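/- Let $k$ be a commutative ring, $A$ a ($\mathbb Z$-graded, cohomological) dg $k$-algebra, $n\ge 0$, $R_n=k[t]/(t^{n+1})$, and let $A_n$ be a cdg deformation of $A$ of order $n$: a cdg algebra structure (a graded $R_n$-algebra structure, a degree $1$ derivation $d$, and a curvature $c\in A_n^2$ with $d(c)=0$ and $d^2=[c,-]$) on the graded $R_n$-module $A\otimes_k R_n$ which reduces modulo $t$ to the dg algebra $A$ (in particular $c\in tA_n$). Let $Z^0A_n\text{-Mod}$ be the category of left cdg $A_n$-modules (graded left $A_n$-modules $M$ with a degree $1$ derivation $d_M$ such that $d_M^2=c$) with morphisms the $A_n$-linear maps of degree $0$ commuting with the predifferentials. A cdg module $M$ is $n$-acyclic if the complexes $t^iM/t^{i+1}M$, $0\le i\le n$, are acyclic; a morphism is an $n$-quasi-isomorphism if its cone is $n$-acyclic. Let $A_i=A_n/t^{i+1}A_n$ and $A_{-1}=0$, let $\pi\colon A_i\to A_{i-1}$ be the projection, and choose $\frac ct\in A_n^2$ with $t\frac ct=c$. For $0\le i\le n$ let $\Gamma_i$ be the cdg $A_n$-module $A_i\oplus A_{i-1}[1]$ with predifferential $(\alpha,a)\mapsto(d\alpha+ta,\,-da+\pi(\alpha\tfrac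 ct))$. A cdg module $P$ is $n$-semifree if it has a filtration by cdg submodules $0=F_0P\subseteq F_1P\subseteq\cdots$ with $P=\bigcup_iF_iP$, whose inclusions $F_iP\hookrightarrow F_{i+1}P$ split as morphisms of graded $A_n$-modules and whose quotients $F_{i+1}P/F_iP$ are isomorphic to direct sums of shifts of the modules $\Gamma_0,\dots,\Gamma_n$. Then $Z^0A_n\text{-Mod}$ carries a cofibrantly generated model structure such that: 1. the weak equivalences are exactly the $n$-quasi-isomorphisms; 2. the fibrations are exactly the morphisms $f\colon M\to N$ such that the induced map $\operatorname{Ker}t^i_M\to\operatorname{Ker}t^i_N$ is surjective for all $i=1,\dots,n+1$, where $t^i_M\colon M\to M$ is the action of $t^i$; 3. the cofibrant objects are exactly the retracts of $n$-semifree modules; 4. the cofibrations are exactly the graded split injections with cofibrant cokernel, i.e. the morphisms $f\colon M\to N$ that have a retraction as morphisms of graded $A_n$-modules and for which $N/f(M)$ is cofibrant. -/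

import Mathlib

open CategoryTheory
open scoped TensorProduct DirectSum

universe v u

noncomputable section

namespace Curved

/-! ### Curved dg algebras and their deformations -/

/-- A cdg algebra over a commutative ring `R`: a `ℤ`-graded associative unital `R`-algebra with a
derivation `d` of degree `1` (the predifferential) and a closed element `c` of degree `2`
(the curvature) such that `d² = [c, -]`. -/
structure CDGAlgebra (R : Type v) [CommRing R] where
  /-- the underlying set -/
  carrier : Type u
  [ring : Ring carrier]
  [algebra : Algebra R carrier]
  /-- the homogeneous components -/
  grading : ℤ → Submodule R carrier
  [gradedAlgebra : GradedAlgebra grading]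
  /-- the predifferential -/
  d : carrier →ₗ[R] carrier
  d_mem : ∀ {i : ℤ} {a : carrier}, a ∈ grading i → d a ∈ grading (i + 1)
  d_mul : ∀ {i : ℤ} {a : carrier} (b : carrier), a ∈ grading i →
    d (a * b) = d a * b + i.negOnePow • (a * d b)
  /-- the curvature -/
  c : carrier
  c_mem : c ∈ grading 2
  d_c : d c = 0
  d_d : ∀ a : carrier, d (d a) = c * a - a * c

attribute [instance] CDGAlgebra.ring CDGAlgebra.algebra CDGAlgebra.gradedAlgebra

/-- A dg algebra is a cdg algebra with zero curvature. -/
structure DGAlgebra (R : Type v) [CommRing R] extends CDGAlgebra.{v, u} R where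
  c_eq_zero : c = 0

/-- `R_n = k[t]/(t^(n+1))`. -/
abbrev TruncPoly (k : Type v) [CommRing k] (n : ℕ) : Type v :=
  AdjoinRoot (Polynomial.X ^ (n + 1) : Polynomial k)

/-- The augmentation `R_n → k` sending `t` to `0`. -/
def TruncPoly.aug (k : Type v) [CommRing k] (n : ℕ) : TruncPoly k n →ₐ[k] k :=
  AdjoinRoot.liftAlgHom _ (Algebra.ofId k k) 0 (by simp)

/-- Reduction modulo `t`, as a map `R_n ⊗ V → k ⊗ V ≅ V`. -/
def TruncPoly.reduce (k : Type v) [CommRing k] (n : ℕ) (V : Type u) [AddCommGroup V] [Module k V] :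
    (TruncPoly k n ⊗[k] V) →ₗ[k] V :=
  (TensorProduct.lid k V).toLinearMap ∘ₗ LinearMap.rTensor V (TruncPoly.aug k n).toLinearMap

/-- A cdg deformation of order `n` of the dg `k`-algebra `A`: a cdg algebra over
`R_n = k[t]/(t^(n+1))` whose underlying graded `R_n`-module is (identified, through `equiv`, with)
`R_n ⊗ A`, and which reduces modulo `t` to the dg algebra `A` (unit, product, differential, and
curvature zero). -/
structure CDGDeformation {k : Type v} [CommRing k] (A : DGAlgebra.{v, u} k) (n : ℕ) extends
    CDGAlgebra.{v, u} (TruncPoly k n) where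
  /-- the identification of the underlying `R_n`-module with `R_n ⊗ A` -/
  equiv : carrier ≃ₗ[TruncPoly k n] (TruncPoly k n ⊗[k] A.carrier)
  mem_grading_iff : ∀ (i : ℤ) (b : carrier),
    b ∈ grading i ↔ equiv b ∈ (A.grading i).baseChange (TruncPoly k n)
  reduce_one : TruncPoly.reduce k n A.carrier (equiv 1) = 1
  reduce_mul : ∀ b b' : carrier, TruncPoly.reduce k n A.carrier (equiv (b * b')) =
    TruncPoly.reduce k n A.carrier (equiv b) * TruncPoly.reduce k n A.carrier (equiv b')
  reduce_d : ∀ b : carrier, TruncPoly.reduce k n A.carrier (equiv (d b)) =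
    A.d (TruncPoly.reduce k n A.carrier (equiv b))
  reduce_c : TruncPoly.reduce k n A.carrier (equiv c) = 0

/-! ### A criterion for gradings -/

/-- A family of subgroups which generates the group and admits a compatible family of projections
is a grading. -/
@[reducible]
def decompositionOfProj {M : Type u} [AddCommGroup M] (ℳ : ℤ → AddSubgroup M)
    (p : ℤ → M →+ M) (h₁ : ∀ i m, m ∈ ℳ i → p i m = m)
    (h₂ : ∀ i j m, i ≠ j → m ∈ ℳ j → p i m = 0) (h₃ : ⨆ i, ℳ i = ⊤) :
    DirectSum.Decomposition ℳ :=
  DirectSum.IsInternal.chooseDecomposition ℳ <| by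
    have key : ∀ (i : ℤ) (x : ⨁ i, ℳ i), p i (DirectSum.coeAddMonoidHom ℳ x) = x i := by
      intro i x
      induction x using DirectSum.induction_on with
      | zero => simp
      | of j y =>
        rw [DirectSum.coeAddMonoidHom_of]
        by_cases h : i = j
        · subst h
          rw [h₁ i y y.2, DirectSum.of_eq_same]
        · rw [h₂ i j y h y.2, DirectSum.of_eq_of_ne _ _ _ h]
          rfl
      | add x y hx hy => simp [map_add, hx, hy]
    constructor
    · intro x y hxy
      refine DFinsupp.ext fun i => Subtype.ext ?_
      rw [← key i x, ← key i y, hxy]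
    · rw [← AddMonoidHom.range_eq_top, eq_top_iff, ← h₃, iSup_le_iff]
      intro i m hm
      exact ⟨DirectSum.of (fun i => ℳ i) i ⟨m, hm⟩, DirectSum.coeAddMonoidHom_of _ _ _⟩

section Algebra

variable {R : Type v} [CommRing R] (B : CDGAlgebra.{v, u} R)

/-- The sign automorphism `a ↦ (-1)^(l|a|) a` of the graded algebra underlying `B`, additively. -/
def CDGAlgebra.signAdd (l : ℤ) : B.carrier →+ B.carrier :=
  (DirectSum.toAddMonoid fun i => (l * i).negOnePow • (B.grading i).subtype.toAddMonoidHom).comp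
    (DirectSum.decomposeAddEquiv B.grading).toAddMonoidHom

lemma CDGAlgebra.signAdd_of_mem (l : ℤ) {i : ℤ} {a : B.carrier} (ha : a ∈ B.grading i) :
    B.signAdd l a = (l * i).negOnePow • a := by
  simp only [signAdd, AddMonoidHom.comp_apply]
  change (DirectSum.toAddMonoid _) (DirectSum.decompose B.grading a) = _
  rw [DirectSum.decompose_of_mem _ ha, DirectSum.toAddMonoid_of]
  rfl

lemma CDGAlgebra.signAdd_mul (l : ℤ) (a b : B.carrier) :
    B.signAdd l (a * b) = B.signAdd l a * B.signAdd l b := by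
  induction a using DirectSum.Decomposition.inductionOn B.grading with
  | zero => simp
  | add x y hx hy => simp [add_mul, hx, hy]
  | @homogeneous i x =>
    induction b using DirectSum.Decomposition.inductionOn B.grading with
    | zero => simp
    | add x y hx hy => simp [mul_add, hx, hy]
    | @homogeneous j y =>
      rw [B.signAdd_of_mem l x.2, B.signAdd_of_mem l y.2,
        B.signAdd_of_mem l (SetLike.mul_mem_graded x.2 y.2), mul_add, Int.negOnePow_add,
        smul_mul_smul_comm]

/-- The sign automorphism `a ↦ (-1)^(l|a|) a` of the graded algebra underlying `B`. -/
def CDGAlgebra.sign (l : ℤ) : B.carrier →+* B.carrier :=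
  { B.signAdd l with
    map_one' := by
      change B.signAdd l 1 = 1
      rw [B.signAdd_of_mem l (SetLike.one_mem_graded B.grading)]
      simp
    map_mul' := B.signAdd_mul l }

lemma CDGAlgebra.sign_of_mem (l : ℤ) {i : ℤ} {a : B.carrier} (ha : a ∈ B.grading i) :
    B.sign l a = (l * i).negOnePow • a :=
  B.signAdd_of_mem l ha

lemma CDGAlgebra.sign_mem (l : ℤ) {i : ℤ} {a : B.carrier} (ha : a ∈ B.grading i) :
    B.sign l a ∈ B.grading i := by
  rw [B.sign_of_mem l ha, Units.smul_def]
  exact zsmul_mem ha _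

lemma CDGAlgebra.sign_c (l : ℤ) : B.sign l B.c = B.c := by
  rw [B.sign_of_mem l B.c_mem, Int.negOnePow_even _ (by simp), one_smul]

lemma CDGAlgebra.d_one : B.d 1 = 0 := by
  have h := B.d_mul 1 (SetLike.one_mem_graded B.grading)
  simpa using h

lemma CDGAlgebra.d_algebraMap (r : R) : B.d (algebraMap R B.carrier r) = 0 := by
  rw [Algebra.algebraMap_eq_smul_one, map_smul, B.d_one, smul_zero]

/-! ### Graded modules with a predifferential, and cdg modules -/

/-- A left qdg module over `B`: a graded left module with a derivation of degree `1`. -/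
structure QDGModule where
  /-- the underlying set -/
  carrier : Type u
  [addCommGroup : AddCommGroup carrier]
  [module : Module B.carrier carrier]
  /-- the homogeneous components -/
  grading : ℤ → AddSubgroup carrier
  [decomposition : DirectSum.Decomposition grading]
  smul_mem : ∀ {i j : ℤ} {a : B.carrier} {m : carrier}, a ∈ B.grading i → m ∈ grading j →
    a • m ∈ grading (i + j)
  /-- the predifferential -/
  d : carrier →+ carrier
  d_mem : ∀ {i : ℤ} {m : carrier}, m ∈ grading i → d m ∈ grading (i + 1)
  d_smul : ∀ {i : ℤ} {a : B.carrier} (m : carrier), a ∈ B.grading i →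
    d (a • m) = B.d a • m + i.negOnePow • (a • d m)

attribute [instance] QDGModule.addCommGroup QDGModule.module QDGModule.decomposition

/-- A left cdg module over `B`: a qdg module whose predifferential squares to the action of the
curvature. -/
structure CDGModule extends QDGModule B where
  d_d : ∀ m : carrier, d (d m) = B.c • m

variable {B}

namespace QDGModule

variable (M : QDGModule B)

lemma iSup_grading : ⨆ i, M.grading i = ⊤ := by
  classical
  rw [eq_top_iff]
  intro m _
  rw [← DirectSum.sum_support_decompose M.grading m]
  exact sum_mem fun i _ => le_iSup M.grading i (SetLike.coe_mem _)

/-- The projection of `M` to its component of degree `i`. -/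
def proj (i : ℤ) : M.carrier →+ M.carrier :=
  ((M.grading i).subtype.comp (DFinsupp.evalAddMonoidHom i)).comp
    (DirectSum.decomposeAddEquiv M.grading).toAddMonoidHom

lemma proj_apply (i : ℤ) (m : M.carrier) :
    M.proj i m = (DirectSum.decompose M.grading m i : M.carrier) := rfl

lemma proj_mem (i : ℤ) (m : M.carrier) : M.proj i m ∈ M.grading i := SetLike.coe_mem _

lemma proj_of_mem {i : ℤ} {m : M.carrier} (hm : m ∈ M.grading i) : M.proj i m = m :=
  DirectSum.decompose_of_mem_same _ hm

lemma proj_of_mem_ne {i j : ℤ} {m : M.carrier} (hij : i ≠ j) (hm : m ∈ M.grading j) :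
    M.proj i m = 0 :=
  DirectSum.decompose_of_mem_ne _ hm hij.symm

lemma proj_of_mem_eq_ite {i j : ℤ} {m : M.carrier} (hm : m ∈ M.grading j) :
    M.proj i m = if i = j then m else 0 := by
  split_ifs with h
  · subst h; exact M.proj_of_mem hm
  · exact M.proj_of_mem_ne h hm

lemma induction {motive : M.carrier → Prop} (m : M.carrier) (zero : motive 0)
    (homogeneous : ∀ (i : ℤ) (m : M.carrier), m ∈ M.grading i → motive m)
    (add : ∀ m m', motive m → motive m' → motive (m + m')) : motive m :=
  DirectSum.Decomposition.inductionOn M.grading zero (fun {i} m => homogeneous i m m.2) add m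

/-- An additive map that has degree `e` commutes with projections. -/
lemma proj_map {M N : QDGModule B} (e : ℤ) (f : M.carrier →+ N.carrier)
    (hf : ∀ {i : ℤ} {m : M.carrier}, m ∈ M.grading i → f m ∈ N.grading (i + e))
    (i : ℤ) (m : M.carrier) : N.proj (i + e) (f m) = f (M.proj i m) := by
  induction m using M.induction with
  | zero => simp
  | add m m' h h' => simp [h, h']
  | homogeneous j m hm =>
    rw [N.proj_of_mem_eq_ite (hf hm), M.proj_of_mem_eq_ite hm]
    by_cases h : i = j <;> simp [h]

/-- The underlying set of the shift `M[l]`; it carries a twisted module structure. -/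
def ShiftCarrier (_ : ℤ) : Type u := M.carrier

instance (l : ℤ) : AddCommGroup (M.ShiftCarrier l) := inferInstanceAs (AddCommGroup M.carrier)

/-- The action on `M[l]`: a homogeneous element `a` acts as `(-1)^(l|a|) a`. -/
instance (l : ℤ) : Module B.carrier (M.ShiftCarrier l) := Module.compHom M.carrier (B.sign l)

/-- The shift `M[l]`: `M[l]^i = M^(i+l)`, with predifferential `(-1)^l d` and with the usual sign
`(-1)^(l|a|)` in the left action. -/
def shift (l : ℤ) : QDGModule B where
  carrier := M.ShiftCarrier l
  grading i := M.grading (i + l)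
  decomposition := decompositionOfProj (M := M.carrier) _ (fun i => M.proj (i + l))
    (fun _ _ hm => M.proj_of_mem hm)
    (fun _ _ _ hij hm => M.proj_of_mem_ne (by simpa using hij) hm)
    ((Equiv.addRight l).iSup_comp (g := M.grading) |>.trans M.iSup_grading)
  smul_mem {i j a m} ha hm := by
    have := M.smul_mem (B.sign_mem l ha) hm
    rwa [← add_assoc] at this
  d := l.negOnePow • M.d
  d_mem {i m} hm := by
    have := M.d_mem hm
    rw [add_right_comm] at this
    change ((l.negOnePow : ℤˣ) : ℤ) • M.d m ∈ M.grading (i + 1 + l)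
    exact zsmul_mem this _
  d_smul {i a} m ha := by
    change l.negOnePow • M.d (B.sign l a • (show M.carrier from m)) =
      (show M.carrier from B.sign l (B.d a) • (show M.carrier from m)) +
        i.negOnePow • (B.sign l a • (l.negOnePow • M.d m))
    have h1 : B.sign l (B.d a) = l.negOnePow • B.d (B.sign l a) := by
      rw [B.sign_of_mem l (B.d_mem ha), B.sign_of_mem l ha, mul_add, mul_one, Int.negOnePow_add,
        Units.smul_def (l * i).negOnePow, map_zsmul, ← Units.smul_def, smul_smul, mul_comm]
    rw [M.d_smul _ (B.sign_mem l ha), h1, smul_add, smul_assoc]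
    congr 1
    rw [smul_comm (B.sign l a) l.negOnePow, smul_comm]

/-- The direct sum of two qdg modules. -/
def prod (N : QDGModule B) : QDGModule B where
  carrier := M.carrier × N.carrier
  grading i := (M.grading i).prod (N.grading i)
  decomposition := decompositionOfProj _ (fun i => (M.proj i).prodMap (N.proj i))
    (fun _ _ hm => Prod.ext (M.proj_of_mem hm.1) (N.proj_of_mem hm.2))
    (fun _ _ _ hij hm => Prod.ext (M.proj_of_mem_ne hij hm.1) (N.proj_of_mem_ne hij hm.2))
    (by
      rw [eq_top_iff]
      rintro ⟨m, n⟩ -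
      rw [show ((m, n) : M.carrier × N.carrier) = (m, 0) + (0, n) by simp]
      refine add_mem ?_ ?_
      · induction m using M.induction with
        | zero => exact zero_mem _
        | add m m' h h' => simpa using add_mem h h'
        | homogeneous i m hm =>
          exact AddSubgroup.mem_iSup_of_mem i ⟨hm, zero_mem _⟩
      · induction n using N.induction with
        | zero => exact zero_mem _
        | add m m' h h' => simpa using add_mem h h'
        | homogeneous i n hn =>
          exact AddSubgroup.mem_iSup_of_mem i ⟨zero_mem _, hn⟩)
  smul_mem ha hm := ⟨M.smul_mem ha hm.1, N.smul_mem ha hm.2⟩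
  d := M.d.prodMap N.d
  d_mem hm := ⟨M.d_mem hm.1, N.d_mem hm.2⟩
  d_smul m ha := Prod.ext (M.d_smul _ ha) (N.d_smul _ ha)

/-- The twist of `M` by a `B`-linear endomorphism `F` of degree `1` (with the Koszul sign
`F (a m) = (-1)^|a| a F m`): the predifferential becomes `d + F`. -/
def twist (F : M.carrier →+ M.carrier)
    (hF : ∀ {i : ℤ} {m : M.carrier}, m ∈ M.grading i → F m ∈ M.grading (i + 1))
    (hF' : ∀ {i : ℤ} {a : B.carrier} (m : M.carrier), a ∈ B.grading i →
      F (a • m) = i.negOnePow • (a • F m)) : QDGModule B where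
  carrier := M.carrier
  grading := M.grading
  smul_mem := M.smul_mem
  d := M.d + F
  d_mem hm := add_mem (M.d_mem hm) (hF hm)
  d_smul m ha := by
    simp only [AddMonoidHom.add_apply, M.d_smul m ha, hF' m ha, smul_add, add_assoc]

/-- The free module `B`, as a qdg module. -/
def self (B : CDGAlgebra.{v, u} R) : QDGModule B where
  carrier := B.carrier
  grading i := (B.grading i).toAddSubgroup
  decomposition :=
    { decompose' := DirectSum.decompose B.grading
      left_inv := (DirectSum.decompose B.grading).left_inv
      right_inv := (DirectSum.decompose B.grading).right_inv }
  smul_mem ha hm := SetLike.mul_mem_graded ha hm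
  d := B.d.toAddMonoidHom
  d_mem := B.d_mem
  d_smul m ha := B.d_mul m ha

end QDGModule

/-- A sub-qdg-module of `M`: a homogeneous `B`-submodule stable under the predifferential. -/
structure QDGSubmodule (M : QDGModule B) where
  /-- the underlying submodule -/
  toSubmodule : Submodule B.carrier M.carrier
  proj_mem : ∀ (i : ℤ) {m : M.carrier}, m ∈ toSubmodule → M.proj i m ∈ toSubmodule
  d_mem : ∀ {m : M.carrier}, m ∈ toSubmodule → M.d m ∈ toSubmodule

namespace QDGSubmodule

variable {M : QDGModule B} (S : QDGSubmodule M)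

/-- A sub-qdg-module, as a qdg module. -/
def toModule : QDGModule B where
  carrier := S.toSubmodule
  grading i := (M.grading i).comap S.toSubmodule.subtype.toAddMonoidHom
  decomposition := decompositionOfProj _
    (fun i => ((M.proj i).comp S.toSubmodule.subtype.toAddMonoidHom).codRestrict S.toSubmodule
      fun m => S.proj_mem i m.2)
    (fun i m hm => Subtype.ext (M.proj_of_mem hm))
    (fun i j m hij hm => Subtype.ext (M.proj_of_mem_ne hij hm))
    (by
      classical
      rw [eq_top_iff]
      intro m _
      have h : m = ∑ i ∈ (DirectSum.decompose M.grading (m : M.carrier)).support,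
          (⟨M.proj i m, S.proj_mem i m.2⟩ : S.toSubmodule) := by
        apply Subtype.ext
        rw [AddSubmonoidClass.coe_finsetSum]
        exact (DirectSum.sum_support_decompose M.grading (m : M.carrier)).symm
      rw [h]
      exact sum_mem fun i _ => AddSubgroup.mem_iSup_of_mem i (M.proj_mem i m))
  smul_mem ha hm := M.smul_mem ha hm
  d := (M.d.comp S.toSubmodule.subtype.toAddMonoidHom).codRestrict S.toSubmodule
      fun m => S.d_mem m.2
  d_mem hm := M.d_mem hm
  d_smul m ha := Subtype.ext (M.d_smul _ ha)

/-- The quotient `M / S`. -/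
def quotient : QDGModule B where
  carrier := M.carrier ⧸ S.toSubmodule
  grading i := (M.grading i).map S.toSubmodule.mkQ.toAddMonoidHom
  decomposition := decompositionOfProj _
    (fun i => QuotientAddGroup.map S.toSubmodule.toAddSubgroup S.toSubmodule.toAddSubgroup
      (M.proj i) (fun _ hm => S.proj_mem i hm))
    (by
      rintro i _ ⟨m, hm, rfl⟩
      exact congrArg S.toSubmodule.mkQ (M.proj_of_mem hm))
    (by
      rintro i j _ hij ⟨m, hm, rfl⟩
      exact (congrArg S.toSubmodule.mkQ (M.proj_of_mem_ne hij hm)).trans (map_zero _))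
    (by
      rw [← AddSubgroup.map_iSup, M.iSup_grading, ← AddMonoidHom.range_eq_map,
        AddMonoidHom.range_eq_top]
      exact S.toSubmodule.mkQ_surjective)
  smul_mem := by
    rintro i j a _ ha ⟨m, hm, rfl⟩
    exact ⟨a • m, M.smul_mem ha hm, rfl⟩
  d := QuotientAddGroup.map S.toSubmodule.toAddSubgroup S.toSubmodule.toAddSubgroup
      M.d (fun _ hm => S.d_mem hm)
  d_mem := by
    rintro i _ ⟨m, hm, rfl⟩
    exact ⟨M.d m, M.d_mem hm, rfl⟩
  d_smul := by
    intro i a m ha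
    obtain ⟨m, rfl⟩ := S.toSubmodule.mkQ_surjective m
    refine (congrArg S.toSubmodule.mkQ (M.d_smul m ha)).trans ?_
    rw [map_add, Units.smul_def, map_zsmul, map_smul, map_smul]
    rfl

/-- The sub-qdg-module `S ∩ T` of `T`. -/
def restrict (S T : QDGSubmodule M) : QDGSubmodule T.toModule where
  toSubmodule := S.toSubmodule.comap T.toSubmodule.subtype
  proj_mem i m hm := by
    have h : M.proj i (T.toSubmodule.subtype m) = T.toSubmodule.subtype (T.toModule.proj i m) := by
      have h' := QDGModule.proj_map (M := T.toModule) (N := M) 0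
        T.toSubmodule.subtype.toAddMonoidHom (fun {i m} hm => by rw [add_zero]; exact hm) i m
      rw [add_zero] at h'
      exact h'
    change T.toSubmodule.subtype (T.toModule.proj i m) ∈ S.toSubmodule
    rw [← h]
    exact S.proj_mem i hm
  d_mem hm := S.d_mem hm

end QDGSubmodule

/-! ### The category `Z⁰(B-Mod)` -/

namespace CDGModule

/-- A closed morphism of degree `0`: a `B`-linear map which preserves degrees and commutes with
the predifferentials. -/
@[ext]
structure Hom (M N : CDGModule B) where
  /-- the underlying linear map -/
  toLinearMap : M.carrier →ₗ[B.carrier] N.carrier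
  map_mem : ∀ {i : ℤ} {m : M.carrier}, m ∈ M.grading i → toLinearMap m ∈ N.grading i
  map_d : ∀ m : M.carrier, toLinearMap (M.d m) = N.d (toLinearMap m)

/-- The category `Z⁰(B-Mod)` of cdg modules over `B` and closed morphisms of degree `0`. -/
instance : Category.{u} (CDGModule B) where
  Hom := Hom
  id M := ⟨LinearMap.id, fun h => h, fun _ => rfl⟩
  comp f g := ⟨g.toLinearMap ∘ₗ f.toLinearMap, fun h => g.map_mem (f.map_mem h), fun m => by
    simp [f.map_d, g.map_d]⟩

/-- The underlying linear map of a morphism. -/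
abbrev linearMap {M N : CDGModule B} (f : M ⟶ N) : M.carrier →ₗ[B.carrier] N.carrier :=
  Hom.toLinearMap f

/-- The shift `M[l]`. -/
def shift (M : CDGModule B) (l : ℤ) : CDGModule B where
  toQDGModule := M.toQDGModule.shift l
  d_d m := by
    have h : ∀ m : M.carrier, l.negOnePow • M.d (l.negOnePow • M.d m) = B.sign l B.c • m := by
      intro m
      rw [B.sign_c, Units.smul_def l.negOnePow (M.d m), map_zsmul, M.d_d, ← Units.smul_def,
        smul_smul, ← Int.negOnePow_add, Int.negOnePow_even _ (Even.add_self l), one_smul]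
    exact h m

/-- A sub-qdg-module of a cdg module, as a cdg module. -/
def sub {M : CDGModule B} (S : QDGSubmodule M.toQDGModule) : CDGModule B where
  toQDGModule := S.toModule
  d_d _ := Subtype.ext (M.d_d _)

/-- The quotient of a cdg module by a sub-qdg-module. -/
def quotient {M : CDGModule B} (S : QDGSubmodule M.toQDGModule) : CDGModule B where
  toQDGModule := S.quotient
  d_d := by
    intro x
    obtain ⟨m, rfl⟩ := S.toSubmodule.mkQ_surjective x
    exact congrArg S.toSubmodule.mkQ (M.d_d m)

/-- The quotient `T / S` for `S ⊆ T ⊆ M` (and `T / (S ∩ T)` in general). -/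
def subquotient {M : CDGModule B} (T S : QDGSubmodule M.toQDGModule) : CDGModule B :=
  quotient (M := sub T) (S.restrict T)

/-- The image of a closed morphism. -/
def range {M N : CDGModule B} (f : M ⟶ N) : QDGSubmodule N.toQDGModule where
  toSubmodule := LinearMap.range (linearMap f)
  proj_mem := by
    rintro i _ ⟨m, rfl⟩
    have h := QDGModule.proj_map (M := M.toQDGModule) (N := N.toQDGModule) 0
      (linearMap f).toAddMonoidHom (fun {i m} hm => by rw [add_zero]; exact f.map_mem hm) i m
    rw [add_zero] at h
    exact ⟨M.proj i m, h.symm⟩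
  d_mem := by
    rintro _ ⟨m, rfl⟩
    exact ⟨M.d m, f.map_d m⟩

/-- The cokernel `N / f(M)` of a closed morphism `f : M ⟶ N`. -/
def coker {M N : CDGModule B} (f : M ⟶ N) : CDGModule B := quotient (range f)

/-- The cone of a closed morphism `f : M ⟶ N`: the direct sum `N ⊕ M[1]` with predifferential
`(y, x) ↦ (d y + f x, - d x)`. -/
def cone {M N : CDGModule B} (f : M ⟶ N) : CDGModule B where
  toQDGModule := (N.toQDGModule.prod (M.toQDGModule.shift 1)).twist
    ((AddMonoidHom.inl N.carrier (M.toQDGModule.shift 1).carrier).comp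
      (AddMonoidHom.comp (linearMap f).toAddMonoidHom
        (AddMonoidHom.snd N.carrier (M.toQDGModule.shift 1).carrier)))
    (fun hm => ⟨f.map_mem hm.2, zero_mem _⟩)
    (fun {i a} m ha => by
      refine Prod.ext ?_ ?_
      · change linearMap f (B.sign 1 a • (show M.carrier from m.2)) =
          i.negOnePow • (a • linearMap f (show M.carrier from m.2))
        rw [map_smul, B.sign_of_mem 1 ha, one_mul, smul_assoc]
      · change (0 : (M.toQDGModule.shift 1).carrier) = i.negOnePow • (a • 0)
        simp)
  d_d := by
    rintro ⟨y, x⟩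
    have hy : ∀ (y : N.carrier) (x : M.carrier), N.d (N.d y + linearMap f x) +
        linearMap f (((1 : ℤ).negOnePow • M.d x) + 0) = B.c • y := by
      intro y x
      rw [map_add, N.d_d, ← Hom.map_d f, Int.negOnePow_one, add_zero, Units.smul_def]
      simp
    have hx : ∀ x : (M.shift 1).carrier, (M.shift 1).d ((M.shift 1).d x + 0) + 0 = B.c • x := by
      intro x
      rw [add_zero, add_zero, (M.shift 1).d_d]
    exact Prod.ext (hy y x) (hx x)

/-- The direct sum of a family of cdg modules. -/
def directSum {ι : Type u} (N : ι → CDGModule B) : CDGModule B where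
  carrier := Π₀ j, (N j).carrier
  grading i :=
    { carrier := {x | ∀ j, x j ∈ (N j).grading i}
      zero_mem' := fun j => zero_mem _
      add_mem' := fun hx hy j => add_mem (hx j) (hy j)
      neg_mem' := fun hx j => neg_mem (hx j) }
  decomposition := decompositionOfProj _
    (fun i => DFinsupp.mapRange.addMonoidHom fun j => (N j).proj i)
    (fun i m hm => DFinsupp.ext fun j => (N j).proj_of_mem (hm j))
    (fun i j m hij hm => DFinsupp.ext fun s => (N s).proj_of_mem_ne hij (hm s))
    (by
      classical
      rw [eq_top_iff]
      intro x _
      induction x using DFinsupp.induction with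
      | h0 => exact zero_mem _
      | ha s b f _ _ ih =>
        refine add_mem ?_ (ih (by simp))
        clear * -
        induction b using (N s).induction with
        | zero => simp
        | add m m' h h' =>
          rw [DFinsupp.single_add]
          exact add_mem h h'
        | homogeneous i m hm =>
          refine AddSubgroup.mem_iSup_of_mem i fun j => ?_
          by_cases h : s = j
          · subst h; simpa using hm
          · rw [DFinsupp.single_eq_of_ne (Ne.symm h)]; exact zero_mem _)
  smul_mem ha hm j := (N j).smul_mem ha (hm j)
  d := DFinsupp.mapRange.addMonoidHom fun j => (N j).d
  d_mem hm j := (N j).d_mem (hm j)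
  d_smul m ha := DFinsupp.ext fun j => (N j).d_smul (m j) ha
  d_d m := DFinsupp.ext fun j => (N j).d_d (m j)

/-- A closed morphism is a graded split injection if it has a retraction in the category of graded
`B`-modules (the retraction need not commute with the predifferentials). -/
def IsGradedSplitInjection {M N : CDGModule B} (f : M ⟶ N) : Prop :=
  ∃ r : N.carrier →ₗ[B.carrier] M.carrier,
    (∀ (i : ℤ) (y : N.carrier), y ∈ N.grading i → r y ∈ M.grading i) ∧
    ∀ x : M.carrier, r (linearMap f x) = x

/-- The inclusion `S ⊆ T` of sub-qdg-modules splits as a morphism of graded modules. -/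
def InclusionGradedSplits {M : CDGModule B} (S T : QDGSubmodule M.toQDGModule) : Prop :=
  ∃ h : S.toSubmodule ≤ T.toSubmodule, IsGradedSplitInjection (M := sub S) (N := sub T)
    ⟨Submodule.inclusion h, fun hm => hm, fun _ => rfl⟩

/-- Let `X` be a family of cdg modules. A cdg module `P` is `X`-semifree if it has an exhaustive
filtration `0 = F 0 ⊆ F 1 ⊆ ⋯` whose inclusions split as morphisms of graded modules and whose
successive quotients are isomorphic to direct sums of shifts of members of `X`. -/
def IsSemifree {J : Type} (X : J → CDGModule B) (P : CDGModule B) : Prop :=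
  ∃ F : ℕ → QDGSubmodule P.toQDGModule,
    (F 0).toSubmodule = ⊥ ∧
    (∀ x : P.carrier, ∃ i, x ∈ (F i).toSubmodule) ∧
    ∀ i, InclusionGradedSplits (F i) (F (i + 1)) ∧
      ∃ (ι : Type u) (s : ι → J) (l : ι → ℤ),
        Nonempty (subquotient (F (i + 1)) (F i) ≅ directSum fun j => (X (s j)).shift (l j))

end CDGModule

end Algebra

/-! ### The modules `Γ_i` -/

open Polynomial in
/-- Division by `t` in `R_n`: it is used to divide the curvature by `t` and to compute the
annihilator of `t`. -/
lemma TruncPoly.exists_divT (k : Type v) [CommRing k] (n : ℕ) :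
    ∃ δ s : TruncPoly k n →ₗ[k] TruncPoly k n,
      (∀ r, r = algebraMap k _ (TruncPoly.aug k n r) + AdjoinRoot.root _ * δ r) ∧
      (∀ r, r = δ (AdjoinRoot.root _ * r) + AdjoinRoot.root _ ^ n * s r) := by
  rcases subsingleton_or_nontrivial k with hk | hk
  · have : Subsingleton (TruncPoly k n) := Module.subsingleton k _
    exact ⟨0, 0, fun r => Subsingleton.elim _ _, fun r => Subsingleton.elim _ _⟩
  have hm : (X ^ (n + 1) : k[X]).Monic := monic_X_pow _
  have hlt : ∀ j, j ≤ n → (X ^ j : k[X]) %ₘ X ^ (n + 1) = X ^ j := fun j hj => by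
    rw [modByMonic_eq_self_iff hm, degree_X_pow, degree_X_pow]
    exact_mod_cast Nat.lt_succ_of_le hj
  have hge : ∀ j, n < j → (X ^ j : k[X]) %ₘ X ^ (n + 1) = 0 := fun j hj =>
    (modByMonic_eq_zero_iff_dvd hm).2 (pow_dvd_pow _ hj)
  let mkL : k[X] →ₗ[k] TruncPoly k n := (AdjoinRoot.mkₐ (X ^ (n + 1) : k[X])).toLinearMap
  let dX : k[X] →ₗ[k] k[X] :=
    { divX_hom with
      map_smul' := fun a p => by
        ext j
        simp [divX_hom] }
  let δ : TruncPoly k n →ₗ[k] TruncPoly k n := mkL ∘ₗ dX ∘ₗ AdjoinRoot.modByMonicHom hm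
  let s : TruncPoly k n →ₗ[k] TruncPoly k n :=
    mkL ∘ₗ monomial 0 ∘ₗ lcoeff k n ∘ₗ AdjoinRoot.modByMonicHom hm
  have hδ : ∀ p : k[X], δ (AdjoinRoot.mk _ p) = AdjoinRoot.mk _ (divX (p %ₘ X ^ (n + 1))) :=
    fun p => rfl
  have hs : ∀ p : k[X], s (AdjoinRoot.mk _ p) =
      AdjoinRoot.mk _ (monomial 0 ((p %ₘ X ^ (n + 1)).coeff n)) := fun p => rfl
  have hz : ∀ j, n < j → (AdjoinRoot.root (X ^ (n + 1) : k[X])) ^ j = 0 := fun j hj => by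
    rw [← AdjoinRoot.mk_X, ← map_pow, AdjoinRoot.mk_eq_zero]
    exact pow_dvd_pow _ hj
  have key : ∀ f g : TruncPoly k n →ₗ[k] TruncPoly k n,
      (∀ j : ℕ, f (AdjoinRoot.root _ ^ j) = g (AdjoinRoot.root _ ^ j)) → ∀ r, f r = g r := by
    intro f g h r
    have : f ∘ₗ mkL = g ∘ₗ mkL := by
      refine Polynomial.lhom_ext' fun j => LinearMap.ext_ring ?_
      have := h j
      rw [← AdjoinRoot.mk_X, ← map_pow] at this
      simpa [mkL, monomial_one_right_eq_X_pow] using this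
    obtain ⟨p, rfl⟩ := AdjoinRoot.mk_surjective r
    exact congrArg (fun F => F p) this
  refine ⟨δ, s, ?_, ?_⟩
  · refine key (LinearMap.id : TruncPoly k n →ₗ[k] TruncPoly k n) (Algebra.linearMap k _ ∘ₗ (TruncPoly.aug k n).toLinearMap +
      LinearMap.mulLeft k (AdjoinRoot.root (X ^ (n + 1) : k[X])) ∘ₗ δ) fun j => ?_
    have ha : TruncPoly.aug k n (AdjoinRoot.root _ ^ j) = 0 ^ j := by
      simp [TruncPoly.aug]
    have hd : AdjoinRoot.root _ * δ (AdjoinRoot.root _ ^ j) =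
        if j = 0 then 0 else AdjoinRoot.root _ ^ j := by
      conv_lhs => rw [← AdjoinRoot.mk_X, ← map_pow, hδ]
      rcases j with _ | j
      · rw [hlt 0 (Nat.zero_le _)]
        simp
      · by_cases h : j + 1 ≤ n
        · rw [hlt _ h, divX_X_pow]
          simp [pow_succ']
        · rw [hge _ (not_le.1 h), hz _ (not_le.1 h)]
          simp
    simp only [LinearMap.id_apply, LinearMap.add_apply, LinearMap.comp_apply,
      LinearMap.mulLeft_apply, AlgHom.toLinearMap_apply, hd, ha]
    rcases j with _ | j <;> simp
  · refine key (LinearMap.id : TruncPoly k n →ₗ[k] TruncPoly k n) (δ ∘ₗ LinearMap.mulLeft k (AdjoinRoot.root (X ^ (n + 1) : k[X])) +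
      LinearMap.mulLeft k (AdjoinRoot.root (X ^ (n + 1) : k[X]) ^ n) ∘ₗ s) fun j => ?_
    have hd : δ (AdjoinRoot.root _ * AdjoinRoot.root _ ^ j) =
        if j < n then AdjoinRoot.root _ ^ j else 0 := by
      conv_lhs => rw [← pow_succ', ← AdjoinRoot.mk_X, ← map_pow, hδ]
      by_cases h : j + 1 ≤ n
      · rw [hlt _ h, if_pos (by omega), divX_X_pow]
        simp
      · rw [hge _ (not_le.1 h), if_neg (by omega)]
        simp
    have hs' : s (AdjoinRoot.root _ ^ j) = if j = n then 1 else 0 := by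
      conv_lhs => rw [← AdjoinRoot.mk_X, ← map_pow, hs]
      by_cases h : j ≤ n
      · rw [hlt _ h, coeff_X_pow]
        by_cases h' : n = j
        · simp [h']
        · simp [h', Ne.symm h']
      · rw [hge _ (not_le.1 h), if_neg (by omega)]
        simp
    simp only [LinearMap.id_apply, LinearMap.add_apply, LinearMap.comp_apply,
      LinearMap.mulLeft_apply, hd, hs']
    rcases lt_trichotomy j n with h | h | h
    · simp [h, h.ne]
    · simp [h]
    · simp [h.not_gt, h.ne', hz _ h]

namespace CDGDeformation

variable {k : Type v} [CommRing k] {A : DGAlgebra.{v, u} k} {n : ℕ} (An : CDGDeformation A n)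

/-- The element `t`. -/
def t : An.carrier := algebraMap (TruncPoly k n) An.carrier (AdjoinRoot.root _)

lemma t_mem : An.t ∈ An.grading 0 :=
  (algebraMap (TruncPoly k n) (An.grading 0) (AdjoinRoot.root _)).2

lemma t_pow_mem (i : ℕ) : An.t ^ i ∈ An.grading 0 := by
  simpa using SetLike.pow_mem_graded i An.t_mem

lemma t_pow_comm (i : ℕ) (a : An.carrier) : An.t ^ i * a = a * An.t ^ i := by
  rw [t, ← map_pow]
  exact Algebra.commutes _ _

lemma t_comm (a : An.carrier) : An.t * a = a * An.t := by
  simpa using An.t_pow_comm 1 a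

lemma d_t_pow (i : ℕ) : An.d (An.t ^ i) = 0 := by
  rw [t, ← map_pow]
  exact An.d_algebraMap _

lemma d_t_pow_mul (i : ℕ) (a : An.carrier) : An.d (An.t ^ i * a) = An.t ^ i * An.d a := by
  rw [An.d_mul a (An.t_pow_mem i), An.d_t_pow]
  simp

lemma exists_t_mul (a : An.carrier) (ha : TruncPoly.reduce k n A.carrier (An.equiv a) = 0) :
    ∃ b, An.t * b = a := by
  obtain ⟨δ, s, h, -⟩ := TruncPoly.exists_divT k n
  have key : ∀ y : TruncPoly k n ⊗[k] A.carrier,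
      y = (1 : TruncPoly k n) ⊗ₜ[k] (TruncPoly.reduce k n A.carrier y) +
        (AdjoinRoot.root _ : TruncPoly k n) • (LinearMap.rTensor A.carrier δ y) := by
    intro y
    induction y with
    | zero => simp
    | add y z hy hz =>
      rw [map_add, map_add, TensorProduct.tmul_add, smul_add, add_add_add_comm, ← hy, ← hz]
    | tmul r a =>
      have h1 : TruncPoly.reduce k n A.carrier (r ⊗ₜ a) = TruncPoly.aug k n r • a := rfl
      rw [h1, LinearMap.rTensor_tmul, TensorProduct.smul_tmul', ← TensorProduct.smul_tmul,
        ← Algebra.algebraMap_eq_smul_one, ← TensorProduct.add_tmul, smul_eq_mul, ← h r]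
  refine ⟨An.equiv.symm (LinearMap.rTensor A.carrier δ (An.equiv a)), An.equiv.injective ?_⟩
  conv_rhs => rw [key (An.equiv a), ha]
  rw [t, ← Algebra.smul_def, map_smul, LinearEquiv.apply_symm_apply]
  simp

lemma exists_t_pow_mul (a : An.carrier) (ha : An.t * a = 0) : ∃ b, An.t ^ n * b = a := by
  obtain ⟨δ, s, -, h⟩ := TruncPoly.exists_divT k n
  have key : ∀ y : TruncPoly k n ⊗[k] A.carrier,
      y = LinearMap.rTensor A.carrier δ ((AdjoinRoot.root _ : TruncPoly k n) • y) +
        (AdjoinRoot.root _ ^ n : TruncPoly k n) • (LinearMap.rTensor A.carrier s y) := by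
    intro y
    induction y with
    | zero => simp
    | add y z hy hz =>
      rw [map_add, smul_add, smul_add, map_add, add_add_add_comm, ← hy, ← hz]
    | tmul r a =>
      rw [TensorProduct.smul_tmul', LinearMap.rTensor_tmul, LinearMap.rTensor_tmul,
        TensorProduct.smul_tmul', ← TensorProduct.add_tmul, smul_eq_mul, smul_eq_mul, ← h r]
  refine ⟨An.equiv.symm (LinearMap.rTensor A.carrier s (An.equiv a)), An.equiv.injective ?_⟩
  have h0 : (AdjoinRoot.root _ : TruncPoly k n) • An.equiv a = 0 := by
    rw [← map_smul, Algebra.smul_def]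
    exact (congrArg An.equiv ha).trans (map_zero _)
  conv_rhs => rw [key (An.equiv a), h0]
  rw [t, ← map_pow, ← Algebra.smul_def, map_smul, LinearEquiv.apply_symm_apply]
  simp

lemma exists_c_div_t : ∃ x ∈ An.grading 2, An.t * x = An.c := by
  obtain ⟨b, hb⟩ := An.exists_t_mul An.c An.reduce_c
  refine ⟨DirectSum.decompose An.grading b 2, SetLike.coe_mem _, ?_⟩
  have h := DirectSum.coe_decompose_mul_of_left_mem_zero An.grading (j := 2) (b := b) An.t_mem
  rw [← h, hb, DirectSum.decompose_of_mem_same _ An.c_mem]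

/-- An element `c/t` of degree `2` with `t (c/t) = c`. It is determined up to `t^n A_n`, which does
not affect the modules `Γ i` below. -/
def cDivT : An.carrier := An.exists_c_div_t.choose

lemma cDivT_mem : An.cDivT ∈ An.grading 2 := An.exists_c_div_t.choose_spec.1

lemma t_mul_cDivT : An.t * An.cDivT = An.c := An.exists_c_div_t.choose_spec.2

/-- The left ideal `t^m A_n` as a sub-qdg-module of the free module `A_n`. -/
def tIdeal (m : ℕ) : QDGSubmodule (QDGModule.self An.toCDGAlgebra) where
  toSubmodule := LinearMap.range (LinearMap.toSpanSingleton An.carrier An.carrier (An.t ^ m))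
  proj_mem := by
    rintro i _ ⟨b, rfl⟩
    have h := QDGModule.proj_map (M := QDGModule.self An.toCDGAlgebra)
      (N := QDGModule.self An.toCDGAlgebra) 0
      (LinearMap.toSpanSingleton An.carrier An.carrier (An.t ^ m)).toAddMonoidHom
      (fun {i b} hb => SetLike.mul_mem_graded (A := An.grading) hb (An.t_pow_mem m)) i b
    rw [add_zero] at h
    exact ⟨_, h.symm⟩
  d_mem := by
    rintro _ ⟨b, rfl⟩
    refine ⟨An.d b, ?_⟩
    change An.d b * An.t ^ m = An.d (b * An.t ^ m)
    rw [← An.t_pow_comm, ← An.t_pow_comm, An.d_t_pow_mul]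

lemma mem_tIdeal {m : ℕ} {a : An.carrier} (b : An.carrier) (h : b * An.t ^ m = a) :
    a ∈ (An.tIdeal m).toSubmodule := ⟨b, h⟩

/-- The qdg `A_n`-module `A_n / t^m A_n`; it is `A_(m-1)` (and zero if `m = 0`). -/
def truncation (m : ℕ) : QDGModule An.toCDGAlgebra := (An.tIdeal m).quotient

/-- The projection `A_n → A_n / t^m A_n`. -/
def toTrunc (m : ℕ) : An.carrier →ₗ[An.carrier] (An.truncation m).carrier := (An.tIdeal m).toSubmodule.mkQ

lemma toTrunc_surjective (m : ℕ) (x : (An.truncation m).carrier) : ∃ a, An.toTrunc m a = x :=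
  (An.tIdeal m).toSubmodule.mkQ_surjective x

lemma toTrunc_mem (m : ℕ) {i : ℤ} {a : An.carrier} (ha : a ∈ An.grading i) :
    An.toTrunc m a ∈ (An.truncation m).grading i := ⟨a, ha, rfl⟩

lemma d_toTrunc (m : ℕ) (a : An.carrier) : (An.truncation m).d (An.toTrunc m a) = An.toTrunc m (An.d a) := rfl

lemma toTrunc_eq_zero (m : ℕ) {a : An.carrier} (b : An.carrier) (h : b * An.t ^ m = a) :
    An.toTrunc m a = 0 :=
  (Submodule.Quotient.mk_eq_zero _).2 (An.mem_tIdeal b h)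

/-- Multiplication by `t`, `A_(i-1) → A_i`. -/
def mulT (i : ℕ) : (An.truncation i).carrier →ₗ[An.carrier] (An.truncation (i + 1)).carrier :=
  Submodule.mapQ _ _ (LinearMap.toSpanSingleton An.carrier An.carrier An.t) <| by
    rintro _ ⟨b, rfl⟩
    refine An.mem_tIdeal b ?_
    change b * An.t ^ (i + 1) = b * An.t ^ i * An.t
    rw [pow_succ An.t, mul_assoc]

lemma mulT_toTrunc (i : ℕ) (a : An.carrier) : An.mulT i (An.toTrunc i a) = An.toTrunc (i + 1) (a * An.t) := rfl

/-- The map `α ↦ π (α (c/t))`, `A_i → A_(i-1)`, with `π` the projection. -/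
def mulCDivT (i : ℕ) : (An.truncation (i + 1)).carrier →ₗ[An.carrier] (An.truncation i).carrier :=
  Submodule.mapQ _ _ (LinearMap.toSpanSingleton An.carrier An.carrier An.cDivT) <| by
    rintro _ ⟨b, rfl⟩
    refine An.mem_tIdeal (b * An.t * An.cDivT) ?_
    change b * An.t * An.cDivT * An.t ^ i = b * An.t ^ (i + 1) * An.cDivT
    rw [mul_assoc, ← An.t_pow_comm, ← mul_assoc, mul_assoc b, ← pow_succ' An.t]

lemma mulCDivT_toTrunc (i : ℕ) (a : An.carrier) :
    An.mulCDivT i (An.toTrunc (i + 1) a) = An.toTrunc i (a * An.cDivT) := rfl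

/-- The `A_n`-linear endomorphism `(α, a) ↦ (t a, π (α (c/t)))` of `A_i ⊕ A_(i-1)[1]`, of
degree `1`. -/
def gammaTwist (i : ℕ) : ((An.truncation (i + 1)).prod ((An.truncation i).shift 1)).carrier →+
    ((An.truncation (i + 1)).prod ((An.truncation i).shift 1)).carrier :=
  AddMonoidHom.prod
    ((An.mulT i).toAddMonoidHom.comp (AddMonoidHom.snd (An.truncation (i + 1)).carrier
      (An.truncation i).carrier))
    ((An.mulCDivT i).toAddMonoidHom.comp (AddMonoidHom.fst (An.truncation (i + 1)).carrier
      (An.truncation i).carrier))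

/-- The qdg module `A_i ⊕ A_(i-1)[1]` twisted by the matrix with entries `t : A_(i-1)[1] → A_i` and
`π ∘ (c/t) : A_i → A_(i-1)[1]`. -/
def gammaQDG (i : ℕ) : QDGModule An.toCDGAlgebra :=
  ((An.truncation (i + 1)).prod ((An.truncation i).shift 1)).twist (An.gammaTwist i)
    (by
      rintro j ⟨_, _⟩ ⟨⟨(a : An.carrier), ha, rfl⟩, ⟨(b : An.carrier), hb, rfl⟩⟩
      refine ⟨?_, ?_⟩
      · have h : An.toTrunc (i + 1) (b * An.t) ∈ (An.truncation (i + 1)).grading (j + 1 + 0) :=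
          An.toTrunc_mem _ (SetLike.mul_mem_graded (A := An.grading) hb An.t_mem)
        rw [add_zero] at h
        exact h
      · have h : An.toTrunc i (a * An.cDivT) ∈ (An.truncation i).grading (j + 2) :=
          An.toTrunc_mem _ (SetLike.mul_mem_graded (A := An.grading) ha An.cDivT_mem)
        rw [show j + 2 = j + 1 + 1 by ring] at h
        exact h)
    (by
      rintro j a ⟨x, y⟩ ha
      have hs : An.sign 1 a = j.negOnePow • a := by rw [An.sign_of_mem 1 ha, one_mul]
      refine Prod.ext ?_ ?_
      · have h : ∀ y : (An.truncation i).carrier,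
            An.mulT i (An.sign 1 a • y) = j.negOnePow • (a • An.mulT i y) := fun y => by
          rw [map_smul, hs, smul_assoc]
        exact h y
      · have h : ∀ x : (An.truncation (i + 1)).carrier,
            An.mulCDivT i (a • x) = j.negOnePow • (An.sign 1 a • An.mulCDivT i x) := fun x => by
          rw [map_smul, hs, smul_assoc, smul_smul, Int.units_mul_self, one_smul]
        exact h x)

lemma d_cDivT : ∃ b, b * An.t ^ n = An.d An.cDivT := by
  have h : An.t * An.d An.cDivT = 0 := by
    have := An.d_t_pow_mul 1 An.cDivT
    rw [pow_one, An.t_mul_cDivT, An.d_c] at this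
    exact this.symm
  obtain ⟨b, hb⟩ := An.exists_t_pow_mul _ h
  exact ⟨b, by rw [← An.t_pow_comm, hb]⟩

lemma toTrunc_d_mul_cDivT {i : ℕ} (hi : i ≤ n) (a : An.carrier) :
    An.toTrunc i (An.d (a * An.cDivT)) = An.toTrunc i (An.d a * An.cDivT) := by
  obtain ⟨b, hb⟩ := An.d_cDivT
  have h0 : ∀ a, An.toTrunc i (a * An.d An.cDivT) = 0 := fun a => by
    refine An.toTrunc_eq_zero i (a * b * An.t ^ (n - i)) ?_
    rw [mul_assoc, ← pow_add An.t, Nat.sub_add_cancel hi, mul_assoc, hb]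
  induction a using DirectSum.Decomposition.inductionOn An.grading with
  | zero => simp
  | add x y hx hy => simp only [add_mul, map_add, hx, hy]
  | @homogeneous j x =>
    rw [An.d_mul _ x.2, map_add, Units.smul_def, map_zsmul, h0, smul_zero, add_zero]

/-- The cdg `A_n`-module `Γ_i = A_i ⊕ A_(i-1)[1]`, `0 ≤ i ≤ n`, with predifferential
`(α, a) ↦ (d α + t a, - d a + π (α (c/t)))`. -/
def gamma (i : Fin (n + 1)) : CDGModule An.toCDGAlgebra where
  toQDGModule := An.gammaQDG i
  d_d := by
    have h₁ : ∀ (x : (An.truncation (i + 1)).carrier) (y : (An.truncation i).carrier),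
        (An.truncation (i + 1)).d ((An.truncation (i + 1)).d x + An.mulT i y) +
          An.mulT i ((1 : ℤ).negOnePow • (An.truncation i).d y + An.mulCDivT i x) =
        An.c • x := by
      intro x y
      obtain ⟨a, rfl⟩ := An.toTrunc_surjective _ x
      obtain ⟨b, rfl⟩ := An.toTrunc_surjective _ y
      rw [Int.negOnePow_one, Units.neg_smul, one_smul]
      simp only [map_add, map_neg, d_toTrunc, mulT_toTrunc, mulCDivT_toTrunc]
      rw [← map_smul, An.d_d, ← An.t_comm b, ← pow_one An.t, An.d_t_pow_mul, pow_one, mul_assoc a,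
        ← An.t_comm An.cDivT, An.t_mul_cDivT, An.t_comm (An.d b), smul_eq_mul, map_sub]
      abel
    have h₂ : ∀ (x : (An.truncation (i + 1)).carrier) (y : (An.truncation i).carrier),
        (1 : ℤ).negOnePow • (An.truncation i).d
            ((1 : ℤ).negOnePow • (An.truncation i).d y + An.mulCDivT i x) +
          An.mulCDivT i ((An.truncation (i + 1)).d x + An.mulT i y) =
        An.sign 1 An.c • y := by
      intro x y
      obtain ⟨a, rfl⟩ := An.toTrunc_surjective _ x
      obtain ⟨b, rfl⟩ := An.toTrunc_surjective _ y
      rw [Int.negOnePow_one, An.sign_c]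
      simp only [Units.neg_smul, one_smul, map_add, map_neg, d_toTrunc, mulT_toTrunc,
        mulCDivT_toTrunc]
      rw [An.toTrunc_d_mul_cDivT (Nat.lt_succ_iff.1 i.2), ← map_smul, An.d_d, mul_assoc b,
        An.t_mul_cDivT, smul_eq_mul, map_sub]
      abel
    rintro ⟨x, y⟩
    exact Prod.ext (h₁ x y) (h₂ x y)

/-! ### Acyclicity, semifree modules, cofibrant generation -/

/-- The submodule `t^i M` of a cdg `A_n`-module `M`. -/
def tPow (M : CDGModule An.toCDGAlgebra) (i : ℕ) : QDGSubmodule M.toQDGModule where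
  toSubmodule :=
    { carrier := {m | ∃ x : M.carrier, An.t ^ i • x = m}
      zero_mem' := ⟨0, smul_zero _⟩
      add_mem' := by
        rintro _ _ ⟨x, rfl⟩ ⟨y, rfl⟩
        exact ⟨x + y, smul_add _ _ _⟩
      smul_mem' := by
        rintro a _ ⟨x, rfl⟩
        exact ⟨a • x, by rw [smul_smul, smul_smul, An.t_pow_comm]⟩ }
  proj_mem := by
    rintro j _ ⟨x, rfl⟩
    have h := QDGModule.proj_map (M := M.toQDGModule) (N := M.toQDGModule) 0
      (DistribSMul.toAddMonoidHom M.carrier (An.t ^ i))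
      (fun {j m} hm => by
        have h := M.smul_mem (An.t_pow_mem i) hm
        rw [add_comm (0 : ℤ) j] at h
        exact h) j x
    rw [add_zero] at h
    exact ⟨_, h.symm⟩
  d_mem := by
    rintro _ ⟨x, rfl⟩
    refine ⟨M.d x, ?_⟩
    rw [M.d_smul x (An.t_pow_mem i), An.d_t_pow]
    simp

/-- The graded piece `Gr_t^i(M) = t^i M / t^(i+1) M` of the `t`-adic filtration, as a cdg
`A_n`-module. It is annihilated by `t`, hence by the curvature, so it is a complex. -/
def gr (M : CDGModule An.toCDGAlgebra) (i : ℕ) : CDGModule An.toCDGAlgebra :=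
  CDGModule.subquotient (An.tPow M i) (An.tPow M (i + 1))

/-- `M` is `n`-acyclic: the complexes `t^i M / t^(i+1) M`, `0 ≤ i ≤ n`, are acyclic. -/
def IsNAcyclic (M : CDGModule An.toCDGAlgebra) : Prop :=
  ∀ i ≤ n, Function.Exact (An.gr M i).d (An.gr M i).d

/-- A closed morphism is an `n`-quasi-isomorphism if its cone is `n`-acyclic. -/
def IsNQuasiIso {M N : CDGModule An.toCDGAlgebra} (f : M ⟶ N) : Prop :=
  An.IsNAcyclic (CDGModule.cone f)

/-- The kernel `Ker t^i_M` of the action of `t^i` on `M`. -/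
def kerTPow (M : CDGModule An.toCDGAlgebra) (i : ℕ) : Set M.carrier :=
  {m | An.t ^ i • m = 0}

/-- `P` is `n`-semifree: it is `{Γ_0, …, Γ_n}`-semifree. -/
def IsNSemifree (P : CDGModule An.toCDGAlgebra) : Prop :=
  CDGModule.IsSemifree An.gamma P

end CDGDeformation

/-- A model category is cofibrantly generated if there are sets `I` and `J` of morphisms which
permit the small object argument, such that the trivial fibrations are the maps with the right
lifting property with respect to `I`, and the fibrations are those with the right lifting property
with respect to `J`. -/
def IsCofibrantlyGenerated (C : Type (u + 1)) [Category.{u} C]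
    [HomotopicalAlgebra.ModelCategory C] : Prop :=
  ∃ I J : MorphismProperty C,
    MorphismProperty.HasSmallObjectArgument.{u} I ∧
    MorphismProperty.HasSmallObjectArgument.{u} J ∧
    HomotopicalAlgebra.trivialFibrations C = I.rlp ∧
    HomotopicalAlgebra.fibrations C = J.rlp

end Curved

end

noncomputable section

/-! ### The additive category of cdg modules and its limits and colimits -/

namespace Curved

open CategoryTheory.Limits

section Algebra

variable {R : Type v} [CommRing R] {B : CDGAlgebra.{v, u} R}

namespace CDGModule

/-! ### Elementary properties of closed morphisms -/

/-! Everything is detected by the complexes Hom(Γ_i, M). As a graded module Γ_i is generated by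
(1,0) and (0,1), killed by t^(i+1) and t^i respectively, so a map Γ_i → M of degree j is a pair (x,
y) in Ker t^(i+1) × Ker t^i with x of degree j and y of degree j-1. The differential becomes D(x, y)
= (dx - (c/t)y, tx - dy) (`homGroup`, `homD`, `gammaLift_d`).

The first point is that M is n-acyclic iff Hom(Γ_i, M) is acyclic for all i ≤ n (`isNAcyclic_iff`).
The bridge is the family of complexes K_i = t^i M ∩ Ker t. Multiplication by t gives exact sequences
0 → K_i/K_(i+1) → Gr^i M → Gr^(i+1) M → 0, so all Gr^i are acyclic iff all K_i are. On the other
side Hom(Γ_0, M) = K_0, and Hom(Γ_(i+1), M)/Hom(Γ_i, M) is, up to shift, the cone of the inclusion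
K_(i+1) ⊆ K_i. Since Hom(Γ_i, cone f) is the cone of Hom(Γ_i, f), n-quasi-isomorphisms are the maps
inducing quasi-isomorphisms on all Hom(Γ_i, -), which gives two-out-of-three.

Closed maps Γ_i[l] → M are cycles of degree -l in Hom(Γ_i, M), and closed maps cone(id of Γ_i[l]) →
M are arbitrary elements of degree -l-1, restriction to Γ_i[l] being D. Hence lifting against 0 →
cone(id) is surjectivity on Hom(Γ_i, -), that is on Ker t^i for 1 ≤ i ≤ n+1, while lifting against
Γ_i[l] → cone(id) says that Hom(Γ_i, f) is a surjective quasi-isomorphism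
(`generatingTrivialCofibrations_rlp_iff`, `generatingCofibrations_rlp_iff`). Elements of Hom(Γ_i, -)
are pairs subject to finitely many equations, so the sources are finitely presentable enough for the
small object argument to stop at ω.

A map with the left lifting property against all fibrations has a closed retraction, because every
object is fibrant, and is a homotopy equivalence, because N receives a fibration from the cone of
the identity of N[-1]. So it is a weak equivalence, and the retract argument identifies trivial
cofibrations (`generatingTrivialCofibrations_rlp_llp`).

Cofibrations are graded split because M → cone(id_M) extends along them. Conversely, a graded split
injection with cofibrant cokernel Q lifts against a trivial fibration p: the obstruction is a closed
map Q → cone(p), which lifts through the trivial fibration cone(id) → cone(p)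
(`generatingCofibrations_llp_iff`). Finally, cell complexes of length ω starting at 0 are
n-semifree, and a cofibrant Q is a retract of the one that the small object argument attaches to 0 →
Q (`llp_initial_iff_exists_retract`). -/

lemma hom_ext' {M N : CDGModule B} {f g : M ⟶ N}
    (h : ∀ x : M.carrier, linearMap f x = linearMap g x) : f = g :=
  Hom.ext (LinearMap.ext h)

@[simp]
lemma linearMap_comp {M N P : CDGModule B} (f : M ⟶ N) (g : N ⟶ P) (x : M.carrier) :
    linearMap (f ≫ g) x = linearMap g (linearMap f x) := rfl

@[simp]
lemma linearMap_id (M : CDGModule B) (x : M.carrier) : linearMap (𝟙 M) x = x := rfl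

lemma linearMap_d {M N : CDGModule B} (f : M ⟶ N) (x : M.carrier) :
    linearMap f (M.d x) = N.d (linearMap f x) := Hom.map_d f x

lemma linearMap_mem {M N : CDGModule B} (f : M ⟶ N) {i : ℤ} {x : M.carrier}
    (hx : x ∈ M.grading i) : linearMap f x ∈ N.grading i := Hom.map_mem f hx

lemma linearMap_proj {M N : CDGModule B} (f : M ⟶ N) (i : ℤ) (x : M.carrier) :
    linearMap f (M.proj i x) = N.proj i (linearMap f x) := by
  have h := QDGModule.proj_map (M := M.toQDGModule) (N := N.toQDGModule) 0
    (linearMap f).toAddMonoidHom (fun {i m} hm => by rw [add_zero]; exact linearMap_mem f hm) i x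
  rw [add_zero] at h
  exact h.symm

/-- Construct a closed morphism of degree `0`. -/
def mkHom {M N : CDGModule B} (f : M.carrier →ₗ[B.carrier] N.carrier)
    (h₁ : ∀ {i : ℤ} {m : M.carrier}, m ∈ M.grading i → f m ∈ N.grading i)
    (h₂ : ∀ m : M.carrier, f (M.d m) = N.d (f m)) : M ⟶ N :=
  ⟨f, h₁, h₂⟩

lemma linearMap_eq_of_comp_eq {M N P Q : CDGModule B} {f : M ⟶ N} {g : N ⟶ Q} {f' : M ⟶ P}
    {g' : P ⟶ Q} (h : f ≫ g = f' ≫ g') (x : M.carrier) :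
    linearMap g (linearMap f x) = linearMap g' (linearMap f' x) :=
  congrArg (fun φ => linearMap φ x) h

lemma linearMap_eq_of_comp_eq' {M N Q : CDGModule B} {f : M ⟶ N} {g : N ⟶ Q} {f' : M ⟶ Q}
    (h : f ≫ g = f') (x : M.carrier) : linearMap g (linearMap f x) = linearMap f' x :=
  congrArg (fun φ => linearMap φ x) h

/-! ### The preadditive structure -/

instance {M N : CDGModule B} : Zero (M ⟶ N) :=
  ⟨mkHom 0 (fun _ => zero_mem _) (fun _ => by simp)⟩

instance {M N : CDGModule B} : Add (M ⟶ N) :=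
  ⟨fun f g => mkHom (linearMap f + linearMap g)
    (fun h => add_mem (linearMap_mem f h) (linearMap_mem g h))
    (fun m => by simp [linearMap_d])⟩

instance {M N : CDGModule B} : Neg (M ⟶ N) :=
  ⟨fun f => mkHom (-linearMap f) (fun h => neg_mem (linearMap_mem f h))
    (fun m => by simp [linearMap_d])⟩

lemma linearMap_zero {M N : CDGModule B} (x : M.carrier) :
    linearMap (0 : M ⟶ N) x = 0 := rfl

lemma linearMap_add {M N : CDGModule B} (f g : M ⟶ N) (x : M.carrier) :
    linearMap (f + g) x = linearMap f x + linearMap g x := rfl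

lemma linearMap_neg {M N : CDGModule B} (f : M ⟶ N) (x : M.carrier) :
    linearMap (-f) x = -linearMap f x := rfl

instance {M N : CDGModule B} : AddCommGroup (M ⟶ N) :=
  { AddGroup.ofLeftAxioms
      (fun f g h => hom_ext' fun x => by simp only [linearMap_add, add_assoc])
      (fun f => hom_ext' fun x => by simp only [linearMap_add, linearMap_zero, zero_add])
      (fun f => hom_ext' fun x => by
        simp only [linearMap_add, linearMap_zero, linearMap_neg, neg_add_cancel]) with
    add_comm := fun f g => hom_ext' fun x => by simp only [linearMap_add, add_comm] }

instance : Preadditive (CDGModule B) where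
  add_comp _ _ _ f f' g := hom_ext' fun x => by
    simp only [linearMap_add, linearMap_comp, map_add]
  comp_add _ _ _ f g g' := hom_ext' fun x => by
    simp only [linearMap_add, linearMap_comp]

lemma linearMap_sub {M N : CDGModule B} (f g : M ⟶ N) (x : M.carrier) :
    linearMap (f - g) x = linearMap f x - linearMap g x := by
  rw [sub_eq_add_neg, sub_eq_add_neg]
  rfl

lemma eq_zero_of_isInitial {M : CDGModule B} (hM : IsInitial M) (x : M.carrier) : x = 0 := by
  have h : 𝟙 M = 0 := hM.hom_ext _ _
  exact congrArg (fun f => linearMap f x) h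

/-! ### Submodules and quotients -/

/-- The inclusion of a submodule. -/
def subι {M : CDGModule B} (S : QDGSubmodule M.toQDGModule) : sub S ⟶ M :=
  mkHom (M := sub S) S.toSubmodule.subtype (fun h => h) (fun _ => rfl)

/-- The inclusion between submodules. -/
def subMap {M : CDGModule B} {S T : QDGSubmodule M.toQDGModule}
    (h : S.toSubmodule ≤ T.toSubmodule) : sub S ⟶ sub T :=
  mkHom (M := sub S) (N := sub T) (Submodule.inclusion h) (fun hm => hm) (fun _ => rfl)

/-- A morphism with values in a submodule. -/
def subLift {M N : CDGModule B} (S : QDGSubmodule M.toQDGModule) (f : N ⟶ M)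
    (h : ∀ x, linearMap f x ∈ S.toSubmodule) : N ⟶ sub S :=
  mkHom (N := sub S) ((linearMap f).codRestrict S.toSubmodule h)
    (fun hm => linearMap_mem f hm) (fun m => Subtype.ext (linearMap_d f m))

/-- The kernel of a closed morphism. -/
def ker {M N : CDGModule B} (f : M ⟶ N) : QDGSubmodule M.toQDGModule where
  toSubmodule := LinearMap.ker (linearMap f)
  proj_mem := by
    intro i m hm
    rw [LinearMap.mem_ker] at hm ⊢
    rw [linearMap_proj, hm, map_zero]
  d_mem := by
    intro m hm
    rw [LinearMap.mem_ker] at hm ⊢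
    rw [linearMap_d, hm, map_zero]

/-- The projection to a quotient. -/
def quotientπ {M : CDGModule B} (S : QDGSubmodule M.toQDGModule) : M ⟶ quotient S :=
  mkHom (N := quotient S) S.toSubmodule.mkQ (fun {_ m} h => ⟨m, h, rfl⟩) (fun _ => rfl)

lemma quotientπ_surjective {M : CDGModule B} (S : QDGSubmodule M.toQDGModule) :
    Function.Surjective (linearMap (quotientπ S)) := S.toSubmodule.mkQ_surjective

lemma quotientπ_eq_zero_iff {M : CDGModule B} (S : QDGSubmodule M.toQDGModule) (x : M.carrier) :
    linearMap (quotientπ S) x = 0 ↔ x ∈ S.toSubmodule :=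
  Submodule.Quotient.mk_eq_zero _

/-- The morphism from the target of a surjective morphism `π : M ⟶ Q` induced by a morphism from
`M` which vanishes on the kernel of `π`. -/
lemma exists_desc {M Q N : CDGModule B} (π : M ⟶ Q) (hπ : Function.Surjective (linearMap π))
    (f : M ⟶ N) (h : ∀ x, linearMap π x = 0 → linearMap f x = 0) : ∃ g : Q ⟶ N, π ≫ g = f := by
  have hk : LinearMap.ker (linearMap π) ≤ LinearMap.ker (linearMap f) := fun x hx => h x hx
  let g : Q.carrier →ₗ[B.carrier] N.carrier :=
    (Submodule.liftQ _ (linearMap f) hk) ∘ₗ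
      ((linearMap π).quotKerEquivOfSurjective hπ).symm.toLinearMap
  have hg : ∀ x, g (linearMap π x) = linearMap f x := fun x => by
    have : ((linearMap π).quotKerEquivOfSurjective hπ).symm (linearMap π x) =
        (LinearMap.ker (linearMap π)).mkQ x := by
      rw [LinearEquiv.symm_apply_eq]
      rfl
    simp [g, this]
  refine ⟨mkHom g (fun {i q} hq => ?_) (fun q => ?_), hom_ext' hg⟩
  · obtain ⟨x, rfl⟩ := hπ q
    -- A homogeneous element of `Q` is the image of a homogeneous element: project any preimage to
    -- the right degree.
    rw [← Q.proj_of_mem hq, ← linearMap_proj, hg]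
    exact linearMap_mem f (M.proj_mem i x)
  · obtain ⟨x, rfl⟩ := hπ q
    rw [← linearMap_d, hg, hg, linearMap_d]

lemma epi_of_surjective {M Q : CDGModule B} (π : M ⟶ Q)
    (hπ : Function.Surjective (linearMap π)) : Epi π := ⟨fun _ _ h => hom_ext' fun q => by
  obtain ⟨x, rfl⟩ := hπ q
  exact congrArg (fun φ => linearMap φ x) h⟩

lemma mono_of_injective {M Q : CDGModule B} (π : M ⟶ Q)
    (hπ : Function.Injective (linearMap π)) : Mono π := ⟨fun _ _ h => hom_ext' fun q =>
  hπ (congrArg (fun φ => linearMap φ q) h)⟩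

lemma comp_quotientπ_range {M N : CDGModule B} (f : M ⟶ N) : f ≫ quotientπ (range f) = 0 :=
  hom_ext' fun x => (quotientπ_eq_zero_iff (range f) (linearMap f x)).2 ⟨x, rfl⟩

scoped instance : HasCokernels (CDGModule B) where
  has_colimit {M N} f := by
    have : Epi (quotientπ (range f)) := epi_of_surjective _ (quotientπ_surjective _)
    refine ⟨⟨⟨_, CokernelCofork.IsColimit.ofπ' (quotientπ (range f)) (comp_quotientπ_range f)
      fun {Z} k hk => ?_⟩⟩⟩
    have h := exists_desc (quotientπ (range f)) (quotientπ_surjective _) k fun x hx => by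
      obtain ⟨y, rfl⟩ := (quotientπ_eq_zero_iff _ x).1 hx
      exact congrArg (fun φ => linearMap φ y) hk
    exact ⟨h.choose, h.choose_spec⟩

scoped instance : HasKernels (CDGModule B) where
  has_limit {M N} f := by
    have : Mono (subι (ker f)) := mono_of_injective _ Subtype.val_injective
    refine ⟨⟨⟨_, KernelFork.IsLimit.ofι' (subι (ker f)) (hom_ext' fun x => x.2)
      fun {Z} k hk => ⟨subLift (ker f) k fun x => congrArg (fun φ => linearMap φ x) hk, rfl⟩⟩⟩⟩

/-! ### Direct sums -/

section DirectSum

variable {ι : Type u} (N : ι → CDGModule B)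

open Classical in
/-- The inclusion of a summand in a direct sum, as a linear map. -/
def directSumLsingle (j : ι) : (N j).carrier →ₗ[B.carrier] (directSum N).carrier where
  toFun x := (DFinsupp.single j x : Π₀ j, (N j).carrier)
  map_add' x y := DFinsupp.single_add (β := fun j => (N j).carrier) j x y
  map_smul' c x := DFinsupp.single_smul (β := fun j => (N j).carrier) (i := j) c x

open Classical in
/-- The inclusion of a summand in a direct sum. -/
def directSumι (j : ι) : N j ⟶ directSum N :=
  mkHom (N := directSum N) (directSumLsingle N j)
    (fun {i m} hm s => by
      change (DFinsupp.single j m : Π₀ j, (N j).carrier) s ∈ (N s).grading i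
      by_cases h : j = s
      · subst h; simpa using hm
      · rw [DFinsupp.single_eq_of_ne (Ne.symm h)]; exact zero_mem _)
    (fun m => (DFinsupp.mapRange_single (f := fun j => (N j).d)
      (hf := fun j => map_zero (N j).d)).symm)

variable {N}

open Classical in
lemma directSum_induction {motive : (directSum N).carrier → Prop} (x : (directSum N).carrier)
    (zero : motive 0) (ι : ∀ j x, motive (linearMap (directSumι N j) x))
    (add : ∀ x y, motive x → motive y → motive (x + y)) : motive x := by
  classical
  exact DFinsupp.induction (p := motive) x zero fun j b f _ _ hf => add _ _ (ι j b) hf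

lemma directSum_hom_ext {X : CDGModule B} {f g : directSum N ⟶ X}
    (h : ∀ j, directSumι N j ≫ f = directSumι N j ≫ g) : f = g := by
  refine hom_ext' fun x => ?_
  induction x using directSum_induction with
  | zero => simp only [map_zero]
  | ι j x => exact congrArg (fun φ => linearMap φ x) (h j)
  | add x y hx hy => rw [map_add, map_add, hx, hy]

open Classical in
/-- The linear map from a direct sum induced by a family of linear maps. -/
def directSumLift {X : CDGModule B} (f : ∀ j, (N j).carrier →ₗ[B.carrier] X.carrier) :
    (directSum N).carrier →ₗ[B.carrier] X.carrier :=
  (DFinsupp.lsum ℕ f : (Π₀ j, (N j).carrier) →ₗ[B.carrier] X.carrier)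

lemma directSumLift_ι {X : CDGModule B} (f : ∀ j, (N j).carrier →ₗ[B.carrier] X.carrier) (j : ι)
    (x : (N j).carrier) : directSumLift f (linearMap (directSumι N j) x) = f j x := by
  classical
  exact DFinsupp.lsum_single ℕ f j x

/-- The morphism from a direct sum induced by a family of morphisms. -/
def directSumDesc {X : CDGModule B} (f : ∀ j, N j ⟶ X) : directSum N ⟶ X :=
  mkHom (directSumLift fun j => linearMap (f j))
    (fun {i m} hm => by
      classical
      exact dfinsuppSumAddHom_mem (X.grading i) (m : Π₀ j, (N j).carrier) _
        fun j _ => linearMap_mem (f j) (hm j))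
    (fun m => by
      induction m using directSum_induction with
      | zero => simp only [map_zero]
      | ι j x => rw [← linearMap_d, directSumLift_ι, directSumLift_ι, linearMap_d]
      | add x y hx hy => rw [map_add, map_add, map_add, map_add, hx, hy])

@[simp]
lemma directSumι_desc {X : CDGModule B} (f : ∀ j, N j ⟶ X) (j : ι) :
    directSumι N j ≫ directSumDesc f = f j :=
  hom_ext' fun x => directSumLift_ι (fun j => linearMap (f j)) j x

lemma directSumDesc_ι_apply {X : CDGModule B} (f : ∀ j, N j ⟶ X) (j : ι) (x : (N j).carrier) :
    linearMap (directSumDesc f) (linearMap (directSumι N j) x) = linearMap (f j) x :=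
  congrArg (fun φ => linearMap φ x) (directSumι_desc f j)

end DirectSum

scoped instance : HasCoproducts.{u} (CDGModule B) :=
  hasCoproducts_of_colimit_cofans (fun f => Cofan.mk (directSum f) (directSumι f)) fun f =>
    Cofan.IsColimit.mk _ (fun s => directSumDesc s.inj) (fun s j => directSumι_desc _ j)
      (fun s m hm => directSum_hom_ext fun j => by
        rw [directSumι_desc]; exact hm j)

scoped instance : HasColimitsOfSize.{u, u} (CDGModule B) :=
  have : HasCoequalizers (CDGModule B) := Preadditive.hasCoequalizers_of_hasCokernels
  has_colimits_of_hasCoequalizers_and_coproducts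

scoped instance : HasFiniteColimits (CDGModule B) := by
  have : HasColimitsOfSize.{0, 0} (CDGModule B) := hasColimitsOfSizeShrink.{0, 0, u, u} _
  infer_instance

-- Finite products come for free as biproducts from the coproducts, so only kernels are needed.
scoped instance : HasFiniteLimits (CDGModule B) :=
  have : HasEqualizers (CDGModule B) := Preadditive.hasEqualizers_of_hasKernels
  have : HasFiniteBiproducts (CDGModule B) := HasFiniteBiproducts.of_hasFiniteCoproducts
  hasFiniteLimits_of_hasEqualizers_and_finite_products

end CDGModule

end Algebra

end Curved

namespace Curved

open CategoryTheory.Limits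
open scoped CDGModule

section Algebra

variable {R : Type v} [CommRing R] {B : CDGAlgebra.{v, u} R}

namespace CDGModule

/-! ### Colimits indexed by linear orders -/

section Colimit

variable {J : Type u} [LinearOrder J] (F : J ⥤ CDGModule B)

/-- The transition map to `F.obj j`, extended by zero to the summands with index not `≤ j`. -/
def evalStage (j : J) : directSum F.obj ⟶ F.obj j :=
  -- The value 0 is a harmless default: only the behaviour for all large `j` is used, and an element
  -- of the direct sum involves finitely many indices.
  directSumDesc fun i => if h : i ≤ j then F.map (homOfLE h) else 0

lemma evalStage_ι {i j : J} (h : i ≤ j) (x : (F.obj i).carrier) :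
    linearMap (evalStage F j) (linearMap (directSumι F.obj i) x) =
      linearMap (F.map (homOfLE h)) x := by
  rw [evalStage, directSumDesc_ι_apply, dif_pos h]

/-- The elements of the direct sum which vanish in the colimit. -/
def colimitRel [Nonempty J] : QDGSubmodule (directSum F.obj).toQDGModule where
  toSubmodule :=
    { carrier := {x | ∃ j₀, ∀ j, j₀ ≤ j → linearMap (evalStage F j) x = 0}
      zero_mem' := ⟨Classical.arbitrary J, fun j _ => map_zero _⟩
      add_mem' := by
        rintro x y ⟨i, hi⟩ ⟨j, hj⟩
        refine ⟨max i j, fun l hl => ?_⟩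
        rw [map_add, hi l ((le_max_left i j).trans hl), hj l ((le_max_right i j).trans hl),
          add_zero]
      smul_mem' := by
        rintro a x ⟨i, hi⟩
        exact ⟨i, fun l hl => by rw [map_smul, hi l hl, smul_zero]⟩ }
  proj_mem := by
    rintro i x ⟨j, hj⟩
    exact ⟨j, fun l hl => by rw [linearMap_proj, hj l hl, map_zero]⟩
  d_mem := by
    rintro x ⟨j, hj⟩
    exact ⟨j, fun l hl => by rw [linearMap_d, hj l hl, map_zero]⟩

/-- A cocone whose legs have the smallest possible kernels. -/
def colimitCocone [Nonempty J] : Cocone F where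
  pt := quotient (colimitRel F)
  ι :=
    { app := fun j => directSumι F.obj j ≫ quotientπ (colimitRel F)
      naturality := by
        intro i i' f
        refine hom_ext' fun x => ?_
        change linearMap (quotientπ (colimitRel F))
            (linearMap (directSumι F.obj i') (linearMap (F.map f) x)) =
          linearMap (quotientπ (colimitRel F)) (linearMap (directSumι F.obj i) x)
        rw [← sub_eq_zero, ← map_sub, quotientπ_eq_zero_iff]
        refine ⟨i', fun j hj => ?_⟩
        rw [map_sub, evalStage_ι F hj, evalStage_ι F ((leOfHom f).trans hj),
          linearMap_eq_of_comp_eq' (F.map_comp f (homOfLE hj)).symm, sub_eq_zero]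
        rfl }

variable {F}

/-- The colimit maps to `colimitCocone F`, so an element that dies in the colimit dies there; by
construction it then dies at all late stages. No explicit model of the colimit is needed. -/
lemma exists_map_eq_zero_of_isColimit {c : Cocone F} (hc : IsColimit c) {i : J}
    {x : (F.obj i).carrier} (hx : linearMap (c.ι.app i) x = 0) :
    ∃ (j : J) (h : i ≤ j), linearMap (F.map (homOfLE h)) x = 0 := by
  have : Nonempty J := ⟨i⟩
  have h : linearMap ((colimitCocone F).ι.app i) x = 0 := by
    rw [← linearMap_eq_of_comp_eq' (hc.fac (colimitCocone F) i), hx, map_zero]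
  obtain ⟨j, hj⟩ := (quotientπ_eq_zero_iff (colimitRel F) _).1 h
  exact ⟨max i j, le_max_left _ _, by
    rw [← evalStage_ι F (le_max_left i j)]
    exact hj _ (le_max_right i j)⟩

end Colimit

section Colimit

variable {J : Type*} [LinearOrder J] {F : J ⥤ CDGModule B}

lemma cocone_naturality (c : Cocone F) {i j : J} (h : i ≤ j) (x : (F.obj i).carrier) :
    linearMap (c.ι.app j) (linearMap (F.map (homOfLE h)) x) = linearMap (c.ι.app i) x :=
  linearMap_eq_of_comp_eq' (c.w (homOfLE h)) x

lemma map_homOfLE_trans {i j l : J} (h : i ≤ j) (h' : j ≤ l) (x : (F.obj i).carrier) :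
    linearMap (F.map (homOfLE h')) (linearMap (F.map (homOfLE h)) x) =
      linearMap (F.map (homOfLE (h.trans h'))) x :=
  linearMap_eq_of_comp_eq' (F.map_comp (homOfLE h) (homOfLE h')).symm x

/-- Since `J` is linearly ordered, the union of the images of the legs is a submodule. The
projection to the quotient by it kills all legs, hence is zero by the universal property. -/
lemma exists_eq_of_isColimit [Nonempty J] {c : Cocone F} (hc : IsColimit c) (x : c.pt.carrier) :
    ∃ (j : J) (y : (F.obj j).carrier), linearMap (c.ι.app j) y = x := by
  let S : QDGSubmodule c.pt.toQDGModule :=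
    { toSubmodule :=
        { carrier := {x | ∃ (j : J) (y : (F.obj j).carrier), linearMap (c.ι.app j) y = x}
          zero_mem' := ⟨Classical.arbitrary J, 0, map_zero _⟩
          add_mem' := by
            rintro _ _ ⟨i, x, rfl⟩ ⟨j, y, rfl⟩
            exact ⟨max i j, linearMap (F.map (homOfLE (le_max_left i j))) x +
              linearMap (F.map (homOfLE (le_max_right i j))) y, by
                rw [map_add, cocone_naturality, cocone_naturality]⟩
          smul_mem' := by
            rintro a _ ⟨j, y, rfl⟩
            exact ⟨j, a • y, map_smul _ _ _⟩ }
      proj_mem := by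
        rintro i _ ⟨j, y, rfl⟩
        exact ⟨j, _, linearMap_proj _ _ _⟩
      d_mem := by
        rintro _ ⟨j, y, rfl⟩
        exact ⟨j, _, linearMap_d _ _⟩ }
  have h : quotientπ S = 0 := hc.hom_ext fun j => hom_ext' fun y =>
    (quotientπ_eq_zero_iff S _).2 ⟨j, y, rfl⟩
  exact (quotientπ_eq_zero_iff S x).1 (congrArg (fun φ => linearMap φ x) h)

lemma exists_homogeneous_eq_of_isColimit [Nonempty J] {c : Cocone F} (hc : IsColimit c) {i : ℤ}
    {x : c.pt.carrier} (hx : x ∈ c.pt.grading i) :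
    ∃ (j : J) (y : (F.obj j).carrier), y ∈ (F.obj j).grading i ∧ linearMap (c.ι.app j) y = x := by
  obtain ⟨j, y, rfl⟩ := exists_eq_of_isColimit hc x
  exact ⟨j, _, (F.obj j).proj_mem i y, by rw [linearMap_proj]; exact c.pt.proj_of_mem hx⟩

end Colimit

end CDGModule

end Algebra

end Curved

/-! ### Sign bookkeeping for shifts and cones -/

namespace Curved

open CategoryTheory.Limits
open scoped CDGModule

section Algebra

variable {R : Type v} [CommRing R] {B : CDGAlgebra.{v, u} R}

/-! ### Signs -/

namespace CDGAlgebra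

lemma induction {motive : B.carrier → Prop} (a : B.carrier) (zero : motive 0)
    (homogeneous : ∀ (i : ℤ) (a : B.carrier), a ∈ B.grading i → motive a)
    (add : ∀ a b, motive a → motive b → motive (a + b)) : motive a :=
  DirectSum.Decomposition.inductionOn B.grading zero (fun {i} m => homogeneous i m m.2) add a

lemma sign_sign (l m : ℤ) (a : B.carrier) : B.sign l (B.sign m a) = B.sign (l + m) a := by
  induction a using B.induction with
  | zero => simp
  | add a b ha hb => simp only [map_add, ha, hb]
  | homogeneous i a ha =>
    rw [B.sign_of_mem l (B.sign_mem m ha), B.sign_of_mem m ha, B.sign_of_mem _ ha, smul_smul,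
      add_mul, Int.negOnePow_add]

lemma sign_even {l : ℤ} (hl : Even l) (a : B.carrier) : B.sign l a = a := by
  induction a using B.induction with
  | zero => simp
  | add a b ha hb => simp only [map_add, ha, hb]
  | homogeneous i a ha => rw [B.sign_of_mem l ha, Int.negOnePow_even _ (hl.mul_right i), one_smul]

lemma sign_of_even_mem (l : ℤ) {i : ℤ} (hi : Even i) {a : B.carrier} (ha : a ∈ B.grading i) :
    B.sign l a = a := by
  rw [B.sign_of_mem l ha, Int.negOnePow_even _ (hi.mul_left l), one_smul]

lemma d_sign (l : ℤ) (a : B.carrier) : B.d (B.sign l a) = l.negOnePow • B.sign l (B.d a) := by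
  induction a using B.induction with
  | zero => simp
  | add a b ha hb => simp only [map_add, ha, hb, smul_add]
  | homogeneous i a ha =>
    rw [B.sign_of_mem l ha, B.sign_of_mem l (B.d_mem ha), smul_smul, Units.smul_def, map_zsmul,
      ← Units.smul_def, ← Int.negOnePow_add]
    congr 1
    rw [mul_add, mul_one, add_comm l, add_assoc, Int.negOnePow_add, Int.negOnePow_even (l + l) (Even.add_self l), mul_one]

end CDGAlgebra

/-- Writing the Koszul sign as the automorphism `B.sign 1` makes the Leibniz rule valid for
inhomogeneous `a`; the sign computations below then need no decomposition. -/
lemma QDGModule.d_smul' (M : QDGModule B) (a : B.carrier) (x : M.carrier) :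
    M.d (a • x) = B.d a • x + B.sign 1 a • M.d x := by
  induction a using B.induction with
  | zero => simp
  | add a b ha hb => simp only [map_add, add_smul, ha, hb]; abel
  | homogeneous i a ha => rw [M.d_smul x ha, B.sign_of_mem 1 ha, one_mul, smul_assoc]

namespace CDGModule

/-! ### Shifts -/

/-- The identity, as an additive bijection between `M` and `M[l]`. -/
def toShift (M : CDGModule B) (l : ℤ) : M.carrier ≃+ (M.shift l).carrier :=
  AddEquiv.refl M.carrier

lemma toShift_mem {M : CDGModule B} {l i : ℤ} {x : M.carrier} :
    M.toShift l x ∈ (M.shift l).grading i ↔ x ∈ M.grading (i + l) := Iff.rfl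

lemma smul_toShift (M : CDGModule B) (l : ℤ) (a : B.carrier) (x : M.carrier) :
    a • M.toShift l x = M.toShift l (B.sign l a • x) := rfl

lemma d_toShift (M : CDGModule B) (l : ℤ) (x : M.carrier) :
    (M.shift l).d (M.toShift l x) = M.toShift l (l.negOnePow • M.d x) := rfl

/-- Construct a closed morphism from a bijection. -/
def mkIso {M N : CDGModule B} (e : M.carrier ≃+ N.carrier)
    (h₀ : ∀ (a : B.carrier) x, e (a • x) = a • e x)
    (h₁ : ∀ {i : ℤ} {m : M.carrier}, e m ∈ N.grading i ↔ m ∈ M.grading i)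
    (h₂ : ∀ m : M.carrier, e (M.d m) = N.d (e m)) : M ≅ N where
  hom := mkHom { e with map_smul' := h₀ } h₁.2 h₂
  inv := mkHom
    { e.symm with
      map_smul' := fun a x => e.injective (by
        obtain ⟨x, rfl⟩ := e.surjective x
        change e (e.symm (a • e x)) = e (a • e.symm (e x))
        rw [h₀, e.apply_symm_apply, e.symm_apply_apply]) }
    (fun {i m} hm => h₁.1 (by
      change e (e.symm m) ∈ _
      rwa [e.apply_symm_apply]))
    (fun m => e.injective (by
      change e (e.symm (N.d m)) = e (M.d (e.symm m))
      rw [h₂, e.apply_symm_apply, e.apply_symm_apply]))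
  hom_inv_id := hom_ext' e.symm_apply_apply
  inv_hom_id := hom_ext' e.apply_symm_apply

/-- The identification `M[a][b] ≅ M[c]` if `a + b = c`. -/
def shiftShiftIso (M : CDGModule B) {a b c : ℤ} (h : a + b = c) :
    M.shift c ≅ (M.shift a).shift b :=
  mkIso ((M.toShift c).symm.trans ((M.toShift a).trans ((M.shift a).toShift b)))
    (fun r x => by
      obtain ⟨x, rfl⟩ := (M.toShift c).surjective x
      simp only [AddEquiv.trans_apply, smul_toShift, AddEquiv.symm_apply_apply]
      rw [CDGAlgebra.sign_sign, h])
    (fun {i x} => by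
      obtain ⟨x, rfl⟩ := (M.toShift c).surjective x
      simp only [AddEquiv.trans_apply, AddEquiv.symm_apply_apply]
      rw [toShift_mem, toShift_mem, toShift_mem, add_assoc, add_comm b, h])
    (fun x => by
      obtain ⟨x, rfl⟩ := (M.toShift c).surjective x
      simp only [AddEquiv.trans_apply, d_toShift, AddEquiv.symm_apply_apply, Units.smul_def,
        ← map_zsmul]
      rw [smul_smul, ← Units.val_mul, ← Int.negOnePow_add, add_comm b, h])

/-- The identification `M[0] ≅ M`. -/
def shiftZeroIso (M : CDGModule B) : M ≅ M.shift 0 :=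
  mkIso (M.toShift 0)
    (fun r x => by rw [smul_toShift, CDGAlgebra.sign_even Even.zero])
    (fun {i x} => by rw [toShift_mem, add_zero])
    (fun x => by rw [d_toShift, Int.negOnePow_zero, one_smul])

/-! ### Cones -/

section Cone

variable {X Y : CDGModule B} (f : X ⟶ Y)

/-- The element `(y, x)` of the cone of `f : X ⟶ Y`. -/
def coneMk (y : Y.carrier) (x : X.carrier) : (cone f).carrier :=
  ((y, x) : Y.carrier × X.ShiftCarrier 1)

/-- The component in `Y` of an element of the cone of `f : X ⟶ Y`. -/
def coneFst (p : (cone f).carrier) : Y.carrier :=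
  (show Y.carrier × X.ShiftCarrier 1 from p).1

/-- The component in `X` of an element of the cone of `f : X ⟶ Y`. -/
def coneSnd (p : (cone f).carrier) : X.carrier :=
  (show Y.carrier × X.ShiftCarrier 1 from p).2

@[simp] lemma coneFst_mk (y : Y.carrier) (x : X.carrier) : coneFst f (coneMk f y x) = y := rfl
@[simp] lemma coneSnd_mk (y : Y.carrier) (x : X.carrier) : coneSnd f (coneMk f y x) = x := rfl

lemma coneMk_eta (p : (cone f).carrier) : coneMk f (coneFst f p) (coneSnd f p) = p := rfl

lemma coneMk_zero : coneMk f 0 0 = 0 := rfl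

lemma coneMk_add (y y' : Y.carrier) (x x' : X.carrier) :
    coneMk f (y + y') (x + x') = coneMk f y x + coneMk f y' x' := rfl

lemma coneMk_sub (y y' : Y.carrier) (x x' : X.carrier) :
    coneMk f (y - y') (x - x') = coneMk f y x - coneMk f y' x' := rfl

lemma smul_coneMk (a : B.carrier) (y : Y.carrier) (x : X.carrier) :
    a • coneMk f y x = coneMk f (a • y) (B.sign 1 a • x) := rfl

lemma d_coneMk (y : Y.carrier) (x : X.carrier) :
    (cone f).d (coneMk f y x) = coneMk f (Y.d y + linearMap f x) (-X.d x) := by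
  refine Prod.ext rfl ?_
  change (1 : ℤ).negOnePow • X.d x + 0 = -X.d x
  rw [Int.negOnePow_one, add_zero, Units.neg_smul, one_smul]

lemma coneMk_mem {i : ℤ} {y : Y.carrier} {x : X.carrier} :
    coneMk f y x ∈ (cone f).grading i ↔ y ∈ Y.grading i ∧ x ∈ X.grading (i + 1) := Iff.rfl

/-- The inclusion `Y ⟶ cone f`. -/
def coneInl : Y ⟶ cone f :=
  mkHom
    { toFun := fun y => coneMk f y 0
      map_add' := fun y y' => by rw [← coneMk_add, add_zero]
      map_smul' := fun a y => by rw [RingHom.id_apply, smul_coneMk, smul_zero] }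
    (fun hm => ⟨hm, zero_mem _⟩)
    (fun y => by
      change coneMk f (Y.d y) 0 = (cone f).d (coneMk f y 0)
      rw [d_coneMk, map_zero, map_zero, add_zero, neg_zero])

/-- The projection `cone f ⟶ X[1]`. -/
def coneπ : cone f ⟶ X.shift 1 :=
  mkHom (N := X.shift 1)
    { toFun := fun p => (show X.carrier from coneSnd f p)
      map_add' := fun _ _ => rfl
      map_smul' := fun _ _ => rfl }
    (fun hm => hm.2)
    (fun p => by
      obtain ⟨y, x, rfl⟩ : ∃ y x, coneMk f y x = p := ⟨_, _, coneMk_eta f p⟩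
      change coneSnd f ((cone f).d (coneMk f y x)) = (1 : ℤ).negOnePow • X.d x
      rw [d_coneMk, coneSnd_mk, Int.negOnePow_one, Units.neg_smul, one_smul])

variable {f} in
/-- A closed morphism `Q ⟶ cone f`, from its components. -/
def coneLift {Q : CDGModule B} (k : Q.carrier →ₗ[B.carrier] Y.carrier)
    (ψ : Q.carrier →+ X.carrier)
    (hk : ∀ {i : ℤ} {q : Q.carrier}, q ∈ Q.grading i → k q ∈ Y.grading i)
    (hψ : ∀ {i : ℤ} {q : Q.carrier}, q ∈ Q.grading i → ψ q ∈ X.grading (i + 1))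
    (hψ' : ∀ (a : B.carrier) (q : Q.carrier), ψ (a • q) = B.sign 1 a • ψ q)
    (h₁ : ∀ q, k (Q.d q) = Y.d (k q) + linearMap f (ψ q))
    (h₂ : ∀ q, ψ (Q.d q) = -X.d (ψ q)) : Q ⟶ cone f :=
  mkHom
    { toFun := fun q => coneMk f (k q) (ψ q)
      map_add' := fun q q' => by rw [map_add, map_add, coneMk_add]
      map_smul' := fun a q => by rw [map_smul, hψ', RingHom.id_apply, smul_coneMk] }
    (fun hq => ⟨hk hq, hψ hq⟩)
    (fun q => by
      change coneMk f (k (Q.d q)) (ψ (Q.d q)) = (cone f).d (coneMk f (k q) (ψ q))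
      rw [d_coneMk, h₁, h₂])

variable {f} in
/-- A closed morphism `cone f ⟶ Z`, from its components. -/
def coneDesc {Z : CDGModule B} (g : Y ⟶ Z) (h : X.carrier →+ Z.carrier)
    (hh : ∀ {i : ℤ} {x : X.carrier}, x ∈ X.grading (i + 1) → h x ∈ Z.grading i)
    (hh' : ∀ (a : B.carrier) (x : X.carrier), h (B.sign 1 a • x) = a • h x)
    (hd : ∀ x, linearMap g (linearMap f x) = Z.d (h x) + h (X.d x)) : cone f ⟶ Z :=
  mkHom
    { toFun := fun p => linearMap g (coneFst f p) + h (coneSnd f p)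
      map_add' := fun p q => by
        change linearMap g (coneFst f p + coneFst f q) + h (coneSnd f p + coneSnd f q) = _
        rw [map_add, map_add, add_add_add_comm]
      map_smul' := fun a p => by
        change linearMap g (a • coneFst f p) + h (B.sign 1 a • coneSnd f p) = _
        rw [map_smul, hh', RingHom.id_apply, smul_add] }
    (fun hp => add_mem (linearMap_mem g hp.1) (hh hp.2))
    (fun p => by
      obtain ⟨y, x, rfl⟩ : ∃ y x, coneMk f y x = p := ⟨_, _, coneMk_eta f p⟩
      change linearMap g (coneFst f ((cone f).d (coneMk f y x))) +
        h (coneSnd f ((cone f).d (coneMk f y x))) = Z.d (linearMap g y + h x)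
      rw [d_coneMk, coneFst_mk, coneSnd_mk, map_add, hd, map_add, map_neg, linearMap_d]
      abel)

/-- The morphism from the cone of the identity of `X` to the cone of `f : X ⟶ Y`. -/
def coneIdMap : cone (𝟙 X) ⟶ cone f :=
  mkHom
    { toFun := fun p => coneMk f (linearMap f (coneFst (𝟙 X) p)) (coneSnd (𝟙 X) p)
      map_add' := fun p q => by
        rw [← coneMk_add, ← map_add]
        rfl
      map_smul' := fun a p => by
        rw [RingHom.id_apply, smul_coneMk, ← map_smul]
        rfl }
    (fun hp => ⟨linearMap_mem f hp.1, hp.2⟩)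
    (fun p => by
      obtain ⟨y, x, rfl⟩ : ∃ y x, coneMk (𝟙 X) y x = p := ⟨_, _, coneMk_eta _ p⟩
      change coneMk f (linearMap f (coneFst (𝟙 X) ((cone (𝟙 X)).d (coneMk (𝟙 X) y x))))
        (coneSnd (𝟙 X) ((cone (𝟙 X)).d (coneMk (𝟙 X) y x))) =
          (cone f).d (coneMk f (linearMap f y) x)
      rw [d_coneMk, d_coneMk, coneFst_mk, coneSnd_mk, map_add, linearMap_d]
      rfl)

lemma coneIdMap_mk (y x : X.carrier) :
    linearMap (coneIdMap f) (coneMk (𝟙 X) y x) = coneMk f (linearMap f y) x := rfl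

end Cone

end CDGModule

end Algebra

end Curved

/-! ### Acyclicity: from the t-adic graded pieces to the complexes Hom(Γ_i, M) -/

namespace Curved

open CategoryTheory.Limits
open scoped CDGModule

namespace CDGDeformation

variable {k : Type v} [CommRing k] {A : DGAlgebra.{v, u} k} {n : ℕ} (An : CDGDeformation A n)

section Elements

variable {An} {M N : CDGModule An.toCDGAlgebra}

lemma t_pow_smul_smul (i : ℕ) (a : An.carrier) (x : M.carrier) :
    An.t ^ i • a • x = a • An.t ^ i • x := by
  rw [smul_smul, smul_smul, An.t_pow_comm]

lemma t_smul_smul (a : An.carrier) (x : M.carrier) : An.t • a • x = a • An.t • x := by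
  rw [smul_smul, smul_smul, An.t_comm]

lemma t_pow_succ_smul (i : ℕ) (x : M.carrier) : An.t ^ (i + 1) • x = An.t ^ i • An.t • x := by
  rw [smul_smul, pow_succ An.t]

lemma t_pow_succ_smul' (i : ℕ) (x : M.carrier) : An.t ^ (i + 1) • x = An.t • An.t ^ i • x := by
  rw [smul_smul, pow_succ' An.t]

lemma d_t_pow_smul (i : ℕ) (x : M.carrier) : M.d (An.t ^ i • x) = An.t ^ i • M.d x := by
  rw [M.d_smul x (An.t_pow_mem i), An.d_t_pow]
  simp

lemma d_t_smul (x : M.carrier) : M.d (An.t • x) = An.t • M.d x := by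
  simpa only [pow_one An.t] using d_t_pow_smul (An := An) 1 x

lemma c_smul (x : M.carrier) : An.c • x = An.cDivT • An.t • x := by
  rw [smul_smul, ← An.t_comm, An.t_mul_cDivT]

lemma d_d_eq (x : M.carrier) : M.d (M.d x) = An.cDivT • An.t • x := by
  rw [M.d_d, c_smul]

lemma d_cDivT_smul (x : M.carrier) :
    M.d (An.cDivT • x) = An.d An.cDivT • x + An.cDivT • M.d x := by
  rw [M.d_smul x An.cDivT_mem, Int.negOnePow_even _ even_two, one_smul]

lemma t_pow_smul_eq_zero_of_le {i j : ℕ} (h : i ≤ j) {x : M.carrier} (hx : An.t ^ i • x = 0) :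
    An.t ^ j • x = 0 := by
  rw [← Nat.sub_add_cancel h, pow_add An.t, mul_smul, hx, smul_zero]

lemma dcDivT_smul_eq_zero {x : M.carrier} (hx : An.t ^ n • x = 0) :
    An.d An.cDivT • x = 0 := by
  obtain ⟨b, hb⟩ := An.d_cDivT
  rw [← hb, mul_smul, hx, smul_zero]

variable (An) in
lemma t_pow_eq_zero : An.t ^ (n + 1) = 0 := by
  have h : (AdjoinRoot.root (Polynomial.X ^ (n + 1) : Polynomial k)) ^ (n + 1) = 0 := by
    rw [← AdjoinRoot.mk_X, ← map_pow, AdjoinRoot.mk_self]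
  rw [t, ← map_pow, h, map_zero]

lemma t_pow_smul_eq_zero {i : ℕ} (hi : n < i) (x : M.carrier) : An.t ^ i • x = 0 :=
  t_pow_smul_eq_zero_of_le hi (by rw [An.t_pow_eq_zero, zero_smul])

end Elements

/-! ### The complexes `Hom(Γ_i, M)` -/

section Complex

variable (M : CDGModule An.toCDGAlgebra)

/-- The (ungraded) group `Ker t^(i+1) × Ker t^i` underlying the complex of morphisms from `Γ_i`
to `M`. -/
def homGroup (i : ℕ) : AddSubgroup (M.carrier × M.carrier) where
  carrier := {z | An.t ^ (i + 1) • z.1 = 0 ∧ An.t ^ i • z.2 = 0}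
  zero_mem' := ⟨smul_zero _, smul_zero _⟩
  add_mem' := fun hx hy => ⟨by rw [Prod.fst_add, smul_add, hx.1, hy.1, add_zero],
    by rw [Prod.snd_add, smul_add, hx.2, hy.2, add_zero]⟩
  neg_mem' := fun hx => ⟨by rw [Prod.fst_neg, smul_neg, hx.1, neg_zero],
    by rw [Prod.snd_neg, smul_neg, hx.2, neg_zero]⟩

/-- The differential of the complex of morphisms from `Γ_i` to `M`. -/
def homD : M.carrier × M.carrier →+ M.carrier × M.carrier where
  -- A map φ of degree -l corresponds to (φ(1,0), (-1)^l φ(0,1)). The formula is the differential of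
  -- φ evaluated on the generators, using d(1,0) = (0, c/t) and d(0,1) = (t, 0) in Γ_i.
  toFun z := (M.d z.1 - An.cDivT • z.2, An.t • z.1 - M.d z.2)
  map_zero' := by simp
  map_add' z w := by
    refine Prod.ext ?_ ?_ <;> simp only [Prod.fst_add, Prod.snd_add, map_add, smul_add] <;> abel

variable {An M}

lemma homD_apply (x y : M.carrier) :
    An.homD M (x, y) = (M.d x - An.cDivT • y, An.t • x - M.d y) := rfl

lemma homD_mem {i : ℕ} {z : M.carrier × M.carrier} (hz : z ∈ An.homGroup M i) :
    An.homD M z ∈ An.homGroup M i := by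
  obtain ⟨x, y⟩ := z
  obtain ⟨hx, hy⟩ : An.t ^ (i + 1) • x = 0 ∧ An.t ^ i • y = 0 := hz
  constructor
  · change An.t ^ (i + 1) • (M.d x - An.cDivT • y) = 0
    rw [smul_sub, ← d_t_pow_smul, hx, map_zero, t_pow_smul_smul,
      t_pow_smul_eq_zero_of_le i.le_succ hy, smul_zero, sub_zero]
  · change An.t ^ i • (An.t • x - M.d y) = 0
    rw [smul_sub, ← t_pow_succ_smul, hx, ← d_t_pow_smul, hy, map_zero, sub_zero]

/-- On `M` the square of `d` is (c/t)t, so all terms cancel but d(c/t)·y. As t·d(c/t) = dc = 0, the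
element d(c/t) is a multiple of t^n and kills Ker t^i; this is where i ≤ n enters. -/
lemma homD_homD {i : ℕ} (hi : i ≤ n) {z : M.carrier × M.carrier} (hz : z ∈ An.homGroup M i) :
    An.homD M (An.homD M z) = 0 := by
  obtain ⟨x, y⟩ := z
  obtain ⟨hx, hy⟩ : An.t ^ (i + 1) • x = 0 ∧ An.t ^ i • y = 0 := hz
  refine Prod.ext ?_ ?_
  · change M.d (M.d x - An.cDivT • y) - An.cDivT • (An.t • x - M.d y) = 0
    rw [map_sub, d_d_eq, d_cDivT_smul, dcDivT_smul_eq_zero (t_pow_smul_eq_zero_of_le hi hy),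
      smul_sub]
    abel
  · change An.t • (M.d x - An.cDivT • y) - M.d (An.t • x - M.d y) = 0
    rw [map_sub, d_d_eq, d_t_smul, smul_sub, t_smul_smul]
    abel

/-- The complexes increase with i. This filtration drives the two inductions relating `HomAcyclic`
to `KerAcyclic`. -/
lemma homGroup_succ {i : ℕ} {z : M.carrier × M.carrier} (hz : z ∈ An.homGroup M i) :
    z ∈ An.homGroup M (i + 1) :=
  ⟨t_pow_smul_eq_zero_of_le (i + 1).le_succ hz.1, t_pow_smul_eq_zero_of_le i.le_succ hz.2⟩

variable (An M)

/-- Acyclicity of the complex of morphisms from `Γ_i` to `M`. -/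
def HomAcyclic (i : ℕ) : Prop :=
  ∀ z ∈ An.homGroup M i, An.homD M z = 0 → ∃ w ∈ An.homGroup M i, An.homD M w = z

/-- Acyclicity of the complex `t^i M ∩ Ker t`. -/
def KerAcyclic (i : ℕ) : Prop :=
  ∀ x : M.carrier, An.t ^ (i + 1) • x = 0 → M.d (An.t ^ i • x) = 0 →
    ∃ y : M.carrier, An.t ^ (i + 1) • y = 0 ∧ M.d (An.t ^ i • y) = An.t ^ i • x

/-- Acyclicity of the complex `t^i M / t^(i+1) M`. -/
def GrAcyclic (i : ℕ) : Prop :=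
  ∀ x w : M.carrier, M.d (An.t ^ i • x) = An.t ^ (i + 1) • w →
    ∃ y v : M.carrier, An.t ^ i • x = M.d (An.t ^ i • y) + An.t ^ (i + 1) • v

/-- Only one half of exactness is a condition: d² acts as c = t(c/t), which sends t^i M into t^(i+1)
M, so boundaries in the graded piece are automatically cycles. -/
lemma exact_gr_iff (i : ℕ) :
    Function.Exact (An.gr M i).d (An.gr M i).d ↔ An.GrAcyclic M i := by
  let π : (An.tPow M i).toSubmodule → (An.gr M i).carrier := fun x =>
    ((An.tPow M (i + 1)).restrict (An.tPow M i)).toSubmodule.mkQ x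
  have hπ : ∀ y, ∃ x, π x = y := Submodule.mkQ_surjective _
  have hπ₀ : ∀ x y, π x = π y ↔ ∃ w : M.carrier, An.t ^ (i + 1) • w = (x : M.carrier) - y :=
    fun x y => Submodule.Quotient.eq _
  have hd : ∀ x, (An.gr M i).d (π x) = π ⟨M.d x, (An.tPow M i).d_mem x.2⟩ := fun x => rfl
  have h0 : (0 : (An.gr M i).carrier) = π 0 := (map_zero _).symm
  constructor
  · intro H x w hxw
    obtain ⟨y, hy⟩ := (H (π ⟨An.t ^ i • x, x, rfl⟩)).1 (by
      rw [hd, h0, hπ₀]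
      exact ⟨w, by simpa using hxw.symm⟩)
    obtain ⟨⟨_, y, rfl⟩, rfl⟩ := hπ y
    obtain ⟨v, hv⟩ := (hπ₀ _ _).1 ((hd _).symm.trans hy).symm
    exact ⟨y, v, by rw [hv]; simp⟩
  · intro H z
    obtain ⟨⟨_, x, rfl⟩, rfl⟩ := hπ z
    constructor
    · intro hz
      rw [hd, h0, hπ₀] at hz
      obtain ⟨w, hw⟩ := hz
      obtain ⟨y, v, hyv⟩ := H x w (by simpa using hw.symm)
      refine ⟨π ⟨An.t ^ i • y, y, rfl⟩, ?_⟩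
      rw [hd, eq_comm, hπ₀]
      exact ⟨v, (sub_eq_of_eq_add' hyv).symm⟩
    · rintro ⟨y, hy⟩
      obtain ⟨⟨_, y, rfl⟩, rfl⟩ := hπ y
      rw [← hy, hd, hd, h0, hπ₀]
      refine ⟨An.cDivT • y, ?_⟩
      change _ = M.d (M.d (An.t ^ i • y)) - 0
      rw [d_d_eq, sub_zero, ← t_pow_succ_smul', t_pow_smul_smul]

variable {An M}

/-- Put K_i = t^i M ∩ Ker t. The kernel of the surjection t : Gr^i → Gr^(i+1) is K_i/K_(i+1), which
is therefore acyclic; descending induction from K_n = Gr^n gives K_i. The proof is the corresponding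
chase on representatives. -/
lemma kerAcyclic_of_grAcyclic (h : ∀ i ≤ n, An.GrAcyclic M i) (i : ℕ) : An.KerAcyclic M i := by
  have h' : ∀ i, An.GrAcyclic M i := fun i => by
    by_cases hi : i ≤ n
    · exact h i hi
    · intro x w _
      exact ⟨0, 0, by simp [t_pow_smul_eq_zero (not_le.1 hi)]⟩
  by_cases hi : i ≤ n
  · induction hi using Nat.decreasingInduction with
    | self =>
      intro x _ hd
      obtain ⟨y, v, hyv⟩ := h n le_rfl x 0 (by rw [hd, smul_zero])
      rw [t_pow_smul_eq_zero n.lt_succ_self, add_zero] at hyv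
      exact ⟨y, t_pow_smul_eq_zero n.lt_succ_self y, hyv.symm⟩
    | of_succ i hi ih =>
      intro x hx hd
      obtain ⟨y, v, hyv⟩ := h' i x 0 (by rw [hd, smul_zero])
      -- Multiplying by t shows that t^(i+1)y is a cycle modulo t^(i+2)M. Expressing it as a
      -- boundary corrects y to y - dy₁ - tw₁, which t^(i+1) kills.
      obtain ⟨y₁, w₁, h₁⟩ := h' (i + 1) y (-v) (by
        have := congrArg (An.t • ·) hyv
        simp only [smul_add, ← d_t_smul, ← t_pow_succ_smul', hx] at this
        rw [smul_neg, eq_neg_iff_add_eq_zero, ← this])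
      have hcx : M.d (M.d (An.t ^ i • y₁)) = An.t ^ (i + 1) • An.cDivT • y₁ := by
        rw [d_d_eq, ← t_pow_succ_smul', t_pow_smul_smul]
      have hy₂ : An.t ^ (i + 1) • (y - M.d y₁ - An.t • w₁) = 0 := by
        rw [smul_sub, smul_sub, h₁, d_t_pow_smul, ← t_pow_succ_smul]
        abel
      have hdif : An.t ^ i • x - M.d (An.t ^ i • (y - M.d y₁ - An.t • w₁)) =
          An.t ^ (i + 1) • (v + An.cDivT • y₁ + M.d w₁) := by
        rw [hyv, smul_sub, smul_sub, map_sub, map_sub, ← d_t_pow_smul _ y₁, hcx,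
          ← t_pow_succ_smul, smul_add, smul_add, d_t_pow_smul _ w₁]
        abel
      -- What remains of t^i x lies in K_(i+1) and is closed, so the induction hypothesis applies.
      obtain ⟨y₃, h₃, h₃'⟩ := ih (v + An.cDivT • y₁ + M.d w₁) (by
          rw [t_pow_succ_smul', ← hdif, smul_sub, ← d_t_smul, ← t_pow_succ_smul',
            ← t_pow_succ_smul', hx, hy₂, map_zero, sub_zero]) (by
          rw [← hdif, map_sub, hd, d_d_eq, ← t_pow_succ_smul', hy₂, smul_zero, sub_zero])
      refine ⟨y - M.d y₁ - An.t • w₁ + An.t • y₃, ?_, ?_⟩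
      · rw [smul_add, hy₂, ← t_pow_succ_smul, h₃, add_zero]
      · rw [smul_add, map_add, ← t_pow_succ_smul, h₃', ← hdif]
        abel
  · intro x _ _
    refine ⟨0, by simp, ?_⟩
    simp [t_pow_smul_eq_zero (not_le.1 hi)]

/-- The same exact sequences read backwards: K_i/K_(i+1) is acyclic, and descending induction starts
from Gr^(n+1) = 0, hence the range i ≤ n+1. -/
lemma grAcyclic_of_kerAcyclic (h : ∀ i ≤ n, An.KerAcyclic M i) (i : ℕ) : An.GrAcyclic M i := by
  have h' : ∀ i, An.KerAcyclic M i := fun i => by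
    by_cases hi : i ≤ n
    · exact h i hi
    · intro x _ _
      exact ⟨0, by simp, by simp [t_pow_smul_eq_zero (not_le.1 hi)]⟩
  by_cases hi : i ≤ n + 1
  · induction hi using Nat.decreasingInduction with
    | self =>
      intro x _ _
      exact ⟨0, 0, by simp [t_pow_smul_eq_zero n.lt_succ_self]⟩
    | of_succ i hi ih =>
      intro x w hxw
      -- The image of the cycle under multiplication by t bounds in Gr^(i+1). Subtracting a boundary
      -- and an element of t^(i+1)M leaves t^i x₁ with t^(i+1)x₁ = 0, where x₁ = x - dy₁ - tw₁.
      obtain ⟨y₁, w₁, h₁⟩ := ih x w (by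
        rw [t_pow_succ_smul', d_t_smul, hxw, ← t_pow_succ_smul'])
      have hcx : M.d (M.d (An.t ^ i • y₁)) = An.t ^ (i + 1) • An.cDivT • y₁ := by
        rw [d_d_eq, ← t_pow_succ_smul', t_pow_smul_smul]
      have hx₁ : An.t ^ (i + 1) • (x - M.d y₁ - An.t • w₁) = 0 := by
        rw [smul_sub, smul_sub, h₁, d_t_pow_smul, ← t_pow_succ_smul]
        abel
      have hdx₁ : M.d (An.t ^ i • (x - M.d y₁ - An.t • w₁)) =
          An.t ^ (i + 1) • (w - An.cDivT • y₁ - M.d w₁) := by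
        rw [smul_sub, smul_sub, map_sub, map_sub, hxw, ← d_t_pow_smul _ y₁, hcx,
          ← t_pow_succ_smul, smul_sub, smul_sub, d_t_pow_smul _ w₁]
      -- d(t^i x₁) is a closed element of K_(i+1), hence equals d(t^(i+1)x₂), so t^i(x₁ - tx₂) is a
      -- cycle of K_i.
      obtain ⟨x₂, h₂, h₂'⟩ := h' (i + 1) (w - An.cDivT • y₁ - M.d w₁)
        (by rw [t_pow_succ_smul', ← hdx₁, ← d_t_smul, ← t_pow_succ_smul', hx₁, map_zero])
        (by rw [← hdx₁, d_d_eq, ← t_pow_succ_smul', hx₁, smul_zero])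
      obtain ⟨y, hy, hy'⟩ := h' i (x - M.d y₁ - An.t • w₁ - An.t • x₂)
        (by rw [smul_sub, hx₁, ← t_pow_succ_smul, h₂, sub_zero])
        (by rw [smul_sub, map_sub, hdx₁, ← t_pow_succ_smul, h₂', sub_self])
      refine ⟨y₁ + y, w₁ + x₂, ?_⟩
      rw [smul_add, map_add, hy', d_t_pow_smul _ y₁, t_pow_succ_smul, smul_add, smul_add, smul_sub,
        smul_sub, smul_sub]
      abel
  · intro x _ _
    exact ⟨0, 0, by simp [t_pow_smul_eq_zero (show n < i by omega)]⟩

/-- The map (x, y) ↦ (t^(i+1)x, t^i y) identifies Hom(Γ_(i+1), M)/Hom(Γ_i, M) with K_(i+1) ⊕ K_i,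
with differential (a, b) ↦ (da, a - db): the term in c/t disappears because t^(i+1)y = 0. This
shifted cone of K_(i+1) ⊆ K_i is acyclic, and Hom(Γ_0, M) = K_0. -/
lemma homAcyclic_of_kerAcyclic (h : ∀ i ≤ n, An.KerAcyclic M i) :
    ∀ i ≤ n, An.HomAcyclic M i := by
  intro i
  induction i with
  | zero =>
    rintro hi ⟨x, y⟩ ⟨hx, hy⟩ hD
    have hy : y = 0 := by simpa using hy
    subst hy
    obtain ⟨w, hw, hw'⟩ := h 0 hi x hx (by
      have := congrArg Prod.fst hD
      simpa [homD_apply] using this)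
    refine ⟨(w, 0), ⟨hw, smul_zero _⟩, ?_⟩
    simp only [homD_apply, smul_zero, map_zero, sub_zero]
    refine Prod.ext ?_ ?_
    · simpa using hw'
    · simpa using hw
  | succ i ih =>
    rintro hi ⟨x, y⟩ ⟨hx, hy⟩ hD
    have h₁ : M.d x = An.cDivT • y := sub_eq_zero.1 (congrArg Prod.fst hD)
    have h₂ : An.t • x = M.d y := sub_eq_zero.1 (congrArg Prod.snd hD)
    simp only at hx hy
    obtain ⟨p, hp, hp'⟩ := h (i + 1) hi x hx (by
      rw [d_t_pow_smul, h₁, t_pow_smul_smul, hy, smul_zero])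
    have hya : An.t ^ (i + 1) • (y - An.t • p) = 0 := by
      rw [smul_sub, hy, ← t_pow_succ_smul, hp, sub_zero]
    have hyd : M.d (An.t ^ i • (y - An.t • p)) = 0 := by
      rw [smul_sub, map_sub, ← t_pow_succ_smul, hp', d_t_pow_smul, ← h₂, ← t_pow_succ_smul,
        sub_self]
    obtain ⟨q, hq, hq'⟩ := h i (by omega) _ hya hyd
    -- The element (p, -q) bounds the class of (x, y) in the quotient, so subtracting its
    -- differential lands in the complex for i.
    have hpq : (p, -q) ∈ An.homGroup M (i + 1) :=
      ⟨hp, by rw [smul_neg, hq, neg_zero]⟩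
    have hmem : (x, y) - An.homD M (p, -q) ∈ An.homGroup M i := by
      constructor
      · change An.t ^ (i + 1) • (x - (M.d p - An.cDivT • -q)) = 0
        rw [smul_sub, smul_sub, ← d_t_pow_smul, hp', t_pow_smul_smul, smul_neg (An.t ^ (i + 1)),
          hq]
        simp
      · change An.t ^ i • (y - (An.t • p - M.d (-q))) = 0
        rw [map_neg, sub_neg_eq_add, ← sub_sub, smul_sub, ← d_t_pow_smul, hq', sub_self]
    obtain ⟨w, hw, hw'⟩ := ih (by omega) _ hmem (by
      rw [map_sub, homD_homD hi hpq, hD, sub_zero])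
    exact ⟨w + (p, -q), add_mem (homGroup_succ hw) hpq, by rw [map_add, hw', sub_add_cancel]⟩

/-- By the same filtration the successive quotients are acyclic, so each inclusion K_(i+1) ⊆ K_i is
a quasi-isomorphism, and K_0 = Hom(Γ_0, M) is acyclic. -/
lemma kerAcyclic_of_homAcyclic (h : ∀ i ≤ n, An.HomAcyclic M i) :
    ∀ i ≤ n, An.KerAcyclic M i := by
  intro i
  induction i with
  | zero =>
    intro hi x hx hd
    rw [pow_zero An.t, one_smul] at hd
    obtain ⟨⟨p, q⟩, ⟨hp, hq⟩, hpq⟩ := h 0 hi (x, 0) ⟨hx, smul_zero _⟩ (by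
      rw [homD_apply, hd]
      have : An.t • x = 0 := by simpa using hx
      simp [this])
    have hq : q = 0 := by simpa using hq
    subst hq
    refine ⟨p, hp, ?_⟩
    have := congrArg Prod.fst hpq
    simpa [homD_apply] using this
  | succ i ih =>
    intro hi x hx hd
    -- Viewed in K_i, the cycle t^(i+1)x = t^i(tx) bounds t^i y. Then (x, y) is a cycle modulo
    -- Hom(Γ_i, M), and can be corrected by some (a, b) there to an honest cycle.
    obtain ⟨y, hy, hy'⟩ := ih (by omega) (An.t • x)
      (by rw [← t_pow_succ_smul, hx]) (by rw [← t_pow_succ_smul, hd])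
    have hxy : (x, y) ∈ An.homGroup M (i + 1) := ⟨hx, hy⟩
    have hmem : An.homD M (x, y) ∈ An.homGroup M i := by
      constructor
      · change An.t ^ (i + 1) • (M.d x - An.cDivT • y) = 0
        rw [smul_sub, ← d_t_pow_smul, hd, t_pow_smul_smul, hy, smul_zero, sub_zero]
      · change An.t ^ i • (An.t • x - M.d y) = 0
        rw [smul_sub, ← d_t_pow_smul, hy', sub_self]
    obtain ⟨⟨a, b⟩, ⟨ha, hb⟩, hab⟩ := h i (by omega) _ hmem (homD_homD hi hxy)
    obtain ⟨⟨p, q⟩, ⟨hp, hq⟩, hpq⟩ := h (i + 1) hi ((x, y) - (a, b))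
      (sub_mem hxy (homGroup_succ ⟨ha, hb⟩)) (by rw [map_sub, hab, sub_self])
    refine ⟨p, hp, ?_⟩
    have h₁ : M.d p - An.cDivT • q = x - a := congrArg Prod.fst hpq
    simp only at ha hq
    have := congrArg (An.t ^ (i + 1) • ·) h₁
    simpa only [smul_sub, t_pow_smul_smul, hq, ha, smul_zero, sub_zero, ← d_t_pow_smul] using this

lemma isNAcyclic_iff : An.IsNAcyclic M ↔ ∀ i ≤ n, An.HomAcyclic M i := by
  have : An.IsNAcyclic M ↔ ∀ i ≤ n, An.GrAcyclic M i :=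
    forall₂_congr fun i _ => An.exact_gr_iff M i
  rw [this]
  exact ⟨fun h => homAcyclic_of_kerAcyclic fun i _ => kerAcyclic_of_grAcyclic h i,
    fun h i _ => grAcyclic_of_kerAcyclic (kerAcyclic_of_homAcyclic h) i⟩

end Complex

end CDGDeformation

end Curved

/-! ### Weak equivalences and fibrations read off from Hom(Γ_i, -) -/

namespace Curved

open CategoryTheory.Limits
open scoped CDGModule

section Algebra

variable {R : Type v} [CommRing R] {B : CDGAlgebra.{v, u} R}

namespace QDGModule

variable (M : QDGModule B)

lemma proj_smul {e : ℤ} {a : B.carrier} (ha : a ∈ B.grading e) (i : ℤ) (x : M.carrier) :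
    M.proj (i + e) (a • x) = a • M.proj i x :=
  QDGModule.proj_map (M := M) (N := M) e (DistribSMul.toAddMonoidHom M.carrier a)
    (fun {j m} hm => by
      have h := M.smul_mem ha hm
      rwa [add_comm] at h) i x

lemma proj_d (i : ℤ) (x : M.carrier) : M.proj (i + 1) (M.d x) = M.d (M.proj i x) :=
  QDGModule.proj_map (M := M) (N := M) 1 M.d M.d_mem i x

/-- Stated for every larger index set so that several elements, or the two components of a pair, can
be summed over a common one; the offset `e` accommodates their different degrees. -/
lemma exists_sum_proj (e : ℤ) (x : M.carrier) :
    ∃ s : Finset ℤ, ∀ t, s ⊆ t → ∑ j ∈ t, M.proj (j + e) x = x := by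
  induction x using M.induction with
  | zero => exact ⟨∅, fun t _ => by simp⟩
  | add x y hx hy =>
    obtain ⟨s, hs⟩ := hx
    obtain ⟨s', hs'⟩ := hy
    refine ⟨s ∪ s', fun t ht => ?_⟩
    simp only [map_add, Finset.sum_add_distrib]
    rw [hs t (Finset.union_subset_left ht), hs' t (Finset.union_subset_right ht)]
  | homogeneous i x hx =>
    refine ⟨{i - e}, fun t ht => ?_⟩
    rw [Finset.sum_eq_single_of_mem (i - e) (ht (Finset.mem_singleton_self _)), sub_add_cancel,
      M.proj_of_mem hx]
    intro j _ hj
    exact M.proj_of_mem_ne (fun h => hj (by omega)) hx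

end QDGModule

end Algebra

namespace CDGDeformation

variable {k : Type v} [CommRing k] {A : DGAlgebra.{v, u} k} {n : ℕ} (An : CDGDeformation A n)

section Complex

variable {An} {M N P : CDGModule An.toCDGAlgebra}

/-- The map induced by a closed morphism on the complexes of morphisms from `Γ_i`. -/
def homMap (f : M ⟶ N) : M.carrier × M.carrier →+ N.carrier × N.carrier :=
  (CDGModule.linearMap f).toAddMonoidHom.prodMap (CDGModule.linearMap f).toAddMonoidHom

lemma homMap_apply (f : M ⟶ N) (z : M.carrier × M.carrier) :
    homMap f z = (CDGModule.linearMap f z.1, CDGModule.linearMap f z.2) := rfl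

lemma homMap_comp (f : M ⟶ N) (g : N ⟶ P) (z : M.carrier × M.carrier) :
    homMap (f ≫ g) z = homMap g (homMap f z) := rfl

lemma homMap_mem (f : M ⟶ N) {i : ℕ} {z : M.carrier × M.carrier} (hz : z ∈ An.homGroup M i) :
    homMap f z ∈ An.homGroup N i :=
  ⟨by rw [homMap_apply, ← map_smul, hz.1, map_zero],
    by rw [homMap_apply, ← map_smul, hz.2, map_zero]⟩

lemma homMap_D (f : M ⟶ N) (z : M.carrier × M.carrier) :
    homMap f (An.homD M z) = An.homD N (homMap f z) := by
  obtain ⟨x, y⟩ := z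
  simp only [homMap_apply, homD_apply, map_sub, map_smul, CDGModule.linearMap_d]

/-! ### Homogeneous elements -/

variable (M) in
/-- The projection of `Hom(Γ_i, M)` to its component of degree `j`. -/
def homProj (j : ℤ) : M.carrier × M.carrier →+ M.carrier × M.carrier :=
  (M.proj j).prodMap (M.proj (j - 1))

variable (M) in
/-- The elements of degree `j` of `Hom(Γ_i, M)`. -/
def homDeg (j : ℤ) : AddSubgroup (M.carrier × M.carrier) :=
  (M.grading j).prod (M.grading (j - 1))

lemma homProj_mem_homDeg (j : ℤ) (z : M.carrier × M.carrier) :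
    homProj M j z ∈ homDeg M j := ⟨M.proj_mem _ _, M.proj_mem _ _⟩

lemma homProj_of_mem {j : ℤ} {z : M.carrier × M.carrier} (hz : z ∈ homDeg M j) :
    homProj M j z = z := Prod.ext (M.proj_of_mem hz.1) (M.proj_of_mem hz.2)

lemma homProj_mem {i : ℕ} (j : ℤ) {z : M.carrier × M.carrier} (hz : z ∈ An.homGroup M i) :
    homProj M j z ∈ An.homGroup M i := by
  have h : ∀ (i : ℕ) (j : ℤ) (x : M.carrier), An.t ^ i • M.proj j x = M.proj j (An.t ^ i • x) := by
    intro i j x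
    rw [← M.proj_smul (An.t_pow_mem i), add_zero]
  constructor
  · change An.t ^ (i + 1) • M.proj j z.1 = 0
    rw [h, hz.1, map_zero]
  · change An.t ^ i • M.proj (j - 1) z.2 = 0
    rw [h, hz.2, map_zero]

lemma homProj_D (j : ℤ) (z : M.carrier × M.carrier) :
    homProj M (j + 1) (An.homD M z) = An.homD M (homProj M j z) := by
  obtain ⟨x, y⟩ := z
  refine Prod.ext ?_ ?_
  · change M.proj (j + 1) (M.d x - An.cDivT • y) = M.d (M.proj j x) - An.cDivT • M.proj (j - 1) y
    rw [map_sub, M.proj_d, ← M.proj_smul An.cDivT_mem, show j - 1 + 2 = j + 1 by ring]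
  · change M.proj (j + 1 - 1) (An.t • x - M.d y) = An.t • M.proj j x - M.d (M.proj (j - 1) y)
    rw [map_sub, ← M.proj_d, ← M.proj_smul An.t_mem, add_zero, sub_add_cancel,
      add_sub_cancel_right]

lemma homProj_map (f : M ⟶ N) (j : ℤ) (z : M.carrier × M.carrier) :
    homProj N j (homMap f z) = homMap f (homProj M j z) :=
  Prod.ext (CDGModule.linearMap_proj f _ _).symm (CDGModule.linearMap_proj f _ _).symm

lemma homD_mem_homDeg {j : ℤ} {z : M.carrier × M.carrier} (hz : z ∈ homDeg M j) :
    An.homD M z ∈ homDeg M (j + 1) := by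
  rw [← homProj_of_mem hz, ← homProj_D]
  exact homProj_mem_homDeg _ _

lemma homMap_mem_homDeg (f : M ⟶ N) {j : ℤ} {z : M.carrier × M.carrier} (hz : z ∈ homDeg M j) :
    homMap f z ∈ homDeg N j :=
  ⟨CDGModule.linearMap_mem f hz.1, CDGModule.linearMap_mem f hz.2⟩

lemma exists_sum_homProj (e : ℤ) (z : M.carrier × M.carrier) :
    ∃ s : Finset ℤ, ∀ t, s ⊆ t → ∑ j ∈ t, homProj M (j + e) z = z := by
  obtain ⟨s, hs⟩ := M.exists_sum_proj e z.1
  obtain ⟨s', hs'⟩ := M.exists_sum_proj (e - 1) z.2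
  refine ⟨s ∪ s', fun t ht => Prod.ext ?_ ?_⟩
  · rw [Prod.fst_sum]
    exact hs t (Finset.union_subset_left ht)
  · rw [Prod.snd_sum]
    refine Eq.trans (Finset.sum_congr rfl fun j _ => ?_) (hs' t (Finset.union_subset_right ht))
    change M.proj (j + e - 1) z.2 = _
    rw [add_sub_assoc]

/-! ### `n`-quasi-isomorphisms -/

section Cone

variable (f : M ⟶ N)

/-- The identification of `Hom(Γ_i, cone f)` with the cone of `Hom(Γ_i, f)`. -/
def conePair (y : N.carrier × N.carrier) (x : M.carrier × M.carrier) :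
    (CDGModule.cone f).carrier × (CDGModule.cone f).carrier :=
  (CDGModule.coneMk f y.1 x.1, CDGModule.coneMk f y.2 (-x.2))

lemma exists_conePair (p : (CDGModule.cone f).carrier × (CDGModule.cone f).carrier) :
    ∃ y x, conePair f y x = p :=
  ⟨(CDGModule.coneFst f p.1, CDGModule.coneFst f p.2),
    (CDGModule.coneSnd f p.1, -CDGModule.coneSnd f p.2),
    Prod.ext (CDGModule.coneMk_eta f p.1) (by
      change CDGModule.coneMk f _ (- -CDGModule.coneSnd f p.2) = p.2
      rw [neg_neg]
      exact CDGModule.coneMk_eta f p.2)⟩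

variable {f}

lemma conePair_inj {y y' : N.carrier × N.carrier} {x x' : M.carrier × M.carrier} :
    conePair f y x = conePair f y' x' ↔ y = y' ∧ x = x' := by
  constructor
  · intro h
    have h₁ := congrArg Prod.fst h
    have h₂ := congrArg Prod.snd h
    exact ⟨Prod.ext (congrArg (CDGModule.coneFst f) h₁) (congrArg (CDGModule.coneFst f) h₂),
      Prod.ext (congrArg (CDGModule.coneSnd f) h₁)
        (neg_injective (congrArg (CDGModule.coneSnd f) h₂))⟩
  · rintro ⟨rfl, rfl⟩
    rfl

lemma conePair_zero : conePair f 0 0 = 0 :=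
  Prod.ext (CDGModule.coneMk_zero f) (by
    change CDGModule.coneMk f 0 (-0) = 0
    rw [neg_zero, CDGModule.coneMk_zero])

lemma coneMk_eq_zero {y : N.carrier} {x : M.carrier} :
    CDGModule.coneMk f y x = 0 ↔ y = 0 ∧ x = 0 :=
  ⟨fun h => ⟨congrArg (CDGModule.coneFst f) h, congrArg (CDGModule.coneSnd f) h⟩, by
    rintro ⟨rfl, rfl⟩; exact CDGModule.coneMk_zero f⟩

lemma t_pow_smul_coneMk (i : ℕ) (y : N.carrier) (x : M.carrier) :
    An.t ^ i • CDGModule.coneMk f y x = CDGModule.coneMk f (An.t ^ i • y) (An.t ^ i • x) := by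
  rw [CDGModule.smul_coneMk, CDGAlgebra.sign_of_even_mem 1 Even.zero (An.t_pow_mem i)]

lemma conePair_mem {i : ℕ} {y : N.carrier × N.carrier} {x : M.carrier × M.carrier} :
    conePair f y x ∈ An.homGroup (CDGModule.cone f) i ↔
      y ∈ An.homGroup N i ∧ x ∈ An.homGroup M i := by
  change An.t ^ (i + 1) • CDGModule.coneMk f y.1 x.1 = 0 ∧
    An.t ^ i • CDGModule.coneMk f y.2 (-x.2) = 0 ↔
      (An.t ^ (i + 1) • y.1 = 0 ∧ An.t ^ i • y.2 = 0) ∧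
      (An.t ^ (i + 1) • x.1 = 0 ∧ An.t ^ i • x.2 = 0)
  rw [t_pow_smul_coneMk, t_pow_smul_coneMk, coneMk_eq_zero, coneMk_eq_zero, smul_neg, neg_eq_zero]
  tauto

/-- This is the differential of the cone of Hom(Γ_i, f). The sign on the second component in
`conePair` compensates for the sign of the differential of M[1]. -/
lemma homD_conePair (y : N.carrier × N.carrier) (x : M.carrier × M.carrier) :
    An.homD _ (conePair f y x) =
      conePair f (An.homD N y + homMap f x) (-An.homD M x) := by
  obtain ⟨y, y'⟩ := y
  obtain ⟨x, x'⟩ := x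
  refine Prod.ext ?_ ?_
  · change (CDGModule.cone f).d (CDGModule.coneMk f y x) -
      An.cDivT • CDGModule.coneMk f y' (-x') =
        CDGModule.coneMk f (N.d y - An.cDivT • y' + CDGModule.linearMap f x)
          (-(M.d x - An.cDivT • x'))
    rw [CDGModule.d_coneMk, CDGModule.smul_coneMk,
      CDGAlgebra.sign_of_even_mem 1 even_two An.cDivT_mem, ← CDGModule.coneMk_sub]
    congr 1
    · abel
    · rw [smul_neg]; abel
  · change An.t • CDGModule.coneMk f y x - (CDGModule.cone f).d (CDGModule.coneMk f y' (-x')) =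
        CDGModule.coneMk f (An.t • y - N.d y' + CDGModule.linearMap f x')
          (- -(An.t • x - M.d x'))
    rw [CDGModule.d_coneMk, CDGModule.smul_coneMk,
      CDGAlgebra.sign_of_even_mem 1 Even.zero An.t_mem, ← CDGModule.coneMk_sub]
    congr 1
    · rw [map_neg]; abel
    · rw [map_neg, neg_neg, neg_neg]

end Cone

/-- Acyclicity of the cone of Hom(Γ_i, f), spelled out: a cycle of that cone is a pair (-y, z) with
Dz = 0 and f z = Dy. -/
lemma isNQuasiIso_iff_exists (f : M ⟶ N) : An.IsNQuasiIso f ↔ ∀ i ≤ n,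
    ∀ z ∈ An.homGroup M i, An.homD M z = 0 → ∀ y ∈ An.homGroup N i, homMap f z = An.homD N y →
      ∃ x ∈ An.homGroup M i, ∃ y' ∈ An.homGroup N i,
        An.homD M x = z ∧ y = homMap f x + An.homD N y' := by
  rw [IsNQuasiIso, isNAcyclic_iff]
  refine forall₂_congr fun i hi => ⟨fun H z hz hDz y hy hzy => ?_, fun H p hp hDp => ?_⟩
  · obtain ⟨w, hw, hw'⟩ := H (conePair f (-y) z) (conePair_mem.2 ⟨neg_mem hy, hz⟩) (by
      rw [homD_conePair, hDz, map_neg, hzy, neg_add_cancel, neg_zero, conePair_zero])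
    obtain ⟨a, b, rfl⟩ := exists_conePair f w
    rw [homD_conePair, conePair_inj] at hw'
    rw [conePair_mem] at hw
    refine ⟨-b, neg_mem hw.2, -a, neg_mem hw.1, by rw [map_neg, hw'.2], ?_⟩
    rw [map_neg, map_neg, ← neg_add, add_comm (homMap f b), hw'.1, neg_neg]
  · obtain ⟨y, x, rfl⟩ := exists_conePair f p
    rw [conePair_mem] at hp
    rw [homD_conePair, ← conePair_zero (f := f), conePair_inj] at hDp
    obtain ⟨b, hb, a, ha, hab, hab'⟩ := H x hp.2 (neg_eq_zero.1 hDp.2) (-y) (neg_mem hp.1) (by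
      rw [map_neg, eq_neg_iff_add_eq_zero, add_comm (homMap f x), hDp.1])
    refine ⟨conePair f (-a) (-b), conePair_mem.2 ⟨neg_mem ha, neg_mem hb⟩, ?_⟩
    rw [homD_conePair, conePair_inj]
    refine ⟨?_, by rw [map_neg, hab, neg_neg]⟩
    rw [map_neg, map_neg, ← neg_add, add_comm (An.homD N a), ← hab', neg_neg]

/-- Injectivity in homology of the map induced by `f` on the complexes of morphisms from `Γ_i`. -/
def HomologyInjective (f : M ⟶ N) (i : ℕ) : Prop :=
  ∀ z ∈ An.homGroup M i, An.homD M z = 0 → ∀ y ∈ An.homGroup N i, homMap f z = An.homD N y →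
    ∃ x ∈ An.homGroup M i, An.homD M x = z

/-- Surjectivity in homology of the map induced by `f` on the complexes of morphisms from `Γ_i`. -/
def HomologySurjective (f : M ⟶ N) (i : ℕ) : Prop :=
  ∀ w ∈ An.homGroup N i, An.homD N w = 0 → ∃ z ∈ An.homGroup M i, An.homD M z = 0 ∧
    ∃ y ∈ An.homGroup N i, w = homMap f z + An.homD N y

lemma isNQuasiIso_iff (f : M ⟶ N) : An.IsNQuasiIso f ↔
    ∀ i ≤ n, HomologyInjective f i ∧ HomologySurjective f i := by
  rw [isNQuasiIso_iff_exists]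
  refine forall₂_congr fun i hi => ⟨fun H => ⟨?_, ?_⟩, ?_⟩
  · intro z hz hDz y hy hzy
    obtain ⟨x, hx, _, _, hx', _⟩ := H z hz hDz y hy hzy
    exact ⟨x, hx, hx'⟩
  · intro w hw hDw
    obtain ⟨x, hx, y, hy, hx', hy'⟩ := H 0 (zero_mem _) (map_zero _) w hw (by
      rw [hDw, map_zero])
    exact ⟨x, hx, hx', y, hy, hy'⟩
  · rintro ⟨H, H'⟩ z hz hDz y hy hzy
    obtain ⟨x, hx, rfl⟩ := H z hz hDz y hy hzy
    obtain ⟨z', hz', hDz', y', hy', hyz⟩ := H' (y - homMap f x) (sub_mem hy (homMap_mem f hx)) (by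
      rw [map_sub, ← hzy, homMap_D, sub_self])
    refine ⟨x + z', add_mem hx hz', y', hy', by rw [map_add, hDz', add_zero], ?_⟩
    rw [map_add, add_assoc, ← hyz, add_sub_cancel]

variable (An) in
/-- The class of `n`-quasi-isomorphisms. -/
def nQuasiIsos : MorphismProperty (CDGModule An.toCDGAlgebra) := fun _ _ f => An.IsNQuasiIso f

/-- Two-out-of-three for bijections on the homology of each Hom(Γ_i, -), carried out on
representatives. -/
instance : (An.nQuasiIsos).HasTwoOutOfThreeProperty where
  comp_mem {X Y Z} f g hf hg := by
    refine (isNQuasiIso_iff _).2 fun i hi => ?_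
    obtain ⟨f₁, f₂⟩ := (isNQuasiIso_iff f).1 hf i hi
    obtain ⟨g₁, g₂⟩ := (isNQuasiIso_iff g).1 hg i hi
    constructor
    · intro z hz hDz y hy hzy
      obtain ⟨y', hy', h⟩ := g₁ (homMap f z) (homMap_mem f hz) (by rw [← homMap_D, hDz, map_zero])
        y hy hzy
      exact f₁ z hz hDz y' hy' h.symm
    · intro w hw hDw
      obtain ⟨v, hv, hDv, y, hy, rfl⟩ := g₂ w hw hDw
      obtain ⟨z, hz, hDz, y', hy', rfl⟩ := f₂ v hv hDv
      refine ⟨z, hz, hDz, homMap g y' + y, add_mem (homMap_mem g hy') hy, ?_⟩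
      rw [map_add, map_add, homMap_comp, homMap_D, add_assoc]
  of_postcomp {X Y Z} f g hg hfg := by
    refine (isNQuasiIso_iff _).2 fun i hi => ?_
    obtain ⟨g₁, g₂⟩ := (isNQuasiIso_iff g).1 hg i hi
    obtain ⟨h₁, h₂⟩ := (isNQuasiIso_iff _).1 hfg i hi
    constructor
    · intro z hz hDz y hy hzy
      exact h₁ z hz hDz (homMap g y) (homMap_mem g hy) (by rw [homMap_comp, hzy, homMap_D])
    · intro v hv hDv
      obtain ⟨z, hz, hDz, y, hy, h⟩ := h₂ (homMap g v) (homMap_mem g hv) (by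
        rw [← homMap_D, hDv, map_zero])
      obtain ⟨y', hy', h'⟩ := g₁ (v - homMap f z) (sub_mem hv (homMap_mem f hz))
        (by rw [map_sub, hDv, ← homMap_D, hDz, map_zero, sub_zero]) y hy
        (by rw [map_sub, h, homMap_comp, add_sub_cancel_left])
      exact ⟨z, hz, hDz, y', hy', by rw [h', add_sub_cancel]⟩
  of_precomp {X Y Z} f g hf hfg := by
    refine (isNQuasiIso_iff _).2 fun i hi => ?_
    obtain ⟨f₁, f₂⟩ := (isNQuasiIso_iff f).1 hf i hi
    obtain ⟨h₁, h₂⟩ := (isNQuasiIso_iff _).1 hfg i hi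
    constructor
    · intro v hv hDv y hy hvy
      obtain ⟨z, hz, hDz, y', hy', rfl⟩ := f₂ v hv hDv
      obtain ⟨x, hx, rfl⟩ := h₁ z hz hDz (y - homMap g y') (sub_mem hy (homMap_mem g hy')) (by
        rw [map_sub, ← hvy, map_add, homMap_comp, ← homMap_D, add_sub_cancel_right])
      exact ⟨homMap f x + y', add_mem (homMap_mem f hx) hy', by rw [map_add, homMap_D]⟩
    · intro w hw hDw
      obtain ⟨z, hz, hDz, y, hy, rfl⟩ := h₂ w hw hDw
      exact ⟨homMap f z, homMap_mem f hz, by rw [← homMap_D, hDz, map_zero], y, hy, rfl⟩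

/-! ### Fibrations -/

variable (An) in
/-- The class of morphisms which induce surjections on the kernels of all powers of `t`. -/
def kerSurjections : MorphismProperty (CDGModule An.toCDGAlgebra) := fun M N f =>
  ∀ i : ℕ, 1 ≤ i → i ≤ n + 1 →
    Set.SurjOn (CDGModule.linearMap f) (An.kerTPow M i) (An.kerTPow N i)

lemma exists_homMap_eq {f : M ⟶ N} (hf : An.kerSurjections f) {i : ℕ} (hi : i ≤ n)
    {y : N.carrier × N.carrier} (hy : y ∈ An.homGroup N i) :
    ∃ x ∈ An.homGroup M i, homMap f x = y := by
  obtain ⟨x, hx, hx'⟩ := hf (i + 1) (by omega) (by omega) hy.1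
  obtain ⟨x', h, h'⟩ : ∃ x', An.t ^ i • x' = 0 ∧ CDGModule.linearMap f x' = y.2 := by
    -- The hypothesis says nothing about Ker t^0, but this kernel is zero.
    by_cases hi₀ : i = 0
    · subst hi₀
      have := hy.2
      rw [pow_zero An.t, one_smul] at this
      exact ⟨0, smul_zero _, by rw [this, map_zero]⟩
    · exact hf i (by omega) (by omega) hy.2
  exact ⟨(x, x'), ⟨hx, h⟩, Prod.ext hx' h'⟩

lemma kerSurjections_iff_homogeneous (f : M ⟶ N) : An.kerSurjections f ↔
    ∀ i ≤ n, ∀ j, ∀ y ∈ An.homGroup N i, y ∈ homDeg N j →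
      ∃ x ∈ An.homGroup M i, x ∈ homDeg M j ∧ homMap f x = y := by
  constructor
  · intro hf i hi j y hy hyj
    obtain ⟨x, hx, rfl⟩ := exists_homMap_eq hf hi hy
    exact ⟨homProj M j x, homProj_mem j hx, homProj_mem_homDeg j x, by
      rw [← homProj_map, homProj_of_mem hyj]⟩
  · intro H i hi hi' y hy
    obtain ⟨i, rfl⟩ : ∃ j, i = j + 1 := ⟨i - 1, by omega⟩
    obtain ⟨s, hs⟩ := exists_sum_homProj 0 ((y, 0) : N.carrier × N.carrier)
    -- An element of Ker t^(i+1) is the first component of the element (y, 0) of Hom(Γ_i, N).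
    have hy' : ((y, 0) : N.carrier × N.carrier) ∈ An.homGroup N i := ⟨hy, smul_zero _⟩
    have h := hs s subset_rfl
    choose x hx _ hx' using fun j : ℤ => H i (by omega) (j + 0) _ (homProj_mem (j + 0) hy')
      (homProj_mem_homDeg _ _)
    simp only [← hx', ← map_sum] at h
    exact ⟨(∑ j ∈ s, x j).1, (sum_mem (S := An.homGroup M i) fun j _ => hx j).1,
      congrArg Prod.fst h⟩

/-- The lifting property which characterizes the trivial fibrations. -/
def LiftsCycles (f : M ⟶ N) (i : ℕ) : Prop :=
  ∀ z ∈ An.homGroup M i, An.homD M z = 0 → ∀ y ∈ An.homGroup N i, homMap f z = An.homD N y →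
    ∃ x ∈ An.homGroup M i, An.homD M x = z ∧ homMap f x = y

/-- The lifting property which characterizes the trivial fibrations, for homogeneous elements. -/
def LiftsHomogeneousCycles (f : M ⟶ N) (i : ℕ) : Prop :=
  ∀ j, ∀ z ∈ An.homGroup M i, z ∈ homDeg M (j + 1) → An.homD M z = 0 →
    ∀ y ∈ An.homGroup N i, y ∈ homDeg N j → homMap f z = An.homD N y →
      ∃ x ∈ An.homGroup M i, x ∈ homDeg M j ∧ An.homD M x = z ∧ homMap f x = y

lemma liftsCycles_iff_homogeneous (f : M ⟶ N) (i : ℕ) :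
    LiftsCycles f i ↔ LiftsHomogeneousCycles f i := by
  constructor
  · intro H j z hz hzj hDz y hy hyj hzy
    obtain ⟨x, hx, hx', rfl⟩ := H z hz hDz y hy hzy
    exact ⟨homProj M j x, homProj_mem j hx, homProj_mem_homDeg j x, by
      rw [← homProj_D, hx', homProj_of_mem hzj], by rw [← homProj_map, homProj_of_mem hyj]⟩
  · intro H z hz hDz y hy hzy
    obtain ⟨s, hs⟩ := exists_sum_homProj 1 z
    obtain ⟨s', hs'⟩ := exists_sum_homProj 0 y
    have h := hs (s ∪ s') Finset.subset_union_left
    have h' := hs' (s ∪ s') Finset.subset_union_right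
    simp only [add_zero] at h'
    choose x hx _ hDx hx' using fun j : ℤ => H j _ (homProj_mem (j + 1) hz)
      (homProj_mem_homDeg _ _)
      (by rw [← homProj_D, hDz, map_zero]) _ (homProj_mem j hy) (homProj_mem_homDeg _ _)
      (by rw [← homProj_map, hzy, homProj_D])
    refine ⟨∑ j ∈ s ∪ s', x j, sum_mem fun j _ => hx j, ?_, ?_⟩
    · rw [map_sum, ← h]
      exact Finset.sum_congr rfl fun j _ => hDx j
    · rw [map_sum, ← h']
      exact Finset.sum_congr rfl fun j _ => hx' j

/-- The usual characterization of surjective quasi-isomorphisms, for each Hom(Γ_i, f). Forwards, the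
cone condition solves the lifting problem up to a boundary Dy', and surjectivity removes it by
lifting y'. -/
lemma kerSurjections_and_isNQuasiIso_iff (f : M ⟶ N) :
    An.kerSurjections f ∧ An.IsNQuasiIso f ↔ ∀ i ≤ n, LiftsCycles f i := by
  constructor
  · rintro ⟨hf, hf'⟩ i hi z hz hDz y hy hzy
    obtain ⟨x, hx, y', hy', rfl, rfl⟩ :=
      (isNQuasiIso_iff_exists f).1 hf' i hi z hz hDz y hy hzy
    obtain ⟨x', hx', rfl⟩ := exists_homMap_eq hf hi hy'
    refine ⟨x + An.homD M x', add_mem hx (homD_mem hx'), ?_, ?_⟩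
    · rw [map_add, homD_homD hi hx', add_zero]
    · rw [map_add, homMap_D]
  · intro H
    constructor
    · intro i hi hi' y hy
      obtain ⟨i, rfl⟩ : ∃ j, i = j + 1 := ⟨i - 1, by omega⟩
      have hy' : ((y, 0) : N.carrier × N.carrier) ∈ An.homGroup N i := ⟨hy, smul_zero _⟩
      -- To lift y, first lift the cycle Dy to a cycle z, then apply the property to (z, y).
      obtain ⟨z, hz, hDz, hzy⟩ := H i (by omega) 0 (zero_mem _) (map_zero _) _ (homD_mem hy') (by
        rw [homD_homD (by omega) hy', map_zero])
      obtain ⟨x, hx, -, hxy⟩ := H i (by omega) z hz hDz _ hy' hzy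
      exact ⟨x.1, hx.1, congrArg Prod.fst hxy⟩
    · refine (isNQuasiIso_iff_exists f).2 fun i hi z hz hDz y hy hzy => ?_
      obtain ⟨x, hx, hDx, rfl⟩ := H i hi z hz hDz y hy hzy
      exact ⟨x, hx, 0, zero_mem _, hDx, by rw [map_zero, add_zero]⟩

lemma isNAcyclic_cone_id (M : CDGModule An.toCDGAlgebra) : An.IsNAcyclic (CDGModule.cone (𝟙 M)) :=
  (isNQuasiIso_iff (An := An) (𝟙 M)).2 fun _ _ =>
    ⟨fun _ _ _ y hy hzy => ⟨y, hy, hzy.symm⟩,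
      fun w hw hDw => ⟨w, hw, hDw, 0, zero_mem _, by rw [map_zero, add_zero]; rfl⟩⟩

lemma isNQuasiIso_of_isNAcyclic (hM : An.IsNAcyclic M) (hN : An.IsNAcyclic N) (f : M ⟶ N) :
    An.IsNQuasiIso f :=
  (isNQuasiIso_iff f).2 fun i hi =>
    ⟨fun z hz hDz _ _ _ => isNAcyclic_iff.1 hM i hi z hz hDz,
      fun w hw hDw => by
        obtain ⟨y, hy, hy'⟩ := isNAcyclic_iff.1 hN i hi w hw hDw
        exact ⟨0, zero_mem _, map_zero _, y, hy, by rw [map_zero, zero_add, hy']⟩⟩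

end Complex

end CDGDeformation

end Curved

/-! ### Γ_i[l] represents cycles, the cone of its identity represents elements -/

namespace Curved

open CategoryTheory.Limits
open scoped CDGModule

lemma map_negOnePow_smul {G H : Type*} [AddCommGroup G] [AddCommGroup H] (f : G →+ H) (l : ℤ)
    (x : G) : f (l.negOnePow • x) = l.negOnePow • f x := by
  rw [Units.smul_def, map_zsmul, Units.smul_def]

namespace CDGDeformation

variable {k : Type v} [CommRing k] {A : DGAlgebra.{v, u} k} {n : ℕ} (An : CDGDeformation A n)

/-! ### Morphisms from the modules `Γ_i` -/

section Gamma

variable {M N : CDGModule An.toCDGAlgebra}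

/-- The additive map `A_n / t^m A_n → M`, `a ↦ (-1)^(l|a|) a x`. -/
def truncLift (m : ℕ) (l : ℤ) (x : M.carrier) (hx : An.t ^ m • x = 0) :
    (An.truncation m).carrier →+ M.carrier :=
  QuotientAddGroup.lift (An.tIdeal m).toSubmodule.toAddSubgroup
    (show An.carrier →+ M.carrier from
      (LinearMap.toSpanSingleton An.carrier M.carrier x).toAddMonoidHom.comp
        (An.sign l).toAddMonoidHom)
    (by
      rintro _ ⟨b, rfl⟩
      change An.sign l (b * An.t ^ m) • x = 0
      rw [map_mul, CDGAlgebra.sign_of_even_mem l Even.zero (An.t_pow_mem m), mul_smul, hx,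
        smul_zero])

lemma sign_add_two (l : ℤ) (a : An.carrier) : An.sign (l + 1 + 1) a = An.sign l a := by
  rw [add_assoc, ← CDGAlgebra.sign_sign, CDGAlgebra.sign_even ⟨1, rfl⟩]

variable (i : Fin (n + 1))

/-- The element of `Γ_i` represented by a pair of elements of `A_n`. -/
def gammaMk (a b : An.carrier) : (An.gamma i).carrier :=
  (show (An.truncation (i + 1)).carrier × (An.truncation i).ShiftCarrier 1 from
    (An.toTrunc (i + 1) a, An.toTrunc i b))

lemma exists_gammaMk (x : (An.gamma i).carrier) : ∃ a b, An.gammaMk i a b = x := by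
  obtain ⟨x, y⟩ := x
  obtain ⟨a, rfl⟩ := An.toTrunc_surjective _ x
  obtain ⟨b, hb⟩ := An.toTrunc_surjective _ y
  exact ⟨a, b, Prod.ext rfl hb⟩

lemma gammaMk_add (a b a' b' : An.carrier) :
    An.gammaMk i (a + a') (b + b') = An.gammaMk i a b + An.gammaMk i a' b' := rfl

lemma smul_gammaMk (r a b : An.carrier) :
    r • An.gammaMk i a b = An.gammaMk i (r * a) (An.sign 1 r * b) := rfl

lemma gammaMk_eq_zero {a b : An.carrier} (a' b' : An.carrier) (ha : a' * An.t ^ (i + 1 : ℕ) = a)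
    (hb : b' * An.t ^ (i : ℕ) = b) : An.gammaMk i a b = 0 :=
  Prod.ext (An.toTrunc_eq_zero _ a' ha) (An.toTrunc_eq_zero _ b' hb)

lemma d_gammaMk (a b : An.carrier) : (An.gamma i).d (An.gammaMk i a b) =
    An.gammaMk i (An.d a + b * An.t) (-An.d b + a * An.cDivT) := by
  refine Prod.ext rfl ?_
  change (1 : ℤ).negOnePow • An.toTrunc i (An.d b) + An.toTrunc i (a * An.cDivT) =
    An.toTrunc i (-An.d b + a * An.cDivT)
  rw [Int.negOnePow_one, Units.neg_smul, one_smul, map_add, map_neg]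

lemma gammaMk_mem {j : ℤ} {a b : An.carrier} (ha : a ∈ An.grading j)
    (hb : b ∈ An.grading (j + 1)) : An.gammaMk i a b ∈ (An.gamma i).grading j :=
  ⟨An.toTrunc_mem _ ha, An.toTrunc_mem _ hb⟩

lemma exists_gammaMk_of_mem {j : ℤ} {x : (An.gamma i).carrier}
    (hx : x ∈ (An.gamma i).grading j) :
    ∃ a ∈ An.grading j, ∃ b ∈ An.grading (j + 1), An.gammaMk i a b = x := by
  obtain ⟨⟨a, ha, ha'⟩, ⟨b, hb, hb'⟩⟩ := hx
  exact ⟨a, ha, b, hb, Prod.ext ha' hb'⟩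

/-- The map `(α, a) ↦ (-1)^(l|α|) α z₁ + (-1)^l (-1)^((l+1)|a|) a z₂` from `Γ_i` to `M`. -/
def gammaLift (l : ℤ) (z : M.carrier × M.carrier) (hz : z ∈ An.homGroup M i) :
    (An.gamma i).carrier →+ M.carrier :=
  ((An.truncLift (i + 1) l z.1 hz.1).comp (AddMonoidHom.fst (An.truncation (i + 1)).carrier
      ((An.truncation i).ShiftCarrier 1))) +
  l.negOnePow • ((show (An.truncation i).ShiftCarrier 1 →+ M.carrier from
      An.truncLift i (l + 1) z.2 hz.2).comp (AddMonoidHom.snd (An.truncation (i + 1)).carrier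
        ((An.truncation i).ShiftCarrier 1)))

variable {i}

lemma gammaLift_mk (l : ℤ) (z : M.carrier × M.carrier) (hz : z ∈ An.homGroup M i)
    (a b : An.carrier) : An.gammaLift i l z hz (An.gammaMk i a b) =
      An.sign l a • z.1 + l.negOnePow • An.sign (l + 1) b • z.2 := rfl

/-- `gammaLift` turns `homD` into the commutator differential on maps from Γ_i. Cycles thus give
closed maps; for the other elements D records the failure to be closed. -/
lemma gammaLift_d (l : ℤ) (z : M.carrier × M.carrier) (hz : z ∈ An.homGroup M i)
    (x : (An.gamma i).carrier) :
    M.d (An.gammaLift i l z hz x) - l.negOnePow • An.gammaLift i l z hz ((An.gamma i).d x) =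
      An.gammaLift i (l + 1) (An.homD M z) (homD_mem hz) x := by
  obtain ⟨a, b, rfl⟩ := An.exists_gammaMk i x
  obtain ⟨m, m'⟩ := z
  have hb := An.sign_add_two l b
  rw [d_gammaMk, gammaLift_mk, gammaLift_mk, gammaLift_mk, hb]
  simp only [homD_apply, map_add, map_neg, map_mul, M.d_smul', CDGAlgebra.d_sign,
    CDGAlgebra.sign_sign, CDGAlgebra.sign_of_even_mem _ Even.zero An.t_mem,
    CDGAlgebra.sign_of_even_mem _ even_two An.cDivT_mem, map_negOnePow_smul]
  rw [add_comm 1 l, add_comm 1 (l + 1), hb, Int.negOnePow_succ]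
  rcases Int.units_eq_one_or l.negOnePow with h | h <;> rw [h] <;>
    simp only [one_smul, neg_neg, Units.neg_smul, add_smul, neg_smul, mul_smul, smul_sub,
      smul_add, smul_neg] <;> abel

lemma gammaLift_smul (l : ℤ) (z : M.carrier × M.carrier) (hz : z ∈ An.homGroup M i)
    (r : An.carrier) (x : (An.gamma i).carrier) :
    An.gammaLift i l z hz (An.sign l r • x) = r • An.gammaLift i l z hz x := by
  obtain ⟨a, b, rfl⟩ := An.exists_gammaMk i x
  have h : An.sign (l + 1) (An.sign (1 + l) r) = r := by
    rw [CDGAlgebra.sign_sign, CDGAlgebra.sign_even]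
    rw [add_comm 1 l]
    exact Even.add_self _
  have h' : An.sign l (An.sign l r) = r := by
    rw [CDGAlgebra.sign_sign, CDGAlgebra.sign_even (Even.add_self _)]
  rw [smul_gammaMk, gammaLift_mk, gammaLift_mk, CDGAlgebra.sign_sign, map_mul, map_mul, h, h',
    smul_add, mul_smul, mul_smul, smul_comm r l.negOnePow]

lemma gammaLift_mem {l j : ℤ} {z : M.carrier × M.carrier} (hz : z ∈ An.homGroup M i)
    (hz' : z ∈ homDeg M (-l)) {x : (An.gamma i).carrier}
    (hx : x ∈ (An.gamma i).grading (j + l)) : An.gammaLift i l z hz x ∈ M.grading j := by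
  obtain ⟨a, ha, b, hb, rfl⟩ := An.exists_gammaMk_of_mem i hx
  rw [gammaLift_mk]
  refine add_mem ?_ ?_
  · have := M.smul_mem (An.sign_mem l ha) hz'.1
    rwa [add_neg_cancel_right] at this
  · rw [Units.smul_def]
    have := M.smul_mem (An.sign_mem (l + 1) hb) hz'.2
    rw [show j + l + 1 + (-l - 1) = j by ring] at this
    exact zsmul_mem this _

lemma linearMap_gammaLift (f : M ⟶ N) (l : ℤ) (z : M.carrier × M.carrier)
    (hz : z ∈ An.homGroup M i) (x : (An.gamma i).carrier) :
    CDGModule.linearMap f (An.gammaLift i l z hz x) =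
      An.gammaLift i l (homMap f z) (homMap_mem f hz) x := by
  obtain ⟨a, b, rfl⟩ := An.exists_gammaMk i x
  rw [gammaLift_mk, gammaLift_mk, map_add, map_smul, Units.smul_def, map_zsmul, map_smul,
    Units.smul_def]
  rfl

/-- The element of `Hom(Γ_i, M)` corresponding to a map `Γ_i → M`. -/
def gammaEval (l : ℤ) (h : (An.gamma i).carrier →+ M.carrier) : M.carrier × M.carrier :=
  (h (An.gammaMk i 1 0), l.negOnePow • h (An.gammaMk i 0 1))

lemma gammaEval_lift (l : ℤ) (z : M.carrier × M.carrier) (hz : z ∈ An.homGroup M i) :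
    An.gammaEval l (An.gammaLift i l z hz) = z := by
  simp only [gammaEval, gammaLift_mk, map_one, map_zero, one_smul, zero_smul, smul_zero, add_zero,
    zero_add]
  rw [smul_smul, Int.units_mul_self, one_smul]

/-- The generators satisfy t^(i+1)(1,0) = 0 and t^i(0,1) = 0, and t is even, so no sign interferes.
-/
lemma gammaEval_mem (l : ℤ) (h : (An.gamma i).carrier →+ M.carrier)
    (hh : ∀ r x, h (An.sign l r • x) = r • h x) : An.gammaEval l h ∈ An.homGroup M i := by
  have ht : ∀ (j : ℕ) x, An.t ^ j • h x = h (An.t ^ j • x) := fun j x => by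
    rw [← hh, CDGAlgebra.sign_of_even_mem l Even.zero (An.t_pow_mem j)]
  constructor
  · change An.t ^ (i + 1 : ℕ) • h (An.gammaMk i 1 0) = 0
    rw [ht, smul_gammaMk, An.gammaMk_eq_zero i 1 0 (by rw [one_mul, mul_one])
      (by rw [zero_mul, mul_zero]), map_zero]
  · change An.t ^ (i : ℕ) • l.negOnePow • h (An.gammaMk i 0 1) = 0
    rw [smul_comm, ht, smul_gammaMk, CDGAlgebra.sign_of_even_mem 1 Even.zero (An.t_pow_mem i),
      An.gammaMk_eq_zero i 0 1 (by rw [zero_mul, mul_zero]) (by rw [one_mul, mul_one]), map_zero,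
      smul_zero]

lemma gammaLift_eval (l : ℤ) (h : (An.gamma i).carrier →+ M.carrier)
    (hh : ∀ r x, h (An.sign l r • x) = r • h x) (x : (An.gamma i).carrier) :
    An.gammaLift i l (An.gammaEval l h) (An.gammaEval_mem l h hh) x = h x := by
  obtain ⟨a, b, rfl⟩ := An.exists_gammaMk i x
  -- Every element is a combination of the two generators. The coefficients carry the signs that
  -- make the twisted linearity of `h` directly applicable.
  have h₁ : An.gammaMk i a b = An.sign l (An.sign l a) • An.gammaMk i 1 0 +
      An.sign l (An.sign (l + 1) b) • An.gammaMk i 0 1 := by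
    have hb : An.sign (1 + (l + (l + 1))) b = b := CDGAlgebra.sign_even ⟨l + 1, by ring⟩ b
    rw [CDGAlgebra.sign_sign, CDGAlgebra.sign_even (Even.add_self _), smul_gammaMk, smul_gammaMk,
      ← gammaMk_add, CDGAlgebra.sign_sign, CDGAlgebra.sign_sign, hb]
    simp only [mul_one, mul_zero, add_zero, zero_add]
  rw [gammaLift_mk]
  conv_rhs => rw [h₁, map_add, hh, hh]
  simp only [gammaEval]
  rw [smul_comm l.negOnePow, smul_smul l.negOnePow, Int.units_mul_self, one_smul]

lemma gammaEval_mem_homDeg (l : ℤ) (h : (An.gamma i).carrier →+ M.carrier)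
    (hh : ∀ {j x}, x ∈ (An.gamma i).grading (j + l) → h x ∈ M.grading j) :
    An.gammaEval l h ∈ homDeg M (-l) := by
  constructor
  · refine hh ?_
    rw [neg_add_cancel]
    exact An.gammaMk_mem i (SetLike.one_mem_graded An.grading) (zero_mem _)
  · refine SetLike.mem_coe.2 ?_
    simp only [gammaEval, Units.smul_def]
    refine zsmul_mem (hh ?_) _
    rw [sub_add_eq_add_sub, neg_add_cancel]
    exact An.gammaMk_mem i (zero_mem _) (SetLike.one_mem_graded An.grading)

lemma gammaLift_inj {l : ℤ} {z w : M.carrier × M.carrier} {hz : z ∈ An.homGroup M i}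
    {hw : w ∈ An.homGroup M i} (h : ∀ x, An.gammaLift i l z hz x = An.gammaLift i l w hw x) :
    z = w := by
  rw [← An.gammaEval_lift l z hz, ← An.gammaEval_lift l w hw, DFunLike.ext _ _ h]

lemma gammaLift_zero (l : ℤ) (x : (An.gamma i).carrier) :
    An.gammaLift i l (0 : M.carrier × M.carrier) (zero_mem _) x = 0 := by
  obtain ⟨a, b, rfl⟩ := An.exists_gammaMk i x
  simp only [gammaLift_mk, Prod.fst_zero, Prod.snd_zero, smul_zero, add_zero]

variable (i) in
/-- The shift `Γ_i[l]`. -/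
abbrev gammaShift (l : ℤ) : CDGModule An.toCDGAlgebra := (An.gamma i).shift l

/-- The closed morphism `Γ_i[l] ⟶ M` corresponding to a cycle of degree `-l`. -/
def gammaHom (l : ℤ) (z : M.carrier × M.carrier) (hz : z ∈ An.homGroup M i)
    (hz' : z ∈ homDeg M (-l)) (hD : An.homD M z = 0) : An.gammaShift i l ⟶ M :=
  CDGModule.mkHom
    { (An.gammaLift i l z hz).comp ((An.gamma i).toShift l).symm.toAddMonoidHom with
      map_smul' := fun r x => An.gammaLift_smul l z hz r (((An.gamma i).toShift l).symm x) }
    (fun {j x} hx => An.gammaLift_mem hz hz' hx)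
    (fun x => by
      obtain ⟨x, rfl⟩ := ((An.gamma i).toShift l).surjective x
      change An.gammaLift i l z hz (l.negOnePow • (An.gamma i).d x) =
        M.d (An.gammaLift i l z hz x)
      rw [map_negOnePow_smul, eq_comm, ← sub_eq_zero, gammaLift_d]
      simp only [hD]
      exact An.gammaLift_zero _ _)

lemma gammaHom_apply (l : ℤ) (z : M.carrier × M.carrier) (hz : z ∈ An.homGroup M i)
    (hz' : z ∈ homDeg M (-l)) (hD : An.homD M z = 0) (x : (An.gamma i).carrier) :
    CDGModule.linearMap (An.gammaHom l z hz hz' hD) ((An.gamma i).toShift l x) =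
      An.gammaLift i l z hz x := rfl

lemma gammaHom_comp (f : M ⟶ N) (l : ℤ) (z : M.carrier × M.carrier) (hz : z ∈ An.homGroup M i)
    (hz' : z ∈ homDeg M (-l)) (hD : An.homD M z = 0) :
    An.gammaHom l z hz hz' hD ≫ f = An.gammaHom l (homMap f z) (homMap_mem f hz)
      (homMap_mem_homDeg f hz') (by rw [← homMap_D, hD, map_zero]) :=
  CDGModule.hom_ext' fun x => An.linearMap_gammaLift f l z hz (((An.gamma i).toShift l).symm x)

lemma exists_gammaHom (l : ℤ) (φ : An.gammaShift i l ⟶ M) :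
    ∃ (z : M.carrier × M.carrier) (hz : z ∈ An.homGroup M i) (hz' : z ∈ homDeg M (-l))
      (hD : An.homD M z = 0), φ = An.gammaHom l z hz hz' hD := by
  let h : (An.gamma i).carrier →+ M.carrier :=
    (CDGModule.linearMap φ).toAddMonoidHom.comp ((An.gamma i).toShift l).toAddMonoidHom
  have hh : ∀ r x, h (An.sign l r • x) = r • h x := fun r x =>
    (CDGModule.linearMap φ).map_smul r ((An.gamma i).toShift l x)
  have hh' : ∀ {j x}, x ∈ (An.gamma i).grading (j + l) → h x ∈ M.grading j := fun {j x} hx =>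
    CDGModule.linearMap_mem φ (CDGModule.toShift_mem.2 hx)
  have hd : ∀ x, M.d (h x) = l.negOnePow • h ((An.gamma i).d x) := fun x => by
    rw [← map_negOnePow_smul h]
    exact (CDGModule.linearMap_d φ ((An.gamma i).toShift l x)).symm
  refine ⟨An.gammaEval l h, An.gammaEval_mem l h hh, An.gammaEval_mem_homDeg l h hh', ?_, ?_⟩
  · refine An.gammaLift_inj (i := i) (l := l + 1) (hz := homD_mem (An.gammaEval_mem l h hh))
      (hw := zero_mem _) fun x => ?_
    rw [← An.gammaLift_d l _ (An.gammaEval_mem l h hh), An.gammaLift_eval l h hh, An.gammaLift_eval l h hh, hd, sub_self,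
      gammaLift_zero]
  · refine CDGModule.hom_ext' fun x => ?_
    obtain ⟨x, rfl⟩ := ((An.gamma i).toShift l).surjective x
    rw [gammaHom_apply, An.gammaLift_eval l h hh]
    rfl

lemma gammaHom_inj {l : ℤ} {z w : M.carrier × M.carrier} {hz : z ∈ An.homGroup M i}
    {hz' : z ∈ homDeg M (-l)} {hD : An.homD M z = 0} {hw : w ∈ An.homGroup M i}
    {hw' : w ∈ homDeg M (-l)} {hD' : An.homD M w = 0}
    (h : An.gammaHom l z hz hz' hD = An.gammaHom l w hw hw' hD') : z = w :=
  An.gammaLift_inj (i := i) (l := l) (hz := hz) (hw := hw) fun x =>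
    congrArg (fun φ => CDGModule.linearMap φ ((An.gamma i).toShift l x)) h

/-! ### Morphisms from the cones of the identities of the modules `Γ_i[l]` -/

variable (i) in
/-- The cone of the identity of `Γ_i[l]`. -/
abbrev gammaCone (l : ℤ) : CDGModule An.toCDGAlgebra := CDGModule.cone (𝟙 (An.gammaShift i l))

variable (i) in
/-- The inclusion of `Γ_i[l]` into the cone of its identity. -/
abbrev gammaIncl (l : ℤ) : An.gammaShift i l ⟶ An.gammaCone i l := CDGModule.coneInl _

lemma homD_mem_homDeg_neg {l : ℤ} {y : M.carrier × M.carrier}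
    (hy : y ∈ homDeg M (-(l + 1))) : An.homD M y ∈ homDeg M (-l) := by
  have := homD_mem_homDeg (An := An) hy
  rwa [show -(l + 1) + 1 = -l by ring] at this

/-- The closed morphism from the cone of the identity of `Γ_i[l]` corresponding to an element of
degree `-l-1` of `Hom(Γ_i, M)`. -/
def gammaConeHom (l : ℤ) (y : M.carrier × M.carrier) (hy : y ∈ An.homGroup M i)
    (hy' : y ∈ homDeg M (-(l + 1))) : An.gammaCone i l ⟶ M :=
  CDGModule.coneDesc
    (An.gammaHom l (An.homD M y) (homD_mem hy) (An.homD_mem_homDeg_neg hy')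
      (homD_homD (Nat.lt_succ_iff.1 i.2) hy))
    ((An.gammaLift i (l + 1) y hy).comp ((An.gamma i).toShift l).symm.toAddMonoidHom)
    (fun {j x} hx => by
      obtain ⟨x, rfl⟩ := ((An.gamma i).toShift l).surjective x
      rw [CDGModule.toShift_mem, add_assoc, add_comm 1 l] at hx
      exact An.gammaLift_mem hy hy' hx)
    (fun r x => by
      obtain ⟨x, rfl⟩ := ((An.gamma i).toShift l).surjective x
      have := An.gammaLift_smul (l + 1) y hy r x
      rw [← CDGAlgebra.sign_sign] at this
      exact this)
    (fun x => by
      obtain ⟨x, rfl⟩ := ((An.gamma i).toShift l).surjective x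
      rw [CDGModule.linearMap_id, gammaHom_apply, CDGModule.d_toShift]
      change _ = M.d (An.gammaLift i (l + 1) y hy x) +
        An.gammaLift i (l + 1) y hy (l.negOnePow • (An.gamma i).d x)
      have h := An.gammaLift_d (l + 1) y hy x
      rw [Int.negOnePow_succ, Units.neg_smul, sub_neg_eq_add] at h
      rw [map_negOnePow_smul, h]
      obtain ⟨a, b, rfl⟩ := An.exists_gammaMk i x
      rw [gammaLift_mk, gammaLift_mk, Int.negOnePow_succ, Int.negOnePow_succ, neg_neg]
      rw [sign_add_two, sign_add_two])

lemma gammaConeHom_apply (l : ℤ) (y : M.carrier × M.carrier) (hy : y ∈ An.homGroup M i)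
    (hy' : y ∈ homDeg M (-(l + 1))) (w x : (An.gamma i).carrier) :
    CDGModule.linearMap (An.gammaConeHom l y hy hy')
      (CDGModule.coneMk _ ((An.gamma i).toShift l w) ((An.gamma i).toShift l x)) =
      An.gammaLift i l (An.homD M y) (homD_mem hy) w + An.gammaLift i (l + 1) y hy x := rfl

lemma gammaIncl_coneHom (l : ℤ) (y : M.carrier × M.carrier) (hy : y ∈ An.homGroup M i)
    (hy' : y ∈ homDeg M (-(l + 1))) : An.gammaIncl i l ≫ An.gammaConeHom l y hy hy' =
      An.gammaHom l (An.homD M y) (homD_mem hy) (An.homD_mem_homDeg_neg hy')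
        (homD_homD (Nat.lt_succ_iff.1 i.2) hy) :=
  CDGModule.hom_ext' fun x => by
    obtain ⟨x, rfl⟩ := ((An.gamma i).toShift l).surjective x
    change An.gammaLift i l (An.homD M y) (homD_mem hy) x + An.gammaLift i (l + 1) y hy 0 = _
    rw [map_zero, add_zero]
    rfl

lemma gammaConeHom_comp (f : M ⟶ N) (l : ℤ) (y : M.carrier × M.carrier)
    (hy : y ∈ An.homGroup M i) (hy' : y ∈ homDeg M (-(l + 1))) :
    An.gammaConeHom l y hy hy' ≫ f = An.gammaConeHom l (homMap f y) (homMap_mem f hy)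
      (homMap_mem_homDeg f hy') :=
  CDGModule.hom_ext' fun p => by
    obtain ⟨w, x, rfl⟩ : ∃ w x, CDGModule.coneMk _ ((An.gamma i).toShift l w)
        ((An.gamma i).toShift l x) = p := ⟨_, _, CDGModule.coneMk_eta _ p⟩
    rw [CDGModule.linearMap_comp, gammaConeHom_apply, gammaConeHom_apply, map_add,
      linearMap_gammaLift, linearMap_gammaLift]
    simp only [homMap_D]

/-- The element comes from the restriction of φ to the summand Γ_i[l][1]. Closedness then forces the
values on the other summand, so nothing else has to be recorded. -/
lemma exists_gammaConeHom (l : ℤ) (φ : An.gammaCone i l ⟶ M) :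
    ∃ (y : M.carrier × M.carrier) (hy : y ∈ An.homGroup M i) (hy' : y ∈ homDeg M (-(l + 1))),
      φ = An.gammaConeHom l y hy hy' := by
  let h : (An.gamma i).carrier →+ M.carrier :=
    { toFun := fun x => CDGModule.linearMap φ (CDGModule.coneMk _ 0 ((An.gamma i).toShift l x))
      map_zero' := by rw [map_zero, CDGModule.coneMk_zero, map_zero]
      map_add' := fun x y => by
        rw [← (CDGModule.linearMap φ).map_add, ← CDGModule.coneMk_add, add_zero, map_add] }
  have hh : ∀ r x, h (An.sign (l + 1) r • x) = r • h x := fun r x => by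
    change CDGModule.linearMap φ (CDGModule.coneMk _ 0 _) =
      r • CDGModule.linearMap φ (CDGModule.coneMk _ 0 _)
    rw [← map_smul, CDGModule.smul_coneMk, smul_zero, CDGModule.smul_toShift,
      CDGAlgebra.sign_sign]
  have hh' : ∀ {j x}, x ∈ (An.gamma i).grading (j + (l + 1)) → h x ∈ M.grading j :=
    fun {j x} hx => CDGModule.linearMap_mem φ ((CDGModule.coneMk_mem _).2 ⟨zero_mem _, by
      rwa [CDGModule.toShift_mem, add_assoc, add_comm 1 l]⟩)
  -- In the cone d(0, x) = (x, -dx), so (x, 0) = d(0, x) + (0, dx).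
  have hd : ∀ x, CDGModule.linearMap φ (CDGModule.coneMk _ ((An.gamma i).toShift l x) 0) =
      M.d (h x) - (l + 1).negOnePow • h ((An.gamma i).d x) := fun x => by
    change _ = M.d (CDGModule.linearMap φ (CDGModule.coneMk _ 0 ((An.gamma i).toShift l x))) - _
    rw [← CDGModule.linearMap_d, CDGModule.d_coneMk, CDGModule.linearMap_id, map_zero, zero_add,
      CDGModule.d_toShift, Int.negOnePow_succ, Units.neg_smul, sub_neg_eq_add,
      ← map_negOnePow_smul h]
    change _ = _ + CDGModule.linearMap φ (CDGModule.coneMk _ 0 _)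
    rw [← map_add, ← CDGModule.coneMk_add, add_zero, neg_add_cancel]
  refine ⟨An.gammaEval (l + 1) h, An.gammaEval_mem (l + 1) h hh,
    An.gammaEval_mem_homDeg (l + 1) h hh', CDGModule.hom_ext' fun p => ?_⟩
  obtain ⟨w, x, rfl⟩ : ∃ w x, CDGModule.coneMk _ ((An.gamma i).toShift l w)
      ((An.gamma i).toShift l x) = p := ⟨_, _, CDGModule.coneMk_eta _ p⟩
  rw [gammaConeHom_apply, An.gammaLift_eval (l + 1) h hh]
  have h₁ : CDGModule.coneMk (𝟙 (An.gammaShift i l)) ((An.gamma i).toShift l w)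
      ((An.gamma i).toShift l x) =
      CDGModule.coneMk _ ((An.gamma i).toShift l w) 0 +
        CDGModule.coneMk _ 0 ((An.gamma i).toShift l x) := by
    rw [← CDGModule.coneMk_add, add_zero, zero_add]
  rw [h₁, map_add, hd]
  congr 1
  have h₃ := An.gammaLift_d (l + 1) (An.gammaEval (l + 1) h) (An.gammaEval_mem (l + 1) h hh) w
  rw [An.gammaLift_eval (l + 1) h hh, An.gammaLift_eval (l + 1) h hh] at h₃
  rw [h₃]
  -- The lifts with indices l and l+2 agree, since only the parity of the index affects the signs.
  obtain ⟨a, b, rfl⟩ := An.exists_gammaMk i w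
  rw [gammaLift_mk, gammaLift_mk, Int.negOnePow_succ, Int.negOnePow_succ, neg_neg]
  rw [sign_add_two, sign_add_two]

lemma gammaConeHom_inj {l : ℤ} {z w : M.carrier × M.carrier} {hz : z ∈ An.homGroup M i}
    {hz' : z ∈ homDeg M (-(l + 1))} {hw : w ∈ An.homGroup M i} {hw' : w ∈ homDeg M (-(l + 1))}
    (h : An.gammaConeHom l z hz hz' = An.gammaConeHom l w hw hw') : z = w :=
  An.gammaLift_inj (i := i) (l := l + 1) (hz := hz) (hw := hw) fun x => by
    have h' := congrArg (fun φ => CDGModule.linearMap φ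
      (CDGModule.coneMk _ ((An.gamma i).toShift l 0) ((An.gamma i).toShift l x))) h
    change An.gammaLift i l (An.homD M z) (homD_mem hz) 0 + An.gammaLift i (l + 1) z hz x =
      An.gammaLift i l (An.homD M w) (homD_mem hw) 0 + An.gammaLift i (l + 1) w hw x at h'
    rwa [map_zero, map_zero, zero_add, zero_add] at h'

end Gamma

end CDGDeformation

end Curved

/-! ### The generating sets, their lifting properties and their smallness -/

namespace Curved

open CategoryTheory.Limits
open scoped CDGModule

namespace CDGDeformation

variable {k : Type v} [CommRing k] {A : DGAlgebra.{v, u} k} {n : ℕ} (An : CDGDeformation A n)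

/-! ### The generating cofibrations and the generating trivial cofibrations -/

/-- The generating cofibrations: the inclusions of the modules `Γ_i[l]` into the cones of their
identities. -/
def generatingCofibrations : MorphismProperty (CDGModule An.toCDGAlgebra) :=
  MorphismProperty.ofHoms fun p : Fin (n + 1) × ℤ => An.gammaIncl p.1 p.2

/-- The generating trivial cofibrations: the inclusions of zero into the cones of the identities of
the modules `Γ_i[l]`. -/
def generatingTrivialCofibrations : MorphismProperty (CDGModule An.toCDGAlgebra) :=
  MorphismProperty.ofHoms fun p : Fin (n + 1) × ℤ => initial.to (An.gammaCone p.1 p.2)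

variable {M N : CDGModule An.toCDGAlgebra}

/-- A lifting problem is an element of degree -(l+1) of Hom(Γ_i, N), and a solution is a preimage of
the same degree. -/
lemma generatingTrivialCofibrations_rlp_iff (f : M ⟶ N) :
    An.generatingTrivialCofibrations.rlp f ↔ An.kerSurjections f := by
  rw [kerSurjections_iff_homogeneous]
  constructor
  · intro H i hi j y hy hyj
    obtain ⟨l, rfl⟩ : ∃ l, j = -(l + 1) := ⟨-j - 1, by ring⟩
    have := H _ (MorphismProperty.ofHoms.mk ((⟨i, Nat.lt_succ_iff.2 hi⟩, l) : Fin (n + 1) × ℤ))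
    have sq : CommSq (initial.to M) (initial.to (An.gammaCone ⟨i, Nat.lt_succ_iff.2 hi⟩ l)) f
        (An.gammaConeHom l y hy hyj) := ⟨Subsingleton.elim _ _⟩
    obtain ⟨x, hx, hxj, h⟩ := An.exists_gammaConeHom l sq.lift
    refine ⟨x, hx, hxj, An.gammaConeHom_inj (i := ⟨i, Nat.lt_succ_iff.2 hi⟩)
      (hz := homMap_mem f hx) (hz' := homMap_mem_homDeg f hxj) (hw := hy) (hw' := hyj) ?_⟩
    rw [← An.gammaConeHom_comp f l x hx hxj, ← h]
    exact sq.fac_right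
  · rintro H _ _ _ ⟨i, l⟩
    refine ⟨fun {u w} sq => ?_⟩
    obtain ⟨y, hy, hy', rfl⟩ := An.exists_gammaConeHom l w
    obtain ⟨x, hx, hx', rfl⟩ := H i (Nat.lt_succ_iff.1 i.2) _ y hy hy'
    exact ⟨⟨⟨An.gammaConeHom l x hx hx', Subsingleton.elim _ _, An.gammaConeHom_comp f l x hx hx'⟩⟩⟩

/-- A square is a cycle z in Hom(Γ_i, M) and an element y with f z = Dy; a diagonal is an x with Dx
= z and f x = y. This is exactly the homogeneous form of `LiftsCycles`. -/
lemma generatingCofibrations_rlp_iff (f : M ⟶ N) :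
    An.generatingCofibrations.rlp f ↔ An.kerSurjections f ∧ An.IsNQuasiIso f := by
  rw [kerSurjections_and_isNQuasiIso_iff]
  simp only [liftsCycles_iff_homogeneous]
  constructor
  · intro H i hi j z hz hzj hDz y hy hyj hzy
    obtain ⟨l, rfl⟩ : ∃ l, j = -(l + 1) := ⟨-j - 1, by ring⟩
    have hzj' : z ∈ homDeg M (-l) := by
      rwa [show -(l + 1) + 1 = -l by ring] at hzj
    have := H _ (MorphismProperty.ofHoms.mk ((⟨i, Nat.lt_succ_iff.2 hi⟩, l) : Fin (n + 1) × ℤ))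
    have sq : CommSq (An.gammaHom l z hz hzj' hDz)
        (An.gammaIncl ⟨i, Nat.lt_succ_iff.2 hi⟩ l) f (An.gammaConeHom l y hy hyj) := ⟨by
      rw [gammaIncl_coneHom, gammaHom_comp]
      simp only [hzy]⟩
    obtain ⟨x, hx, hxj, h⟩ := An.exists_gammaConeHom l sq.lift
    refine ⟨x, hx, hxj, ?_, ?_⟩
    · refine An.gammaHom_inj (i := ⟨i, Nat.lt_succ_iff.2 hi⟩) (hz := homD_mem hx)
        (hz' := An.homD_mem_homDeg_neg hxj) (hD := homD_homD hi hx) (hw := hz) (hw' := hzj')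
        (hD' := hDz) ?_
      rw [← An.gammaIncl_coneHom l x hx hxj, ← h]
      exact sq.fac_left
    · refine An.gammaConeHom_inj (i := ⟨i, Nat.lt_succ_iff.2 hi⟩)
        (hz := homMap_mem f hx) (hz' := homMap_mem_homDeg f hxj) (hw := hy) (hw' := hyj) ?_
      rw [← An.gammaConeHom_comp f l x hx hxj, ← h]
      exact sq.fac_right
  · rintro H _ _ _ ⟨i, l⟩
    refine ⟨fun {u w} sq => ?_⟩
    obtain ⟨y, hy, hy', rfl⟩ := An.exists_gammaConeHom l w
    obtain ⟨z, hz, hz', hDz, rfl⟩ := An.exists_gammaHom l u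
    have hzy : homMap f z = An.homD N y := by
      have h := sq.w
      rw [gammaIncl_coneHom, gammaHom_comp] at h
      exact An.gammaHom_inj h
    have hz'' : z ∈ homDeg M (-(l + 1) + 1) := by
      rwa [show -(l + 1) + 1 = -l by ring]
    obtain ⟨x, hx, hx', rfl, rfl⟩ := H i (Nat.lt_succ_iff.1 i.2) _ z hz hz'' hDz y hy hy' hzy
    exact ⟨⟨⟨An.gammaConeHom l x hx hx', An.gammaIncl_coneHom l x hx hx',
      An.gammaConeHom_comp f l x hx hx'⟩⟩⟩

/-! ### The small object argument -/

section Small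

variable {J : Type u} [LinearOrder J] (F : J ⥤ CDGModule An.toCDGAlgebra)

/-- A homogeneous cycle is a pair satisfying four equations: two torsion conditions and the two
components of Dz = 0. Each holds from some stage on for a representing pair, so all hold at a common
stage. -/
lemma exists_homGroup_eq_of_isColimit [Nonempty J] {F} {c : Cocone F} (hc : IsColimit c) {i : ℕ} {l : ℤ}
    {z : c.pt.carrier × c.pt.carrier} (hz : z ∈ An.homGroup c.pt i) (hz' : z ∈ homDeg c.pt l)
    (hD : An.homD c.pt z = 0) :
    ∃ (j : J) (w : (F.obj j).carrier × (F.obj j).carrier), w ∈ An.homGroup (F.obj j) i ∧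
      w ∈ homDeg (F.obj j) l ∧ An.homD (F.obj j) w = 0 ∧ homMap (N := c.pt) (c.ι.app j) w = z := by
  obtain ⟨j₁, x₁, hx₁, hx₁'⟩ := CDGModule.exists_homogeneous_eq_of_isColimit hc hz'.1
  obtain ⟨j₂, x₂, hx₂, hx₂'⟩ := CDGModule.exists_homogeneous_eq_of_isColimit hc hz'.2
  -- a pair of representatives at a common stage
  obtain ⟨j, w, hw, hwz⟩ : ∃ (j : J) (w : (F.obj j).carrier × (F.obj j).carrier),
      w ∈ homDeg (F.obj j) l ∧ homMap (N := c.pt) (c.ι.app j) w = z :=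
    ⟨max j₁ j₂, (CDGModule.linearMap (F.map (homOfLE (le_max_left j₁ j₂))) x₁,
      CDGModule.linearMap (F.map (homOfLE (le_max_right j₁ j₂))) x₂),
      ⟨CDGModule.linearMap_mem _ hx₁, CDGModule.linearMap_mem _ hx₂⟩,
      Prod.ext ((CDGModule.cocone_naturality c (le_max_left j₁ j₂) x₁).trans hx₁')
        ((CDGModule.cocone_naturality c (le_max_right j₁ j₂) x₂).trans hx₂')⟩
  have key : ∀ x : (F.obj j).carrier, CDGModule.linearMap (c.ι.app j) x = 0 →
      ∃ j' : J, ∃ h : j ≤ j', ∀ j'' (h' : j' ≤ j''),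
        CDGModule.linearMap (F.map (homOfLE (h.trans h'))) x = 0 := fun x hx => by
    obtain ⟨j', h, h'⟩ := CDGModule.exists_map_eq_zero_of_isColimit hc hx
    exact ⟨j', h, fun j'' h'' => by
      rw [← CDGModule.map_homOfLE_trans h h'', h', map_zero]⟩
  obtain ⟨a₁, ha₁, h₁⟩ := key (An.t ^ (i + 1) • w.1) (by
    rw [map_smul]; rw [← hwz] at hz; exact hz.1)
  obtain ⟨a₂, ha₂, h₂⟩ := key (An.t ^ i • w.2) (by
    rw [map_smul]; rw [← hwz] at hz; exact hz.2)
  have hDw : homMap (N := c.pt) (c.ι.app j) (An.homD _ w) = 0 := by rw [homMap_D, hwz, hD]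
  obtain ⟨a₃, ha₃, h₃⟩ := key (An.homD _ w).1 (congrArg Prod.fst hDw)
  obtain ⟨a₄, ha₄, h₄⟩ := key (An.homD _ w).2 (congrArg Prod.snd hDw)
  let a := max (max a₁ a₂) (max a₃ a₄)
  have l₁ : a₁ ≤ a := (le_max_left _ _).trans (le_max_left _ _)
  have l₂ : a₂ ≤ a := (le_max_right _ _).trans (le_max_left _ _)
  have l₃ : a₃ ≤ a := (le_max_left _ _).trans (le_max_right _ _)
  have l₄ : a₄ ≤ a := (le_max_right _ _).trans (le_max_right _ _)
  refine ⟨a, homMap (F.map (homOfLE (ha₁.trans l₁))) w, ⟨?_, ?_⟩, homMap_mem_homDeg _ hw, ?_, ?_⟩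
  · rw [homMap_apply, ← map_smul]; exact h₁ a l₁
  · rw [homMap_apply, ← map_smul]; exact h₂ a l₂
  · rw [← homMap_D]
    exact Prod.ext (h₃ a l₃) (h₄ a l₄)
  · rw [← homMap_comp, c.w, hwz]

lemma exists_homMap_eq_of_isColimit {F} {c : Cocone F} (hc : IsColimit c) {j : J}
    {w w' : (F.obj j).carrier × (F.obj j).carrier}
    (h : homMap (An := An) (N := c.pt) (c.ι.app j) w = homMap (An := An) (N := c.pt) (c.ι.app j) w') :
    ∃ (j' : J) (h : j ≤ j'), homMap (An := An) (F.map (homOfLE h)) w =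
      homMap (An := An) (F.map (homOfLE h)) w' := by
  rw [← sub_eq_zero, ← map_sub] at h
  obtain ⟨a, ha, h₁⟩ := CDGModule.exists_map_eq_zero_of_isColimit (x := (w - w').1) hc
    (congrArg Prod.fst h)
  obtain ⟨b, hb, h₂⟩ := CDGModule.exists_map_eq_zero_of_isColimit (x := (w - w').2) hc
    (congrArg Prod.snd h)
  refine ⟨max a b, ha.trans (le_max_left _ _), ?_⟩
  rw [← sub_eq_zero, ← map_sub]
  refine Prod.ext ?_ ?_
  · change CDGModule.linearMap (F.map (homOfLE (ha.trans (le_max_left _ _)))) (w - w').1 = 0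
    rw [← CDGModule.map_homOfLE_trans ha (le_max_left a b), h₁, map_zero]
  · change CDGModule.linearMap (F.map (homOfLE (hb.trans (le_max_right _ _)))) (w - w').2 = 0
    rw [← CDGModule.map_homOfLE_trans hb (le_max_right a b), h₂, map_zero]

lemma preservesColimit_gammaShift [Nonempty J] (i : Fin (n + 1)) (l : ℤ) :
    PreservesColimit F (coyoneda.obj (Opposite.op (An.gammaShift i l))) := by
  constructor
  intro c hc
  refine ⟨Types.FilteredColimit.isColimitOf' _ _ ?_ ?_⟩
  · intro φ
    obtain ⟨z, hz, hz', hD, rfl⟩ := An.exists_gammaHom l (M := c.pt) φ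
    obtain ⟨j, w, hw, hw', hDw, rfl⟩ := An.exists_homGroup_eq_of_isColimit hc hz hz' hD
    exact ⟨j, An.gammaHom l w hw hw' hDw, (An.gammaHom_comp _ l w hw hw' hDw).symm⟩
  · intro j φ ψ h
    obtain ⟨z, hz, hz', hD, rfl⟩ := An.exists_gammaHom l (M := F.obj j) φ
    obtain ⟨w, hw, hw', hDw, rfl⟩ := An.exists_gammaHom l (M := F.obj j) ψ
    have h' : An.gammaHom l z hz hz' hD ≫ c.ι.app j = An.gammaHom l w hw hw' hDw ≫ c.ι.app j := h
    rw [gammaHom_comp, gammaHom_comp] at h'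
    obtain ⟨j', hj, hj'⟩ := An.exists_homMap_eq_of_isColimit hc (An.gammaHom_inj h')
    refine ⟨j', homOfLE hj, ?_⟩
    change An.gammaHom l z hz hz' hD ≫ F.map (homOfLE hj) =
      An.gammaHom l w hw hw' hDw ≫ F.map (homOfLE hj)
    rw [gammaHom_comp, gammaHom_comp]
    simp only [hj']

lemma preservesColimit_initial [Nonempty J] :
    PreservesColimit F (coyoneda.obj (Opposite.op (⊥_ (CDGModule An.toCDGAlgebra)))) := by
  constructor
  intro c hc
  refine ⟨Types.FilteredColimit.isColimitOf' _ _ ?_ ?_⟩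
  · intro φ
    exact ⟨Classical.arbitrary J, initial.to _, Subsingleton.elim (α := ⊥_ _ ⟶ c.pt) _ _⟩
  · intro j φ ψ h
    exact ⟨j, 𝟙 j, Subsingleton.elim (α := ⊥_ _ ⟶ F.obj _) _ _⟩

end Small

attribute [local instance] Cardinal.fact_isRegular_aleph0 Cardinal.orderBotAleph0OrdToType

instance : MorphismProperty.IsSmall.{u} An.generatingCofibrations := by
  have : Small.{u} (Fin (n + 1) × ℤ) := Countable.toSmall _
  unfold generatingCofibrations
  infer_instance

instance : MorphismProperty.IsSmall.{u} An.generatingTrivialCofibrations := by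
  have : Small.{u} (Fin (n + 1) × ℤ) := Countable.toSmall _
  unfold generatingTrivialCofibrations
  infer_instance

instance : An.generatingCofibrations.IsCardinalForSmallObjectArgument Cardinal.aleph0.{u} where
  preservesColimit := by
    rintro _ _ _ _ _ ⟨i, l⟩ f hf
    exact An.preservesColimit_gammaShift _ i l

instance :
    An.generatingTrivialCofibrations.IsCardinalForSmallObjectArgument Cardinal.aleph0.{u} where
  preservesColimit := by
    rintro _ _ _ _ _ ⟨i, l⟩ f hf
    exact An.preservesColimit_initial _

instance : MorphismProperty.HasSmallObjectArgument.{u} An.generatingCofibrations where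
  exists_cardinal := ⟨Cardinal.aleph0, inferInstance, inferInstance, inferInstance⟩

instance : MorphismProperty.HasSmallObjectArgument.{u} An.generatingTrivialCofibrations where
  exists_cardinal := ⟨Cardinal.aleph0, inferInstance, inferInstance, inferInstance⟩

end CDGDeformation

end Curved
-- Cofibrations are graded split injections; trivial cofibrations
namespace Curved

open CategoryTheory.Limits
open scoped CDGModule

section Algebra

variable {R : Type v} [CommRing R] {B : CDGAlgebra.{v, u} R}

lemma llp_initial_iff {C : Type*} [Category* C] [HasInitial C] (W : MorphismProperty C) (Q : C) :
    W.llp (initial.to Q) ↔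
      ∀ {X Y : C} (p : X ⟶ Y), W p → ∀ g : Q ⟶ Y, ∃ h : Q ⟶ X, h ≫ p = g := by
  constructor
  · intro H X Y p hp g
    have := H p hp
    have sq : CommSq (initial.to X) (initial.to Q) p g := ⟨Subsingleton.elim _ _⟩
    exact ⟨sq.lift, sq.fac_right⟩
  · intro H X Y p hp
    refine ⟨fun {u g} _ => ?_⟩
    obtain ⟨h, hh⟩ := H p hp g
    exact ⟨⟨⟨h, Subsingleton.elim _ _, hh⟩⟩⟩

namespace CDGModule

/-- The component in `Y` of the cone of `f : X ⟶ Y`, as a linear map. -/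
def coneFstLinear {X Y : CDGModule B} (f : X ⟶ Y) : (cone f).carrier →ₗ[B.carrier] Y.carrier where
  toFun := coneFst f
  map_add' _ _ := rfl
  map_smul' _ _ := rfl

lemma coneFst_d {X Y : CDGModule B} (f : X ⟶ Y) (p : (cone f).carrier) :
    coneFst f ((cone f).d p) = Y.d (coneFst f p) + linearMap f (coneSnd f p) := by
  obtain ⟨y, x, rfl⟩ : ∃ y x, coneMk f y x = p := ⟨_, _, coneMk_eta f p⟩
  rw [d_coneMk]
  rfl

/-- A graded split injection with a retraction `r` has a graded section `s` of its cokernel. -/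
lemma exists_section {M N Q : CDGModule B} (f : M ⟶ N) (r : N.carrier →ₗ[B.carrier] M.carrier)
    (hr : ∀ (i : ℤ) (y : N.carrier), y ∈ N.grading i → r y ∈ M.grading i)
    (hrf : ∀ x, r (linearMap f x) = x) (π : N ⟶ Q) (hπ : Function.Surjective (linearMap π))
    (hker : ∀ y, linearMap π y = 0 ↔ ∃ x, linearMap f x = y) :
    ∃ s : Q.carrier →ₗ[B.carrier] N.carrier,
      (∀ {i : ℤ} {q : Q.carrier}, q ∈ Q.grading i → s q ∈ N.grading i) ∧
      (∀ q, linearMap π (s q) = q) ∧ (∀ q, r (s q) = 0) ∧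
      ∀ y, y = linearMap f (r y) + s (linearMap π y) := by
  have hk : LinearMap.ker (linearMap π) ≤
      LinearMap.ker (LinearMap.id - linearMap f ∘ₗ r) := fun y hy => by
    obtain ⟨x, rfl⟩ := (hker y).1 hy
    change linearMap f x - linearMap f (r (linearMap f x)) = 0
    rw [hrf, sub_self]
  let s : Q.carrier →ₗ[B.carrier] N.carrier := (Submodule.liftQ _ _ hk) ∘ₗ
    ((linearMap π).quotKerEquivOfSurjective hπ).symm.toLinearMap
  have hs : ∀ y, s (linearMap π y) = y - linearMap f (r y) := fun y => by
    have : ((linearMap π).quotKerEquivOfSurjective hπ).symm (linearMap π y) =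
        (LinearMap.ker (linearMap π)).mkQ y := by
      rw [LinearEquiv.symm_apply_eq]
      rfl
    simp [s, this]
  have hπf : ∀ x, linearMap π (linearMap f x) = 0 := fun x => (hker _).2 ⟨x, rfl⟩
  refine ⟨s, fun {i q} hq => ?_, fun q => ?_, fun q => ?_, fun y => ?_⟩
  · obtain ⟨y, rfl⟩ := hπ q
    rw [← Q.proj_of_mem hq, ← linearMap_proj, hs]
    exact sub_mem (N.proj_mem i y) (linearMap_mem f (hr i _ (N.proj_mem i y)))
  · obtain ⟨y, rfl⟩ := hπ q
    rw [hs, map_sub, hπf, sub_zero]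
  · obtain ⟨y, rfl⟩ := hπ q
    rw [hs, map_sub, hrf, sub_self]
  · rw [hs, add_sub_cancel]

end CDGModule

end Algebra

namespace CDGDeformation

variable {k : Type v} [CommRing k] {A : DGAlgebra.{v, u} k} {n : ℕ} {An : CDGDeformation A n}

section Lifting

variable {M N P X Y Q : CDGModule An.toCDGAlgebra}

lemma isNAcyclic_of_forall_eq_zero (h : ∀ x : M.carrier, x = 0) : An.IsNAcyclic M :=
  isNAcyclic_iff.2 fun _ _ z _ _ =>
    ⟨0, zero_mem _, by rw [map_zero]; exact Prod.ext (h z.1).symm (h z.2).symm⟩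

lemma initial_eq_zero (x : (⊥_ (CDGModule An.toCDGAlgebra)).carrier) : x = 0 :=
  CDGModule.eq_zero_of_isInitial (M := ⊥_ (CDGModule An.toCDGAlgebra)) initialIsInitial x

lemma kerSurjections_zero_initial (M : CDGModule An.toCDGAlgebra) :
    An.kerSurjections (0 : M ⟶ ⊥_ (CDGModule An.toCDGAlgebra)) := fun _ _ _ y _ =>
  ⟨0, smul_zero _, by rw [initial_eq_zero y, map_zero]⟩

lemma generatingCofibrations_rlp_coneId_zero (M : CDGModule An.toCDGAlgebra) :
    An.generatingCofibrations.rlp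
      (0 : CDGModule.cone (𝟙 M) ⟶ ⊥_ (CDGModule An.toCDGAlgebra)) :=
  (An.generatingCofibrations_rlp_iff _).2 ⟨kerSurjections_zero_initial _,
    isNQuasiIso_of_isNAcyclic (isNAcyclic_cone_id M) (isNAcyclic_of_forall_eq_zero initial_eq_zero) _⟩

/-- Both cones are acyclic, so the map is a weak equivalence; kernels are surjected onto
componentwise. Lifting a closed map through it amounts to lifting a graded map along p with
prescribed failure to be closed. -/
lemma generatingCofibrations_rlp_coneIdMap {p : X ⟶ Y} (hp : An.generatingCofibrations.rlp p) :
    An.generatingCofibrations.rlp (CDGModule.coneIdMap p) := by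
  obtain ⟨hp₁, hp₂⟩ := (An.generatingCofibrations_rlp_iff p).1 hp
  refine (An.generatingCofibrations_rlp_iff _).2
    ⟨fun i hi hi' q hq => ?_, isNQuasiIso_of_isNAcyclic (isNAcyclic_cone_id X) hp₂ _⟩
  obtain ⟨y, x, rfl⟩ : ∃ y x, CDGModule.coneMk p y x = q := ⟨_, _, CDGModule.coneMk_eta p q⟩
  change An.t ^ i • CDGModule.coneMk p y x = 0 at hq
  rw [t_pow_smul_coneMk, coneMk_eq_zero] at hq
  obtain ⟨y', hy', rfl⟩ := hp₁ i hi hi' hq.1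
  refine ⟨CDGModule.coneMk (𝟙 X) y' x, ?_, CDGModule.coneIdMap_mk p y' x⟩
  change An.t ^ i • CDGModule.coneMk (𝟙 X) y' x = 0
  rw [t_pow_smul_coneMk, coneMk_eq_zero]
  exact ⟨hy', hq.2⟩

/-- Since cone(id_M) → 0 is a trivial fibration, the inclusion of M into cone(id_M) extends along f.
The first component of the extension is graded linear, though not closed, and is the retraction. -/
lemma isGradedSplitInjection_of_llp {f : M ⟶ N} (hf : An.generatingCofibrations.rlp.llp f) :
    CDGModule.IsGradedSplitInjection f := by
  have := hf _ (generatingCofibrations_rlp_coneId_zero M)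
  have sq : CommSq (CDGModule.coneInl (𝟙 M)) f
    (0 : CDGModule.cone (𝟙 M) ⟶ ⊥_ (CDGModule An.toCDGAlgebra)) 0 := ⟨by simp⟩
  refine ⟨CDGModule.coneFstLinear (𝟙 M) ∘ₗ CDGModule.linearMap sq.lift,
    fun i y hy => (CDGModule.linearMap_mem sq.lift hy).1, fun x => ?_⟩
  exact congrArg (CDGModule.coneFst (𝟙 M)) (CDGModule.linearMap_eq_of_comp_eq' sq.fac_left x)

/-- The map 0 → Q is the pushout of f along M → 0: lift along f with zero on M, then descend to Q.
-/
lemma llp_initial_of_llp (W : MorphismProperty (CDGModule An.toCDGAlgebra)) {f : M ⟶ N}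
    (hf : W.llp f) (π : N ⟶ Q) (hπ : Function.Surjective (CDGModule.linearMap π))
    (hker : ∀ y, CDGModule.linearMap π y = 0 ↔ ∃ x, CDGModule.linearMap f x = y) :
    W.llp (initial.to Q) := by
  rw [llp_initial_iff]
  intro X Y p hp g
  have := hf p hp
  have hfπ : f ≫ π = 0 := CDGModule.hom_ext' fun x => (hker _).2 ⟨x, rfl⟩
  have sq : CommSq (0 : M ⟶ X) f p (π ≫ g) := ⟨by
    rw [← Category.assoc, hfπ, zero_comp, zero_comp]⟩
  obtain ⟨h, hh⟩ := CDGModule.exists_desc π hπ sq.lift fun x hx => by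
    obtain ⟨y, rfl⟩ := (hker x).1 hx
    exact CDGModule.linearMap_eq_of_comp_eq' sq.fac_left y
  have : Epi π := CDGModule.epi_of_surjective _ hπ
  refine ⟨h, ?_⟩
  rw [← cancel_epi π, ← Category.assoc, hh]
  exact sq.fac_right

/-- With a graded section s of π, N is M ⊕ Q twisted by a map φ : Q → M of degree 1. A diagonal has
the form u∘r + h∘π, where h is graded with p∘h = w∘s and dh - hd = u∘φ. Such an h is the first
component of a lift of the closed map (w∘s, -u∘φ) : Q → cone(p) to cone(id_X). -/
lemma llp_of_isGradedSplitInjection {f : M ⟶ N} (hf : CDGModule.IsGradedSplitInjection f)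
    (π : N ⟶ Q) (hπ : Function.Surjective (CDGModule.linearMap π))
    (hker : ∀ y, CDGModule.linearMap π y = 0 ↔ ∃ x, CDGModule.linearMap f x = y)
    (hQ : An.generatingCofibrations.rlp.llp (initial.to Q)) :
    An.generatingCofibrations.rlp.llp f := by
  intro X Y p hp
  refine ⟨fun {u w} sq => ?_⟩
  obtain ⟨r, hr, hrf⟩ := hf
  obtain ⟨s, hs, hπs, hrs, hfs⟩ := CDGModule.exists_section f r hr hrf π hπ hker
  have hpu : ∀ x, CDGModule.linearMap p (CDGModule.linearMap u x) =
      CDGModule.linearMap w (CDGModule.linearMap f x) :=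
    CDGModule.linearMap_eq_of_comp_eq sq.w
  -- the connecting map of degree one
  let φ : Q.carrier →+ M.carrier := r.toAddMonoidHom.comp (N.d.comp s.toAddMonoidHom)
  have hφ : ∀ q, φ q = r (N.d (s q)) := fun _ => rfl
  have hds : ∀ q, N.d (s q) = CDGModule.linearMap f (φ q) + s (Q.d q) := fun q => by
    have h := hfs (N.d (s q))
    rwa [CDGModule.linearMap_d π, hπs] at h
  have hφd : ∀ q, φ (Q.d q) = -M.d (φ q) := fun q => by
    have h : r (N.d (N.d (s q))) = 0 := by rw [N.d_d, map_smul, hrs, smul_zero]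
    rw [hds, map_add, map_add, ← CDGModule.linearMap_d, hrf, ← hφ] at h
    exact eq_neg_of_add_eq_zero_right h
  -- The two closedness conditions on (w∘s, -u∘φ) follow from `hds` and `hφd`.
  obtain ⟨H, hH⟩ := (llp_initial_iff _ Q).1 hQ _ (generatingCofibrations_rlp_coneIdMap hp)
    (CDGModule.coneLift (f := p) (CDGModule.linearMap w ∘ₗ s)
      (-((CDGModule.linearMap u).toAddMonoidHom.comp φ))
      (fun hq => CDGModule.linearMap_mem w (hs hq))
      (fun hq => neg_mem (CDGModule.linearMap_mem u (hr _ _ (N.d_mem (hs hq)))))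
      (fun a q => by
        change -CDGModule.linearMap u (φ (a • q)) = _ • -CDGModule.linearMap u (φ q)
        rw [hφ, map_smul, N.d_smul', map_add, map_smul, map_smul, hrs, smul_zero, zero_add,
          map_smul, smul_neg, hφ])
      (fun q => by
        change CDGModule.linearMap w (s (Q.d q)) = Y.d (CDGModule.linearMap w (s q)) +
          CDGModule.linearMap p (-CDGModule.linearMap u (φ q))
        rw [← CDGModule.linearMap_d, hds, map_add, map_neg, hpu]
        abel)
      (fun q => by
        change -CDGModule.linearMap u (φ (Q.d q)) = -X.d (-CDGModule.linearMap u (φ q))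
        rw [hφd, map_neg, CDGModule.linearMap_d, map_neg]))
  have hH₁ : ∀ q, CDGModule.linearMap p
      (CDGModule.coneFst (𝟙 X) (CDGModule.linearMap H q)) = CDGModule.linearMap w (s q) :=
    fun q => congrArg (CDGModule.coneFst p) (CDGModule.linearMap_eq_of_comp_eq' hH q)
  have hH₂ : ∀ q, CDGModule.coneSnd (𝟙 X) (CDGModule.linearMap H q) =
      -CDGModule.linearMap u (φ q) :=
    fun q => congrArg (CDGModule.coneSnd p) (CDGModule.linearMap_eq_of_comp_eq' hH q)
  let h : Q.carrier →ₗ[An.carrier] X.carrier :=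
    CDGModule.coneFstLinear (𝟙 X) ∘ₗ CDGModule.linearMap H
  have hh : ∀ q, h q = CDGModule.coneFst (𝟙 X) (CDGModule.linearMap H q) := fun _ => rfl
  have hhd : ∀ q, h (Q.d q) = X.d (h q) - CDGModule.linearMap u (φ q) := fun q => by
    rw [hh, CDGModule.linearMap_d, CDGModule.coneFst_d, hH₂, map_neg, CDGModule.linearMap_id,
      sub_eq_add_neg, hh]
  have hrd : ∀ x, r (N.d x) = M.d (r x) + φ (CDGModule.linearMap π x) := fun x => by
    conv_lhs => rw [hfs x]
    rw [map_add, map_add, ← CDGModule.linearMap_d, hrf, hφ]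
  refine ⟨⟨⟨CDGModule.mkHom (CDGModule.linearMap u ∘ₗ r + h ∘ₗ CDGModule.linearMap π)
    (fun {i x} hx => add_mem (CDGModule.linearMap_mem u (hr i x hx))
      (CDGModule.linearMap_mem H (CDGModule.linearMap_mem π hx)).1)
    (fun x => ?_), CDGModule.hom_ext' fun x => ?_, CDGModule.hom_ext' fun x => ?_⟩⟩⟩
  · change CDGModule.linearMap u (r (N.d x)) + h (CDGModule.linearMap π (N.d x)) =
      X.d (CDGModule.linearMap u (r x) + h (CDGModule.linearMap π x))
    rw [hrd, CDGModule.linearMap_d, hhd, map_add, map_add, CDGModule.linearMap_d]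
    abel
  · change CDGModule.linearMap u (r (CDGModule.linearMap f x)) +
      h (CDGModule.linearMap π (CDGModule.linearMap f x)) = CDGModule.linearMap u x
    rw [hrf, (hker _).2 ⟨x, rfl⟩, map_zero, add_zero]
  · change CDGModule.linearMap p (CDGModule.linearMap u (r x) + h (CDGModule.linearMap π x)) =
      CDGModule.linearMap w x
    rw [map_add, hpu, hh, hH₁, ← map_add, ← hfs]

lemma generatingCofibrations_llp_iff (f : M ⟶ N) : An.generatingCofibrations.rlp.llp f ↔
    CDGModule.IsGradedSplitInjection f ∧
      An.generatingCofibrations.rlp.llp (initial.to (CDGModule.coker f)) :=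
  ⟨fun hf => ⟨isGradedSplitInjection_of_llp hf, llp_initial_of_llp (Q := CDGModule.coker f) _ hf
      (CDGModule.quotientπ (CDGModule.range f)) (CDGModule.quotientπ_surjective _)
      (CDGModule.quotientπ_eq_zero_iff _)⟩,
    fun ⟨hf, hf'⟩ => llp_of_isGradedSplitInjection (Q := CDGModule.coker f) hf (CDGModule.quotientπ (CDGModule.range f))
      (CDGModule.quotientπ_surjective _) (CDGModule.quotientπ_eq_zero_iff _) hf'⟩

/-! ### Trivial cofibrations -/

variable (N) in
/-- A surjection to `N` from a cone of an identity. -/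
def pathFibration : CDGModule.cone (𝟙 (N.shift (-1))) ⟶ N :=
  CDGModule.coneπ _ ≫ (N.shiftShiftIso (neg_add_cancel 1)).inv ≫ N.shiftZeroIso.inv

lemma kerSurjections_pathFibration : An.kerSurjections (pathFibration N) := by
  intro i _ _ y hy
  refine ⟨CDGModule.coneMk _ 0 (N.toShift (-1) y), ?_, rfl⟩
  change An.t ^ i • CDGModule.coneMk _ 0 (N.toShift (-1) y) = 0
  rw [t_pow_smul_coneMk, smul_zero, CDGModule.smul_toShift,
    CDGAlgebra.sign_of_even_mem _ Even.zero (An.t_pow_mem i)]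
  rw [show An.t ^ i • y = 0 from hy, map_zero, CDGModule.coneMk_zero]

/-- Since M → 0 is a fibration, f has a closed retraction r. As id_N - f∘r vanishes on M, it lifts
through `pathFibration N`, whose source is acyclic, so it is zero on the homology of every Hom(Γ_i,
-). -/
lemma isNQuasiIso_of_llp_kerSurjections {f : M ⟶ N} (hf : An.kerSurjections.llp f) :
    An.IsNQuasiIso f := by
  have := hf _ (kerSurjections_zero_initial M)
  have sq : CommSq (𝟙 M) f (0 : M ⟶ ⊥_ (CDGModule An.toCDGAlgebra)) 0 := ⟨by simp⟩
  have := hf _ (kerSurjections_pathFibration (N := N))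
  have sq' : CommSq 0 f (pathFibration N) (𝟙 N - sq.lift ≫ f) := ⟨by
    rw [zero_comp, Preadditive.comp_sub, ← Category.assoc, sq.fac_left, Category.id_comp,
      Category.comp_id, sub_self]⟩
  have h₁ : ∀ z, homMap (An := An) sq.lift (homMap f z) = z := fun z => by
    rw [← homMap_comp, sq.fac_left]
    rfl
  have h₂ : ∀ w, w = homMap (An := An) f (homMap sq.lift w) +
      homMap (pathFibration N) (homMap sq'.lift w) := fun w => by
    have h : ∀ x, x = CDGModule.linearMap f (CDGModule.linearMap sq.lift x) +
        CDGModule.linearMap (pathFibration N) (CDGModule.linearMap sq'.lift x) := fun x => by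
      rw [CDGModule.linearMap_eq_of_comp_eq' sq'.fac_right, CDGModule.linearMap_sub,
        CDGModule.linearMap_comp, CDGModule.linearMap_id, add_sub_cancel]
    exact Prod.ext (h w.1) (h w.2)
  refine (isNQuasiIso_iff f).2 fun i hi => ⟨fun z hz _ y hy hzy => ?_, fun w hw hDw => ?_⟩
  · exact ⟨homMap sq.lift y, homMap_mem _ hy, by rw [← homMap_D, ← hzy, h₁]⟩
  · obtain ⟨v, hv, hv'⟩ := isNAcyclic_iff.1 (isNAcyclic_cone_id (N.shift (-1))) i hi
      (homMap sq'.lift w) (homMap_mem _ hw) (by rw [← homMap_D, hDw, map_zero])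
    refine ⟨homMap sq.lift w, homMap_mem _ hw, by rw [← homMap_D, hDw, map_zero],
      homMap (pathFibration N) v, homMap_mem _ hv, ?_⟩
    rw [← homMap_D, hv']
    exact h₂ w

variable (An) in
lemma generatingTrivialCofibrations_rlp :
    An.generatingTrivialCofibrations.rlp = An.kerSurjections := by
  ext M N f
  exact An.generatingTrivialCofibrations_rlp_iff f

variable (An) in
lemma generatingCofibrations_rlp :
    An.generatingCofibrations.rlp = An.kerSurjections ⊓ An.nQuasiIsos := by
  ext M N f
  exact An.generatingCofibrations_rlp_iff f

variable (An) in
-- The retract argument: factor f through the generating trivial cofibrations. Two-out-of-three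
-- makes the second factor a trivial fibration, so f lifts against it and is a retract of the first
-- factor.
lemma generatingTrivialCofibrations_rlp_llp :
    An.generatingTrivialCofibrations.rlp.llp =
      An.generatingCofibrations.rlp.llp ⊓ An.nQuasiIsos := by
  have key : An.generatingTrivialCofibrations.rlp.llp ≤ An.nQuasiIsos := fun M N f hf => by
    rw [generatingTrivialCofibrations_rlp] at hf
    exact isNQuasiIso_of_llp_kerSurjections hf
  apply le_antisymm
  · refine le_inf (MorphismProperty.antitone_llp ?_) key
    rw [generatingTrivialCofibrations_rlp, generatingCofibrations_rlp]
    exact inf_le_left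
  · rintro M N f ⟨hf, hf'⟩
    let h := MorphismProperty.factorizationData An.generatingTrivialCofibrations.rlp.llp
      An.generatingTrivialCofibrations.rlp f
    have hp : An.generatingCofibrations.rlp h.p := by
      rw [generatingCofibrations_rlp]
      refine ⟨?_, An.nQuasiIsos.of_precomp h.i h.p (key _ h.hi) (by rwa [h.fac])⟩
      exact (An.generatingTrivialCofibrations_rlp_iff _).1 h.hp
    have := hf _ hp
    exact MorphismProperty.of_retract (RetractArrow.ofLeftLiftingProperty h.fac) h.hi

end Lifting

end CDGDeformation

end Curved
-- Semifree modules and cell complexes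
namespace Curved

open CategoryTheory.Limits
open scoped CDGModule

section Algebra

variable {R : Type v} [CommRing R] {B : CDGAlgebra.{v, u} R}

/-! ### Cokernels -/

/-- The morphism `π` is a cokernel of `f`. -/
structure IsCokernel {C : Type*} [Category* C] [Preadditive C] {X Y Q : C} (f : X ⟶ Y)
    (π : Y ⟶ Q) : Prop where
  comp_eq_zero : f ≫ π = 0
  epi : Epi π
  exists_desc : ∀ {Z : C} (h : Y ⟶ Z), f ≫ h = 0 → ∃ h', π ≫ h' = h

lemma IsCokernel.of_isPushout {C : Type*} [Category* C] [Preadditive C] {X Y X' Y' Q : C}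
    {a : X ⟶ X'} {f : X ⟶ Y} {f' : X' ⟶ Y'} {b : Y ⟶ Y'} (sq : IsPushout a f f' b) {π : Y ⟶ Q}
    (h : IsCokernel f π) : ∃ π' : Y' ⟶ Q, IsCokernel f' π' := by
  have := h.epi
  have h₁ := sq.inl_desc 0 π (by rw [h.comp_eq_zero, comp_zero])
  have h₂ := sq.inr_desc 0 π (by rw [h.comp_eq_zero, comp_zero])
  refine ⟨_, h₁, ⟨fun x y hxy => ?_⟩, fun {Z} g hg => ?_⟩
  · rw [← cancel_epi π, ← h₂, Category.assoc, Category.assoc, hxy]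
  · obtain ⟨h', hh'⟩ := h.exists_desc (b ≫ g) (by
      rw [← Category.assoc, ← sq.w, Category.assoc, hg, comp_zero])
    refine ⟨h', sq.hom_ext ?_ ?_⟩
    · rw [← Category.assoc, h₁, zero_comp, hg]
    · rw [← Category.assoc, h₂, hh']

lemma IsCokernel.comp_iso {C : Type*} [Category* C] [Preadditive C] {X Y Q Q' : C}
    {f : X ⟶ Y} {π : Y ⟶ Q} (h : IsCokernel f π) (e : Q ≅ Q') : IsCokernel f (π ≫ e.hom) where
  comp_eq_zero := by rw [← Category.assoc, h.comp_eq_zero, zero_comp]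
  epi := by
    have := h.epi
    infer_instance
  exists_desc g hg := by
    obtain ⟨h', hh'⟩ := h.exists_desc g hg
    exact ⟨e.inv ≫ h', by rw [Category.assoc, Iso.hom_inv_id_assoc, hh']⟩

/-- The map from a stage to the colimit is the transfinite composition of the remaining steps. -/
lemma llp_rlp_incl_app {C : Type*} [Category* C] (I : MorphismProperty C) {J : Type*}
    [LinearOrder J] [SuccOrder J] [OrderBot J] [WellFoundedLT J] {X Y : C} {f : X ⟶ Y}
    (c : (MorphismProperty.coproducts.{u} I).pushouts.TransfiniteCompositionOfShape J f) (j : J) :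
    I.rlp.llp (c.incl.app j) :=
  I.transfiniteCompositionsOfShape_pushouts_coproducts_le_llp_rlp _ _ ⟨c.ici j⟩

namespace CDGModule

/-- The projection of Q modulo the image of π is killed by the epimorphism π, hence is zero. -/
lemma IsCokernel.surjective {X Y Q : CDGModule B} {f : X ⟶ Y} {π : Y ⟶ Q}
    (h : IsCokernel f π) : Function.Surjective (linearMap π) := fun q => by
  have := h.epi
  have h₀ : quotientπ (range π) = 0 := by
    rw [← cancel_epi π, comp_quotientπ_range, comp_zero]
  exact (quotientπ_eq_zero_iff (range π) q).1 (congrArg (fun φ => linearMap φ q) h₀)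

lemma IsCokernel.eq_zero_iff {X Y Q : CDGModule B} {f : X ⟶ Y} {π : Y ⟶ Q}
    (h : IsCokernel f π) (y : Y.carrier) :
    linearMap π y = 0 ↔ ∃ x, linearMap f x = y := by
  constructor
  · intro hy
    obtain ⟨h', hh'⟩ := h.exists_desc _ (comp_quotientπ_range f)
    refine (quotientπ_eq_zero_iff (range f) y).1 ?_
    rw [← linearMap_eq_of_comp_eq' hh', hy, map_zero]
  · rintro ⟨x, rfl⟩
    exact linearMap_eq_of_comp_eq' h.comp_eq_zero x

lemma isCokernel_of_surjective {X Y Q : CDGModule B} {f : X ⟶ Y} {π : Y ⟶ Q}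
    (hπ : Function.Surjective (linearMap π))
    (hker : ∀ y, linearMap π y = 0 ↔ ∃ x, linearMap f x = y) : IsCokernel f π where
  comp_eq_zero := hom_ext' fun x => (hker _).2 ⟨x, rfl⟩
  epi := epi_of_surjective _ hπ
  exists_desc h hh := exists_desc π hπ h fun y hy => by
    obtain ⟨x, rfl⟩ := (hker y).1 hy
    exact linearMap_eq_of_comp_eq' hh x

lemma isCokernel_coneπ {X Y : CDGModule B} (f : X ⟶ Y) : IsCokernel (coneInl f) (coneπ f) :=
  isCokernel_of_surjective (fun x => ⟨coneMk f 0 x, rfl⟩) fun p => by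
    obtain ⟨y, x, rfl⟩ : ∃ y x, coneMk f y x = p := ⟨_, _, coneMk_eta f p⟩
    constructor
    · intro hx
      have hx' : x = 0 := hx
      exact ⟨y, by rw [hx']; rfl⟩
    · rintro ⟨z, hz⟩
      exact (congrArg (coneSnd f) hz).symm

/-- The projection from `T` to `T / S`. -/
def subquotientπ {M : CDGModule B} (T S : QDGSubmodule M.toQDGModule) :
    sub T ⟶ subquotient T S :=
  quotientπ (M := sub T) (S.restrict T)

lemma subquotientπ_surjective {M : CDGModule B} (T S : QDGSubmodule M.toQDGModule) :
    Function.Surjective (linearMap (subquotientπ T S)) :=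
  quotientπ_surjective (M := sub T) (S.restrict T)

lemma subquotientπ_eq_zero_iff {M : CDGModule B} (T S : QDGSubmodule M.toQDGModule)
    (x : T.toSubmodule) : linearMap (subquotientπ T S) x = 0 ↔ (x : M.carrier) ∈ S.toSubmodule :=
  quotientπ_eq_zero_iff (M := sub T) (S.restrict T) x

/-- The projection from a module to its image. -/
def rangeπ {M N : CDGModule B} (f : M ⟶ N) : M ⟶ sub (range f) :=
  subLift (range f) f fun x => (⟨x, rfl⟩ : linearMap f x ∈ LinearMap.range (linearMap f))

lemma nonempty_iso_of_surjective {Y Q Q' : CDGModule B} (π : Y ⟶ Q) (π' : Y ⟶ Q')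
    (hπ : Function.Surjective (linearMap π)) (hπ' : Function.Surjective (linearMap π'))
    (h : ∀ y, linearMap π y = 0 ↔ linearMap π' y = 0) : Nonempty (Q ≅ Q') := by
  obtain ⟨g, hg⟩ := exists_desc π hπ π' fun y => (h y).1
  obtain ⟨g', hg'⟩ := exists_desc π' hπ' π fun y => (h y).2
  have := epi_of_surjective π hπ
  have := epi_of_surjective π' hπ'
  exact ⟨g, g', by rw [← cancel_epi π, ← Category.assoc, hg, hg', Category.comp_id],
    by rw [← cancel_epi π', ← Category.assoc, hg', hg, Category.comp_id]⟩

/-- Cokernels commute with coproducts. The target is the concrete `directSum`, as required by the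
definition of a semifree module, while the coproducts themselves are arbitrary colimit cocones. -/
lemma exists_isCokernel_of_coproducts {ι : Type u} {X₁ X₂ : Discrete ι ⥤ CDGModule B}
    {c₁ : Cocone X₁} {c₂ : Cocone X₂} (h₁ : IsColimit c₁) (h₂ : IsColimit c₂) (f : X₁ ⟶ X₂)
    (Q : ι → CDGModule B) (π : ∀ j, X₂.obj ⟨j⟩ ⟶ Q j) (hπ : ∀ j, IsCokernel (f.app ⟨j⟩) (π j)) :
    ∃ p : c₂.pt ⟶ directSum Q, IsCokernel (h₁.desc (Cocone.mk _ (f ≫ c₂.ι))) p := by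
  let s : Cocone X₂ := ⟨directSum Q, Discrete.natTrans fun ⟨j⟩ => π j ≫ directSumι Q j⟩
  have hs : ∀ j, c₂.ι.app ⟨j⟩ ≫ h₂.desc s = π j ≫ directSumι Q j := fun j => h₂.fac s ⟨j⟩
  have hf : ∀ j, c₁.ι.app ⟨j⟩ ≫ h₁.desc (Cocone.mk _ (f ≫ c₂.ι)) = f.app ⟨j⟩ ≫ c₂.ι.app ⟨j⟩ :=
    fun j => h₁.fac (Cocone.mk _ (f ≫ c₂.ι)) ⟨j⟩
  refine ⟨h₂.desc s, h₁.hom_ext fun ⟨j⟩ => ?_, ⟨fun x y hxy => ?_⟩, fun {Z} g hg => ?_⟩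
  · rw [← Category.assoc, hf, Category.assoc, hs, ← Category.assoc, (hπ j).comp_eq_zero, zero_comp,
      comp_zero]
  · refine directSum_hom_ext fun j => ?_
    have := (hπ j).epi
    rw [← cancel_epi (π j), ← Category.assoc, ← Category.assoc, ← hs, Category.assoc,
      Category.assoc, hxy]
  · choose h' hh' using fun j => (hπ j).exists_desc (c₂.ι.app ⟨j⟩ ≫ g) (by
      rw [← Category.assoc, ← hf, Category.assoc, hg, comp_zero])
    refine ⟨directSumDesc h', h₂.hom_ext fun ⟨j⟩ => ?_⟩
    rw [← Category.assoc, hs, Category.assoc, directSumι_desc, hh']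

/-! ### Filtrations -/

section Filtration

variable {P : CDGModule B} (F : ℕ → QDGSubmodule P.toQDGModule)

/-- P is the union of the F i. The proof presents it as a quotient of their direct sum: any element
is represented at one stage, where compatibility shows that relations are respected. -/
lemma exists_hom_of_filtration (hF : ∀ x : P.carrier, ∃ i, x ∈ (F i).toSubmodule)
    (hF' : ∀ i, (F i).toSubmodule ≤ (F (i + 1)).toSubmodule) {X : CDGModule B}
    (h : ∀ i, sub (F i) ⟶ X) (hh : ∀ i, subMap (hF' i) ≫ h (i + 1) = h i) :
    ∃ g : P ⟶ X, ∀ i, subι (F i) ≫ g = h i := by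
  have hmono : Monotone fun i => (F i).toSubmodule := monotone_nat_of_le_succ hF'
  have hh' : ∀ {i j} (hij : i ≤ j), subMap (hmono hij) ≫ h j = h i := fun {i j} hij => by
    induction j, hij using Nat.le_induction with
    | base => rfl
    | succ j hij ih =>
      rw [← ih, ← hh j]
      rfl
  -- The lift of ℕ matches the universe of index types of `directSum`.
  let N : ULift.{u} ℕ → CDGModule B := fun i => sub (F i.down)
  let π : directSum N ⟶ P := directSumDesc fun i => subι (F i.down)
  let f : directSum N ⟶ X := directSumDesc fun i => h i.down
  have key : ∀ x, ∃ (j : ℕ) (y : (F j).toSubmodule),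
      linearMap π x = (y : P.carrier) ∧ linearMap f x = linearMap (h j) y := fun x => by
    induction x using directSum_induction with
    | zero => exact ⟨0, 0, map_zero _, by rw [map_zero]; exact (map_zero _).symm⟩
    | ι j x =>
      exact ⟨j.down, x, directSumDesc_ι_apply (N := N) _ j x, directSumDesc_ι_apply (N := N) _ j x⟩
    | add x y hx hy =>
      obtain ⟨i, x', hx, hx'⟩ := hx
      obtain ⟨j, y', hy, hy'⟩ := hy
      refine ⟨max i j, Submodule.inclusion (hmono (le_max_left i j)) x' +
        Submodule.inclusion (hmono (le_max_right i j)) y', ?_, ?_⟩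
      · rw [map_add, hx, hy]
        rfl
      · rw [map_add, hx', hy', ← hh' (le_max_left i j), ← hh' (le_max_right i j)]
        exact (map_add (linearMap (h (max i j))) _ _).symm
  obtain ⟨g, hg⟩ := exists_desc π (fun x => by
      obtain ⟨i, hi⟩ := hF x
      exact ⟨linearMap (directSumι N ⟨i⟩) (⟨x, hi⟩ : (F i).toSubmodule),
        directSumDesc_ι_apply (N := N) _ _ _⟩) f fun x hx => by
    obtain ⟨j, y, hy, hy'⟩ := key x
    have : y = 0 := Subtype.ext (hy.symm.trans hx)
    rw [hy', this]
    exact map_zero _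
  refine ⟨g, fun i => ?_⟩
  rw [← directSumι_desc (N := N) (fun i => subι (F i.down)) ⟨i⟩, Category.assoc]
  exact (congrArg (directSumι N ⟨i⟩ ≫ ·) hg).trans (directSumι_desc (N := N) _ ⟨i⟩)

end Filtration

end CDGModule

end Algebra

namespace CDGDeformation

variable {k : Type v} [CommRing k] {A : DGAlgebra.{v, u} k} {n : ℕ} {An : CDGDeformation A n}

section Semifree

variable {M N P X Y Q : CDGModule An.toCDGAlgebra}

lemma llp_initial_of_iso (W : MorphismProperty (CDGModule An.toCDGAlgebra)) (e : Q ≅ P)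
    (h : W.llp (initial.to P)) : W.llp (initial.to Q) := by
  rw [llp_initial_iff] at h ⊢
  intro X Y p hp g
  obtain ⟨φ, hφ⟩ := h p hp (e.inv ≫ g)
  exact ⟨e.hom ≫ φ, by rw [Category.assoc, hφ, Iso.hom_inv_id_assoc]⟩

lemma llp_initial_directSum (W : MorphismProperty (CDGModule An.toCDGAlgebra)) {ι : Type u}
    (F : ι → CDGModule An.toCDGAlgebra) (h : ∀ j, W.llp (initial.to (F j))) :
    W.llp (initial.to (CDGModule.directSum F)) := by
  simp only [llp_initial_iff] at h ⊢
  intro X Y p hp g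
  choose φ hφ using fun j => h j p hp (CDGModule.directSumι F j ≫ g)
  refine ⟨CDGModule.directSumDesc φ, CDGModule.directSum_hom_ext fun j => ?_⟩
  rw [← Category.assoc, CDGModule.directSumι_desc, hφ]

variable (An) in
/-- The projection from the cone of the identity of `Γ_i[l]` to `Γ_i[l + 1]`. -/
def gammaProj (i : Fin (n + 1)) (l : ℤ) : An.gammaCone i l ⟶ An.gammaShift i (l + 1) :=
  CDGModule.coneπ _ ≫ ((An.gamma i).shiftShiftIso rfl).inv

lemma isCokernel_gammaProj (i : Fin (n + 1)) (l : ℤ) :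
    IsCokernel (An.gammaIncl i l) (An.gammaProj i l) :=
  (CDGModule.isCokernel_coneπ (𝟙 (An.gammaShift i l))).comp_iso
    ((An.gamma i).shiftShiftIso rfl).symm

/-- Γ_i[l] is the cokernel of the generating cofibration with source Γ_i[l-1]. -/
lemma llp_initial_gammaShift (i : Fin (n + 1)) (l : ℤ) :
    An.generatingCofibrations.rlp.llp (initial.to (An.gammaShift i l)) := by
  obtain ⟨l, rfl⟩ : ∃ m, l = m + 1 := ⟨l - 1, by ring⟩
  exact llp_initial_of_llp _ (An.generatingCofibrations.le_llp_rlp _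
    (MorphismProperty.ofHoms.mk ((i, l) : Fin (n + 1) × ℤ)))
    (An.gammaProj i l) (CDGModule.IsCokernel.surjective (isCokernel_gammaProj i l))
    (CDGModule.IsCokernel.eq_zero_iff (isCokernel_gammaProj i l))

/-- Each inclusion of the filtration is graded split with cofibrant cokernel, hence a cofibration;
lifts are built step by step from F 0 = 0 and glued on the union. -/
lemma llp_initial_of_isNSemifree (hP : An.IsNSemifree P) :
    An.generatingCofibrations.rlp.llp (initial.to P) := by
  obtain ⟨F, hF₀, hF, hF'⟩ := hP
  have hle : ∀ i, (F i).toSubmodule ≤ (F (i + 1)).toSubmodule := fun i => (hF' i).1.choose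
  have hcof : ∀ i, An.generatingCofibrations.rlp.llp (CDGModule.subMap (hle i)) := fun i => by
    obtain ⟨⟨h, hs⟩, ι, s, l, ⟨e⟩⟩ := hF' i
    refine llp_of_isGradedSplitInjection (N := CDGModule.sub (F (i + 1))) hs
      (CDGModule.subquotientπ (F (i + 1)) (F i)) (CDGModule.subquotientπ_surjective _ _)
      (fun y => (CDGModule.subquotientπ_eq_zero_iff _ _ y).trans ?_)
      (llp_initial_of_iso (Q := CDGModule.subquotient (F (i + 1)) (F i)) _ e
        (llp_initial_directSum _ _ fun j => llp_initial_gammaShift _ _))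
    constructor
    · intro hy
      exact ⟨⟨_, hy⟩, Subtype.ext rfl⟩
    · rintro ⟨x, rfl⟩
      exact x.2
  rw [llp_initial_iff]
  intro X Y p hp g
  have step : ∀ (i : ℕ) (h : {h : CDGModule.sub (F i) ⟶ X // h ≫ p = CDGModule.subι (F i) ≫ g}),
      ∃ h' : {h' : CDGModule.sub (F (i + 1)) ⟶ X // h' ≫ p = CDGModule.subι (F (i + 1)) ≫ g},
        CDGModule.subMap (hle i) ≫ h'.1 = h.1 := by
    rintro i ⟨h, hh⟩
    have := hcof i p hp
    have sq : CommSq h (CDGModule.subMap (hle i)) p (CDGModule.subι (F (i + 1)) ≫ g) := ⟨hh⟩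
    exact ⟨⟨sq.lift, sq.fac_right⟩, sq.fac_left⟩
  choose next hnext using step
  have hzero : ∀ x : (F 0).toSubmodule, x = 0 := fun x =>
    Subtype.ext ((Submodule.mem_bot _).1 (hF₀.le x.2))
  let h : ∀ i, {h : CDGModule.sub (F i) ⟶ X // h ≫ p = CDGModule.subι (F i) ≫ g} := fun i =>
    Nat.rec ⟨0, CDGModule.hom_ext' fun x => by
      rw [hzero x]
      exact (map_zero _).trans (map_zero _).symm⟩ (fun i h => next i h) i
  obtain ⟨φ, hφ⟩ := CDGModule.exists_hom_of_filtration F hF hle (fun i => (h i).1)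
    fun i => hnext i (h i)
  refine ⟨φ, CDGModule.hom_ext' fun x => ?_⟩
  obtain ⟨i, hi⟩ := hF x
  have h₁ := CDGModule.linearMap_eq_of_comp_eq' (hφ i) (⟨x, hi⟩ : (F i).toSubmodule)
  have h₂ := CDGModule.linearMap_eq_of_comp_eq (h i).2 (⟨x, hi⟩ : (F i).toSubmodule)
  rw [← h₁] at h₂
  exact h₂

/-! ### Cofibrant modules are retracts of semifree modules -/

lemma exists_isCokernel_of_generatingCofibrations {f : M ⟶ N} (hf : An.generatingCofibrations f) :
    ∃ (s : Fin (n + 1)) (l : ℤ) (π : N ⟶ An.gammaShift s l), IsCokernel f π := by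
  obtain ⟨i, l⟩ := hf
  exact ⟨i, l + 1, _, isCokernel_gammaProj i l⟩

lemma exists_isCokernel_of_pushouts_coproducts {f : M ⟶ N}
    (hf : (MorphismProperty.coproducts.{u} An.generatingCofibrations).pushouts f) :
    ∃ (ι : Type u) (s : ι → Fin (n + 1)) (l : ι → ℤ)
      (π : N ⟶ CDGModule.directSum fun j => (An.gamma (s j)).shift (l j)), IsCokernel f π := by
  obtain ⟨X, Y, g, a, b, hg, sq⟩ := hf
  rw [MorphismProperty.coproducts_iff] at hg
  obtain ⟨ι, X₁, X₂, c₁, c₂, h₁, h₂, φ, hφ⟩ := hg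
  choose s l π hπ using fun j : ι => exists_isCokernel_of_generatingCofibrations (hφ ⟨j⟩)
  obtain ⟨p, hp⟩ := CDGModule.exists_isCokernel_of_coproducts h₁ h₂ φ
    (fun j => (An.gamma (s j)).shift (l j)) π hπ
  exact ⟨ι, s, l, hp.of_isPushout sq⟩

/-- The filtration consists of the images of the stages. Each map from a stage to P is itself a
cofibration, hence graded split injective, which gives the splittings and identifies the
subquotients with the cokernels of the attaching steps. -/
lemma isNSemifree_of_transfiniteComposition {f : M ⟶ P} (hM : ∀ x : M.carrier, x = 0)
    (c : (MorphismProperty.coproducts.{u} An.generatingCofibrations).pushouts.TransfiniteCompositionOfShape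
      ℕ f) : An.IsNSemifree P := by
  let ι : ∀ i, c.F.obj i ⟶ P := fun i => c.incl.app i
  have hι : ∀ {i j : ℕ} (h : i ≤ j), c.F.map (homOfLE h) ≫ ι j = ι i := fun h =>
    (Cocone.mk P c.incl).w (homOfLE h)
  have hsplit : ∀ i, CDGModule.IsGradedSplitInjection (ι i) := fun i =>
    isGradedSplitInjection_of_llp (llp_rlp_incl_app An.generatingCofibrations c i)
  have hinj : ∀ i, Function.Injective (CDGModule.linearMap (ι i)) := fun i x y hxy => by
    obtain ⟨r, -, hr⟩ := hsplit i
    rw [← hr x, hxy, hr]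
  have hle : ∀ i, (CDGModule.range (ι i)).toSubmodule ≤
      (CDGModule.range (ι (i + 1))).toSubmodule := by
    rintro i _ ⟨x, rfl⟩
    exact ⟨CDGModule.linearMap (c.F.map (homOfLE (Nat.le_succ i))) x,
      CDGModule.linearMap_eq_of_comp_eq' (hι (Nat.le_succ i)) x⟩
  refine ⟨fun i => CDGModule.range (ι i), ?_, fun x => ?_, fun i => ⟨⟨hle i, ?_⟩, ?_⟩⟩
  · rw [eq_bot_iff]
    rintro _ ⟨x, rfl⟩
    have hx : x = 0 := by
      have h := hM (CDGModule.linearMap c.isoBot.hom x)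
      have h' := CDGModule.linearMap_eq_of_comp_eq' c.isoBot.hom_inv_id x
      rw [h, map_zero] at h'
      exact h'.symm
    rw [hx, map_zero]
    exact zero_mem _
  · obtain ⟨j, y, hy⟩ := CDGModule.exists_eq_of_isColimit c.isColimit x
    exact ⟨j, y, hy⟩
  · obtain ⟨r, hr, hr'⟩ := hsplit i
    refine ⟨((CDGModule.linearMap (ι i)).codRestrict (CDGModule.range (ι i)).toSubmodule
      fun x => ⟨x, rfl⟩) ∘ₗ r ∘ₗ (CDGModule.range (ι (i + 1))).toSubmodule.subtype,
      fun j y hy => CDGModule.linearMap_mem (ι i) (hr j _ hy), ?_⟩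
    rintro ⟨_, x, rfl⟩
    exact Subtype.ext (congrArg (CDGModule.linearMap (ι i)) (hr' x))
  · obtain ⟨κ, s, l, π, hπ⟩ := exists_isCokernel_of_pushouts_coproducts
      (c.map_mem i (not_isMax i))
    refine ⟨κ, s, l, CDGModule.nonempty_iso_of_surjective (Y := c.F.obj (i + 1))
      (Q := CDGModule.subquotient (CDGModule.range (ι (i + 1))) (CDGModule.range (ι i)))
      (CDGModule.rangeπ (ι (i + 1)) ≫ CDGModule.subquotientπ _ _) π ?_
      (CDGModule.IsCokernel.surjective hπ) fun y => ?_⟩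
    · intro q
      obtain ⟨⟨_, y, rfl⟩, rfl⟩ := CDGModule.subquotientπ_surjective _ _ q
      exact ⟨y, rfl⟩
    · refine (CDGModule.subquotientπ_eq_zero_iff _ _ _).trans
        (Iff.trans ?_ (CDGModule.IsCokernel.eq_zero_iff hπ y).symm)
      constructor
      · rintro ⟨x, hx⟩
        refine ⟨x, hinj (i + 1) ?_⟩
        exact (CDGModule.linearMap_eq_of_comp_eq' (hι (Nat.le_succ i)) x).trans hx
      · rintro ⟨x, rfl⟩
        exact ⟨x, (CDGModule.linearMap_eq_of_comp_eq' (hι (Nat.le_succ i)) x).symm⟩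

attribute [local instance] Cardinal.fact_isRegular_aleph0 Cardinal.orderBotAleph0OrdToType

lemma llp_initial_iff_exists_retract (Q : CDGModule An.toCDGAlgebra) :
    An.generatingCofibrations.rlp.llp (initial.to Q) ↔
      ∃ P : CDGModule An.toCDGAlgebra, An.IsNSemifree P ∧ Nonempty (Retract Q P) := by
  constructor
  · intro hQ
    -- Factor 0 → Q as a cell complex followed by a trivial fibration; lifting the identity of Q
    -- through the latter exhibits Q as a retract.
    obtain ⟨h, hh⟩ := (llp_initial_iff _ Q).1 hQ _
      (SmallObject.rlp_πObj An.generatingCofibrations Cardinal.aleph0.{u} (initial.to Q)) (𝟙 Q)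
    refine ⟨_, ?_, ⟨⟨h, _, hh⟩⟩⟩
    -- The small object argument is indexed by the ordinal ω, semifree filtrations by ℕ.
    let e : ℕ ≃o Cardinal.aleph0.{u}.ord.ToType :=
      ULift.orderIso.{u}.symm.trans
        (OrderIso.ofRelIsoLT (Nonempty.some (by simp [← Ordinal.type_eq])))
    have := SmallObject.transfiniteCompositionsOfShape_ιObj An.generatingCofibrations
      Cardinal.aleph0.{u} (initial.to Q)
    rw [← MorphismProperty.transfiniteCompositionsOfShape_eq_of_orderIso _ e] at this
    exact isNSemifree_of_transfiniteComposition initial_eq_zero this.some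
  · rintro ⟨P, hP, ⟨r⟩⟩
    rw [llp_initial_iff]
    intro X Y p hp g
    obtain ⟨h, hh⟩ := (llp_initial_iff _ P).1 (llp_initial_of_isNSemifree hP) p hp (r.r ≫ g)
    exact ⟨r.i ≫ h, by rw [Category.assoc, hh, Retract.retract_assoc]⟩

end Semifree

end CDGDeformation

end Curved
namespace Curved

open CategoryTheory.Limits HomotopicalAlgebra
open scoped CDGModule

lemma isWeakFactorizationSystem_llp_rlp {C : Type (u + 1)} [Category.{u} C]
    (I : MorphismProperty C) [MorphismProperty.HasSmallObjectArgument.{u} I] :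
    MorphismProperty.IsWeakFactorizationSystem I.rlp.llp I.rlp :=
  MorphismProperty.IsWeakFactorizationSystem.mk' _ _ fun _ p hi hp => hi p hp

namespace CDGDeformation

variable {k : Type v} [CommRing k] {A : DGAlgebra.{v, u} k} {n : ℕ} (An : CDGDeformation A n)

/-! ### The model structure -/

/-- The model structure on the category of cdg modules over a deformation whose weak equivalences
are the `n`-quasi-isomorphisms. -/
@[reducible]
def modelCategory : ModelCategory (CDGModule An.toCDGAlgebra) :=
  letI : CategoryWithFibrations (CDGModule An.toCDGAlgebra) := ⟨An.kerSurjections⟩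
  letI : CategoryWithCofibrations (CDGModule An.toCDGAlgebra) :=
    ⟨An.generatingCofibrations.rlp.llp⟩
  letI : CategoryWithWeakEquivalences (CDGModule An.toCDGAlgebra) := ⟨An.nQuasiIsos⟩
  haveI : (weakEquivalences (CDGModule An.toCDGAlgebra)).HasTwoOutOfThreeProperty :=
    inferInstanceAs An.nQuasiIsos.HasTwoOutOfThreeProperty
  haveI : MorphismProperty.IsWeakFactorizationSystem (cofibrations (CDGModule An.toCDGAlgebra))
      (trivialFibrations (CDGModule An.toCDGAlgebra)) := by
    change MorphismProperty.IsWeakFactorizationSystem An.generatingCofibrations.rlp.llp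
      (An.kerSurjections ⊓ An.nQuasiIsos)
    rw [← generatingCofibrations_rlp]
    exact isWeakFactorizationSystem_llp_rlp _
  haveI : MorphismProperty.IsWeakFactorizationSystem
      (trivialCofibrations (CDGModule An.toCDGAlgebra))
      (fibrations (CDGModule An.toCDGAlgebra)) := by
    change MorphismProperty.IsWeakFactorizationSystem
      (An.generatingCofibrations.rlp.llp ⊓ An.nQuasiIsos) An.kerSurjections
    rw [← generatingTrivialCofibrations_rlp_llp, ← generatingTrivialCofibrations_rlp]
    exact isWeakFactorizationSystem_llp_rlp _
  -- Closure of the weak equivalences under retracts is not checked separately: it follows from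
  -- two-out-of-three and the two weak factorization systems.
  ModelCategory.mk' _

end CDGDeformation

end Curved
end

theorem mainTheorem11 {k : Type v} [CommRing k] (A : Curved.DGAlgebra.{v, u} k) (n : ℕ)
    (An : Curved.CDGDeformation A n) :
    ∃ _ : HomotopicalAlgebra.ModelCategory (Curved.CDGModule An.toCDGAlgebra),
      Curved.IsCofibrantlyGenerated (Curved.CDGModule An.toCDGAlgebra) ∧
      (∀ {M N : Curved.CDGModule An.toCDGAlgebra} (f : M ⟶ N),
        HomotopicalAlgebra.WeakEquivalence f ↔ An.IsNQuasiIso f) ∧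
      (∀ {M N : Curved.CDGModule An.toCDGAlgebra} (f : M ⟶ N),
        HomotopicalAlgebra.Fibration f ↔ ∀ i : ℕ, 1 ≤ i → i ≤ n + 1 →
          Set.SurjOn (Curved.CDGModule.linearMap f) (An.kerTPow M i) (An.kerTPow N i)) ∧
      (∀ Q : Curved.CDGModule An.toCDGAlgebra,
        HomotopicalAlgebra.IsCofibrant Q ↔
          ∃ P : Curved.CDGModule An.toCDGAlgebra,
            An.IsNSemifree P ∧ Nonempty (CategoryTheory.Retract Q P)) ∧
      (∀ {M N : Curved.CDGModule An.toCDGAlgebra} (f : M ⟶ N),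
        HomotopicalAlgebra.Cofibration f ↔
          Curved.CDGModule.IsGradedSplitInjection f ∧
            HomotopicalAlgebra.IsCofibrant (Curved.CDGModule.coker f)) := by 
  let := An.modelCategory
  refine ⟨An.modelCategory, ?_, fun f => HomotopicalAlgebra.weakEquivalence_iff f,
    fun f => HomotopicalAlgebra.fibration_iff f, fun Q => ?_, fun f => ?_⟩
  · exact ⟨An.generatingCofibrations, An.generatingTrivialCofibrations, inferInstance,
      inferInstance, An.generatingCofibrations_rlp.symm, An.generatingTrivialCofibrations_rlp.symm⟩
  · rw [HomotopicalAlgebra.isCofibrant_iff, HomotopicalAlgebra.cofibration_iff]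
    exact Curved.CDGDeformation.llp_initial_iff_exists_retract Q
  · rw [HomotopicalAlgebra.isCofibrant_iff, HomotopicalAlgebra.cofibration_iff,
      HomotopicalAlgebra.cofibration_iff]
    exact Curved.CDGDeformation.generatingCofibrations_llp_iff f
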